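/- All categories are small. An \emph{elementary existential doctrine} is a functor $P:\mathcal C^{\mathrm{op}}\to\mathbf{InfSL}$ from the opposite of a category $\mathcal C$ with finite products (terminal object included) to inf-semilattices with top and their homomorphisms; write $P_f$ for its action on an arrow $f$. It is required that: (Elementary) for each $A$ there is $\delta_A\in P(A\times A)$ such that $\alpha\mapsto P_{\mathrm{pr}_1}(\alpha)\wedge\delta_A$ is left adjoint to $P_{\langle \mathrm{id},\mathrm{id}\rangle}$ and, for all $X,A$, $\alpha\mapsto P_{\langle\mathrm{pr}_1,\mathrm{pr}_2\rangle}(\alpha)\wedge P_{\langle\mathrm{pr}_2,\mathrm{pr}_3\rangle}(\delta_A)$ is left adjoint to $P_{\langle\mathrm{pr}_1,\mathrm{pr}_2,\mathrm{pr}_2\rangle}:P(X\times A\times A)\to P(X\times A)$; (Existential) for each product projection $\mathrm{pr}$, $P_{\mathrm{pr}}$ has a left adjoint $\exists_{\mathrm{pr}}$, and these satisfy the Beck--Chevalley condition for pullbacks of projections and Frobenius reciprocity. These are the objects of the 2-category $\mathbf{EED}$. A 1-arrow $P\to R$ is a pair $(F,b)$ of a functor $F$ preserving finite products and a natural transformation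 $b:P\to R\circ F^{\mathrm{op}}$ such that $b_{A\times A}(\delta_A)=R_{\langle F\mathrm{pr}_1,F\mathrm{pr}_2\rangle}(\delta_{FA})$ and $b(\exists_{\mathrm{pr}}\alpha)=\exists_{F\mathrm{pr}}\,b(\alpha)$ for all projections $\mathrm{pr}$. A 2-arrow $(F,b)\to(G,c)$ is a natural transformation $\theta:F\to G$ with $b_A(\alpha)\le R_{\theta_A}(c_A(\alpha))$ for all $A$ and all $\alpha\in P(A)$. Let $\mathbf{Xct}$ be the 2-category of (Barr-)exact categories, regular functors (functors preserving finite limits and regular epimorphisms) and natural transformations. Let $\mathrm{Sub}:\mathbf{Xct}\to\mathbf{EED}$ be the 2-functor that sends an exact category to its doctrine of subobjects. For an elementary existential doctrine $P$ let $\mathcal T_P$ be the following category. Its objects are the pairs $(A,\rho)$ with $\rho\in P(A\times A)$ such that $\rho\le P_{\langle p_2,p_1\rangle}(\rho)$ and $P_{\langle p_1,p_2\rangle}(\rho)\wedge P_{\langle p_2,p_3\rangle}(\rho)\le P_{\langle p_1,p_3\rangle}(\rho)$. An arrow $(A,\rho)\to(B,\sigma)$ is an element $\phi\in P(A\times B)$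 such that (i) $\phi\le P_{\langle p_1,p_1\rangle}(\rho)\wedge P_{\langle p_2,p_2\rangle}(\sigma)$ in $P(A\times B)$; (ii) $P_{\langle p_1,p_2\rangle}(\rho)\wedge P_{\langle p_2,p_3\rangle}(\phi)\le P_{\langle p_1,p_3\rangle}(\phi)$ in $P(A\times A\times B)$; (iii) $P_{\langle p_1,p_2\rangle}(\phi)\wedge P_{\langle p_2,p_3\rangle}(\sigma)\le P_{\langle p_1,p_3\rangle}(\phi)$ in $P(A\times B\times B)$; (iv) $P_{\langle p_1,p_2\rangle}(\phi)\wedge P_{\langle p_1,p_3\rangle}(\phi)\le P_{\langle p_2,p_3\rangle}(\sigma)$ in $P(A\times B\times B)$; (v) $P_{\langle\mathrm{id},\mathrm{id}\rangle}(\rho)\le\exists_{p_1}(\phi)$ in $P(A)$, where $p_1:A\times B\to A$. The composite of $\phi:(A,\rho)\to(B,\sigma)$ and $\psi:(B,\sigma)\to(C,\tau)$ is $\exists_{\langle p_1,p_3\rangle}\bigl(P_{\langle p_1,p_2\rangle}(\phi)\wedge P_{\langle p_2,p_3\rangle}(\psi)\bigr)$, where the $p_i$ are the projections from $A\times B\times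 C$; the identity of $(A,\rho)$ is $\rho$. \textbf{Statement.} For every elementary existential doctrine $P$ the category $\mathcal T_P$ is exact, and the 2-functor $\mathrm{Sub}:\mathbf{Xct}\to\mathbf{EED}$ has a left biadjoint whose value at each elementary existential doctrine $P$ is $\mathcal T_P$. That is, there are a pseudofunctor $L:\mathbf{EED}\to\mathbf{Xct}$ with $L(P)=\mathcal T_P$ for all $P$ and a pseudonatural transformation $\eta:\mathrm{Id}\to\mathrm{Sub}\circ L$ such that, for every $P$ and every exact category $\mathcal X$, the functor $\mathbf{Xct}(\mathcal T_P,\mathcal X)\to\mathbf{EED}(P,\mathrm{Sub}_{\mathcal X})$, $G\mapsto \mathrm{Sub}(G)\circ\eta_P$, is an equivalence of categories. -/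

import Mathlib

set_option linter.unusedVariables false

open CategoryTheory CategoryTheory.Limits Opposite

universe v u w

namespace ExactCompletion

noncomputable section

/-! ## Doctrines -/

theorem sandwich {A : Type*} [Category* A] {X Y : A} (f : X ⟶ Y) : f = 𝟙 X ≫ f ≫ 𝟙 Y := by
  simp

section Doctrine

variable {C : Type u} [Category.{v} C]

/-- The action `P_f : P(B) → P(A)` of an indexed inf-semilattice on an arrow `f : A ⟶ B`. -/
def pull (P : Cᵒᵖ ⥤ SemilatInfCat.{w}) {A B : C} (f : A ⟶ B) (β : P.obj (op B)) :
    P.obj (op A) :=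
  P.map f.op β

variable (P : Cᵒᵖ ⥤ SemilatInfCat.{w})

theorem pull_inf {A B : C} (f : A ⟶ B) (α β : P.obj (op B)) :
    pull P f (α ⊓ β) = pull P f α ⊓ pull P f β :=
  map_inf (ConcreteCategory.hom (P.map f.op)) α β

theorem pull_top {A B : C} (f : A ⟶ B) : pull P f ⊤ = ⊤ :=
  map_top (ConcreteCategory.hom (P.map f.op))

theorem pull_mono {A B : C} (f : A ⟶ B) {α β : P.obj (op B)} (h : α ≤ β) :
    pull P f α ≤ pull P f β := by
  rw [← inf_eq_left] at h ⊢
  rw [← pull_inf, h]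

theorem pull_id {A : C} (α : P.obj (op A)) : pull P (𝟙 A) α = α := by
  simp [pull]

theorem pull_pull {A B D : C} (f : A ⟶ B) (g : B ⟶ D) (α : P.obj (op D)) :
    pull P f (pull P g α) = pull P (f ≫ g) α := by
  simp [pull]

/-- An arrow is a projection if it is a leg of some binary product diagram. -/
def IsProj {X A : C} (p : X ⟶ A) : Prop :=
  ∃ (B : C) (q : X ⟶ B), Nonempty (IsLimit (BinaryFan.mk p q))

/-- Functors preserving finite products preserve projections. -/
theorem IsProj.map {D : Type*} [Category* D] (F : C ⥤ D) [PreservesFiniteProducts F]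
    {X A : C} {p : X ⟶ A} (hp : IsProj p) : IsProj (F.map p) := by
  obtain ⟨B, q, ⟨h⟩⟩ := hp
  exact ⟨F.obj B, F.map q, ⟨mapIsLimitOfPreservesOfIsLimit F p q h⟩⟩

variable [HasFiniteProducts C]

theorem isProj_fst (A B : C) : IsProj (prod.fst : A ⨯ B ⟶ A) :=
  ⟨B, prod.snd, ⟨prodIsProd A B⟩⟩

/-- The projection `⟨p₁, p₂⟩ : A × B × C ⟶ A × B`. -/
abbrev p12 (A B D : C) : (A ⨯ B) ⨯ D ⟶ A ⨯ B := prod.fst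

/-- The projection `⟨p₂, p₃⟩ : A × B × C ⟶ B × C`. -/
abbrev p23 (A B D : C) : (A ⨯ B) ⨯ D ⟶ B ⨯ D := prod.lift (prod.fst ≫ prod.snd) prod.snd

/-- The projection `⟨p₁, p₃⟩ : A × B × C ⟶ A × C`. -/
abbrev p13 (A B D : C) : (A ⨯ B) ⨯ D ⟶ A ⨯ D := prod.lift (prod.fst ≫ prod.fst) prod.snd

theorem isProj_p13 (A B D : C) : IsProj (p13 A B D) := by
  refine ⟨B, prod.fst ≫ prod.snd, ⟨BinaryFan.IsLimit.mk _
    (fun f g => prod.lift (prod.lift (f ≫ prod.fst) g) (f ≫ prod.snd))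
    (fun f g => ?_) (fun f g => ?_) (fun f g m h₁ h₂ => ?_)⟩⟩
  · apply prod.hom_ext <;> simp [prod.lift_fst, prod.lift_fst_assoc, prod.lift_snd]
  · simp [prod.lift_snd, prod.lift_fst_assoc]
  · change _ ⟶ (A ⨯ B) ⨯ D at m
    change m ≫ p13 A B D = f at h₁
    change m ≫ prod.fst ≫ prod.snd = g at h₂
    subst h₁ h₂
    apply prod.hom_ext
    · apply prod.hom_ext <;> simp [prod.lift_fst, prod.lift_snd]
    · simp [prod.lift_snd]

/-- The structure of an elementary doctrine on an indexed inf-semilattice. -/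
structure Elementary where
  /-- The equality predicate `δ_A ∈ P(A × A)`. -/
  δ (A : C) : P.obj (op (A ⨯ A))
  /-- `α ↦ P_{pr₁}(α) ∧ δ_A` is left adjoint to `P_{⟨id, id⟩}`. -/
  adj_diag (A : C) : GaloisConnection
    (fun α : P.obj (op A) => pull P (prod.fst : A ⨯ A ⟶ A) α ⊓ δ A)
    (pull P (prod.lift (𝟙 A) (𝟙 A)))
  /-- `α ↦ P_{⟨pr₁, pr₂⟩}(α) ∧ P_{⟨pr₂, pr₃⟩}(δ_A)` is left adjoint to `P_e`, where
  `e = ⟨pr₁, pr₂, pr₂⟩ : X × A ⟶ X × A × A`. -/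
  adj_param (X A : C) : GaloisConnection
    (fun α : P.obj (op (X ⨯ A)) => pull P (p12 X A A) α ⊓ pull P (p23 X A A) (δ A))
    (pull P (prod.lift (𝟙 (X ⨯ A)) prod.snd))

/-- The structure of an existential doctrine on an indexed inf-semilattice: left adjoints to
reindexing along projections, with the Beck-Chevalley condition and Frobenius reciprocity. -/
structure Existential where
  /-- The left adjoint `∃_p` along a projection `p`. -/
  ex {X A : C} (p : X ⟶ A) (hp : IsProj p) : P.obj (op X) → P.obj (op A)
  adj {X A : C} (p : X ⟶ A) (hp : IsProj p) : GaloisConnection (ex p hp) (pull P p)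
  /-- Beck-Chevalley, for pullbacks of projections (`p'` is then automatically a projection). -/
  beckChevalley {X' A' X A : C} {p' : X' ⟶ A'} {f' : X' ⟶ X} {f : A' ⟶ A} {p : X ⟶ A}
    (sq : IsPullback p' f' f p) (hp : IsProj p) (hp' : IsProj p') (β : P.obj (op X)) :
    ex p' hp' (pull P f' β) = pull P f (ex p hp β)
  frobenius {X A : C} (p : X ⟶ A) (hp : IsProj p) (α : P.obj (op A)) (β : P.obj (op X)) :
    ex p hp (pull P p α ⊓ β) = α ⊓ ex p hp β

end Doctrine

/-- A (small) elementary existential doctrine: an indexed inf-semilattice on a category with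
finite products, which is both elementary and existential. -/
structure EED : Type (u + 1) where
  C : Type u
  [cat : SmallCategory C]
  [prods : HasFiniteProducts C]
  P : Cᵒᵖ ⥤ SemilatInfCat.{u}
  el : Elementary P
  ext : Existential P

namespace EED

attribute [instance] cat prods

/-- The fibre of a doctrine at `A`. -/
abbrev fib (D : EED.{u}) (A : D.C) : Type u := D.P.obj (op A)

/-- A 1-arrow `(F, b)` of elementary existential doctrines: `F` preserves finite products, `b`
preserves finite meets, equality predicates and existential quantification along projections. -/
structure Hom (D E : EED.{u}) where
  F : D.C ⥤ E.C
  [pres : PreservesFiniteProducts F]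
  /-- A natural family of homomorphisms of inf-semilattices (with top). -/
  b : D.P ⟶ F.op ⋙ E.P
  map_δ (A : D.C) : b.app (op (A ⨯ A)) (D.el.δ A) =
    pull E.P (prod.lift (F.map prod.fst) (F.map prod.snd)) (E.el.δ (F.obj A))
  map_ex {X A : D.C} (p : X ⟶ A) (hp : IsProj p) (α : D.fib X) :
    b.app (op A) (D.ext.ex p hp α) = E.ext.ex (F.map p) (hp.map F) (b.app (op X) α)

attribute [instance] Hom.pres

/-- The component `b_A : P(A) → R(F A)` of a 1-arrow `(F, b) : P ⟶ R`. -/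
def Hom.app {D E : EED.{u}} (f : Hom D E) {A : D.C} (α : D.fib A) : E.fib (f.F.obj A) :=
  f.b.app (op A) α

theorem Hom.app_pull {D E : EED.{u}} (f : Hom D E) {A B : D.C} (g : A ⟶ B) (α : D.fib B) :
    f.app (pull D.P g α) = pull E.P (f.F.map g) (f.app α) :=
  ConcreteCategory.congr_hom (f.b.naturality g.op) α

theorem Hom.app_mono {D E : EED.{u}} (f : Hom D E) {A : D.C} {α β : D.fib A} (h : α ≤ β) :
    f.app α ≤ f.app β :=
  OrderHomClass.mono (ConcreteCategory.hom (f.b.app (op A))) h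

/-- A 2-arrow `θ : (F, b) ⟶ (G, c)`: a natural transformation `θ : F ⟶ G` such that
`b_A(α) ≤ R_{θ_A}(c_A(α))`. -/
@[ext]
structure Hom₂ {D E : EED.{u}} (f g : Hom D E) where
  θ : f.F ⟶ g.F
  le (A : D.C) (α : D.fib A) : f.app α ≤ pull E.P (θ.app A) (g.app α)

instance (D E : EED.{u}) : Category (Hom D E) where
  Hom f g := Hom₂ f g
  id f := ⟨𝟙 f.F, fun A α => by simp [pull_id]⟩
  comp s t := ⟨s.θ ≫ t.θ, fun A α => by
    refine (s.le A α).trans ?_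
    rw [NatTrans.comp_app, ← pull_pull]
    exact pull_mono _ _ (t.le A α)⟩
  id_comp s := Hom₂.ext (Category.id_comp s.θ)
  comp_id s := Hom₂.ext (Category.comp_id s.θ)
  assoc s t r := Hom₂.ext (Category.assoc s.θ t.θ r.θ)

/-- The identity 1-arrow. -/
@[simps]
def Hom.id (D : EED.{u}) : Hom D D where
  F := 𝟭 D.C
  b := { app := fun A => 𝟙 (D.P.obj A) }
  map_δ A := by
    have : prod.lift ((𝟭 D.C).map (prod.fst : A ⨯ A ⟶ A)) ((𝟭 D.C).map prod.snd) =
      𝟙 (A ⨯ A) := by apply prod.hom_ext <;> simp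
    erw [this, pull_id]
    rfl
  map_ex p hp α := rfl

/-- Composition of 1-arrows. -/
@[simps]
def Hom.comp {D E K : EED.{u}} (f : Hom D E) (g : Hom E K) : Hom D K where
  F := f.F ⋙ g.F
  b := f.b ≫ Functor.whiskerLeft f.F.op g.b
  map_δ A := by
    have h₁ : (f.b ≫ Functor.whiskerLeft f.F.op g.b).app (op (A ⨯ A)) (D.el.δ A) =
      g.app (f.app (D.el.δ A)) := rfl
    have h₂ : f.app (D.el.δ A) = _ := f.map_δ A
    have h₃ : g.app (E.el.δ (f.F.obj A)) = _ := g.map_δ (f.F.obj A)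
    rw [h₁, h₂, Hom.app_pull, h₃, pull_pull]
    congr 1
    rw [prod.comp_lift]
    simp [← Functor.map_comp, prod.lift_fst, prod.lift_snd]
  map_ex p hp α := by
    have h₂ := f.map_ex p hp α
    have h₃ := g.map_ex (f.F.map p) (hp.map f.F) (f.app α)
    exact (congrArg (fun x => g.app x) h₂).trans h₃

/-- An invertible 2-arrow from an invertible natural transformation. -/
def isoMk {D E : EED.{u}} (f g : Hom D E) (e : f.F ≅ g.F)
    (h : ∀ (A : D.C) (α : D.fib A), f.app α = pull E.P (e.hom.app A) (g.app α)) : f ≅ g where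
  hom := (⟨e.hom, fun A α => (h A α).le⟩ : Hom₂ f g)
  inv := (⟨e.inv, fun A α => by rw [h, pull_pull]; simp [pull_id]⟩ : Hom₂ g f)
  hom_inv_id := Hom₂.ext e.hom_inv_id
  inv_hom_id := Hom₂.ext e.inv_hom_id

/-- Left whiskering of a 2-arrow. -/
def whiskerLeft {D E K : EED.{u}} (f : Hom D E) {g h : Hom E K} (η : Hom₂ g h) :
    Hom₂ (f.comp g) (f.comp h) where
  θ := Functor.whiskerLeft f.F η.θ
  le A α := η.le (f.F.obj A) (f.app α)

/-- Right whiskering of a 2-arrow. -/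
def whiskerRight {D E K : EED.{u}} {f g : Hom D E} (η : Hom₂ f g) (h : Hom E K) :
    Hom₂ (f.comp h) (g.comp h) where
  θ := Functor.whiskerRight η.θ h.F
  le A α := by
    refine (h.app_mono (η.le A α)).trans ?_
    rw [Hom.app_pull]
    rfl

/-- The 2-category of elementary existential doctrines. -/
instance : Bicategory EED.{u} where
  Hom := Hom
  id := Hom.id
  comp := Hom.comp
  homCategory D E := inferInstanceAs (Category (Hom D E))
  whiskerLeft := whiskerLeft
  whiskerRight := whiskerRight
  associator f g h := isoMk ((f.comp g).comp h) (f.comp (g.comp h))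
    (Functor.associator f.F g.F h.F) (fun A α => (pull_id _ _).symm)
  leftUnitor {D E} f := isoMk ((Hom.id D).comp f) f
    (Functor.leftUnitor f.F) (fun A α => (pull_id _ _).symm)
  rightUnitor {D E} f := isoMk (f.comp (Hom.id E)) f
    (Functor.rightUnitor f.F) (fun A α => (pull_id _ _).symm)
  whiskerLeft_id f g := Hom₂.ext (Functor.whiskerLeft_id f.F)
  whiskerLeft_comp f _ _ _ η θ := Hom₂.ext (Functor.whiskerLeft_comp f.F η.θ θ.θ)
  id_whiskerLeft η := Hom₂.ext (NatTrans.ext (funext fun _ => sandwich _))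
  comp_whiskerLeft f g _ _ η := Hom₂.ext (NatTrans.ext (funext fun _ => sandwich _))
  id_whiskerRight f g := Hom₂.ext (Functor.whiskerRight_id' g.F)
  comp_whiskerRight η θ i := Hom₂.ext (Functor.whiskerRight_comp η.θ θ.θ i.F)
  whiskerRight_id η := Hom₂.ext (NatTrans.ext (funext fun _ => sandwich _))
  whiskerRight_comp η g h := Hom₂.ext (NatTrans.ext (funext fun _ => sandwich _))
  whisker_assoc f _ _ η h := Hom₂.ext (NatTrans.ext (funext fun _ => sandwich _))
  whisker_exchange η θ :=
    Hom₂.ext (NatTrans.ext (funext fun X => (θ.θ.naturality (η.θ.app X)).symm))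
  pentagon f g h i := Hom₂.ext (Functor.pentagon f.F g.F h.F i.F)
  triangle f g := Hom₂.ext (Functor.triangle f.F g.F)

end EED

/-! ## Exact categories -/

/-- A (Barr-)exact category: a regular category in which every internal equivalence relation is
effective. -/
class ExactCategory (C : Type u) [Category.{v} C] : Prop extends Regular C where
  effective {R A : C} (p₁ p₂ : R ⟶ A) [IsEquivalenceRelation p₁ p₂] :
    IsEffectiveEquivalenceRelation p₁ p₂

/-- A (small) exact category. -/
structure Xct : Type (u + 1) where
  C : Type u
  [cat : SmallCategory C]
  [exact : ExactCategory C]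

namespace Xct

attribute [instance] cat exact

/-- A regular functor: it preserves finite limits and regular epimorphisms. -/
structure Hom (X Y : Xct.{u}) where
  F : X.C ⥤ Y.C
  [lex : PreservesFiniteLimits F]
  map_regularEpi {A B : X.C} (e : A ⟶ B) [IsRegularEpi e] : IsRegularEpi (F.map e)

attribute [instance] Hom.lex

/-- A 2-arrow between regular functors is a natural transformation. -/
@[ext]
structure Hom₂ {X Y : Xct.{u}} (f g : Hom X Y) where
  θ : f.F ⟶ g.F

instance (X Y : Xct.{u}) : Category (Hom X Y) where
  Hom f g := Hom₂ f g
  id f := ⟨𝟙 f.F⟩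
  comp s t := ⟨s.θ ≫ t.θ⟩
  id_comp s := Hom₂.ext (Category.id_comp s.θ)
  comp_id s := Hom₂.ext (Category.comp_id s.θ)
  assoc s t r := Hom₂.ext (Category.assoc s.θ t.θ r.θ)

/-- The identity regular functor. -/
def Hom.id (X : Xct.{u}) : Hom X X where
  F := 𝟭 X.C
  map_regularEpi _ h := h

/-- Composition of regular functors. -/
def Hom.comp {X Y Z : Xct.{u}} (f : Hom X Y) (g : Hom Y Z) : Hom X Z where
  F := f.F ⋙ g.F
  lex := comp_preservesFiniteLimits f.F g.F
  map_regularEpi e _ :=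
    have := f.map_regularEpi e
    g.map_regularEpi (f.F.map e)

/-- An invertible 2-arrow from an invertible natural transformation. -/
def isoMk {X Y : Xct.{u}} (f g : Hom X Y) (e : f.F ≅ g.F) : f ≅ g where
  hom := (⟨e.hom⟩ : Hom₂ f g)
  inv := (⟨e.inv⟩ : Hom₂ g f)
  hom_inv_id := Hom₂.ext e.hom_inv_id
  inv_hom_id := Hom₂.ext e.inv_hom_id

/-- The 2-category of exact categories, regular functors and natural transformations. -/
instance : Bicategory Xct.{u} where
  Hom := Hom
  id := Hom.id
  comp := Hom.comp
  homCategory X Y := inferInstanceAs (Category (Hom X Y))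
  whiskerLeft f _ _ η := (⟨Functor.whiskerLeft f.F η.θ⟩ : Hom₂ (f.comp _) (f.comp _))
  whiskerRight η h := (⟨Functor.whiskerRight η.θ h.F⟩ : Hom₂ (Hom.comp _ h) (Hom.comp _ h))
  associator f g h := isoMk ((f.comp g).comp h) (f.comp (g.comp h))
    (Functor.associator f.F g.F h.F)
  leftUnitor {X Y} f := isoMk ((Hom.id X).comp f) f (Functor.leftUnitor f.F)
  rightUnitor {X Y} f := isoMk (f.comp (Hom.id Y)) f (Functor.rightUnitor f.F)
  whiskerLeft_id f g := Hom₂.ext (Functor.whiskerLeft_id f.F)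
  whiskerLeft_comp f _ _ _ η θ := Hom₂.ext (Functor.whiskerLeft_comp f.F η.θ θ.θ)
  id_whiskerLeft η := Hom₂.ext (NatTrans.ext (funext fun _ => sandwich _))
  comp_whiskerLeft f g _ _ η := Hom₂.ext (NatTrans.ext (funext fun _ => sandwich _))
  id_whiskerRight f g := Hom₂.ext (Functor.whiskerRight_id' g.F)
  comp_whiskerRight η θ i := Hom₂.ext (Functor.whiskerRight_comp η.θ θ.θ i.F)
  whiskerRight_id η := Hom₂.ext (NatTrans.ext (funext fun _ => sandwich _))
  whiskerRight_comp η g h := Hom₂.ext (NatTrans.ext (funext fun _ => sandwich _))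
  whisker_assoc f _ _ η h := Hom₂.ext (NatTrans.ext (funext fun _ => sandwich _))
  whisker_exchange η θ :=
    Hom₂.ext (NatTrans.ext (funext fun X => (θ.θ.naturality (η.θ.app X)).symm))
  pentagon f g h i := Hom₂.ext (Functor.pentagon f.F g.F h.F i.F)
  triangle f g := Hom₂.ext (Functor.triangle f.F g.F)

end Xct

/-! ## The doctrine of subobjects -/

section Sub

variable (C : Type u) [Category.{v} C]

/-- The indexed inf-semilattice of subobjects; arrows act by pullback. -/
def subFunctor [HasPullbacks C] : Cᵒᵖ ⥤ SemilatInfCat.{max u v} where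
  obj A := SemilatInfCat.of (Subobject A.unop)
  map f := ConcreteCategory.ofHom (C := SemilatInfCat)
    { toFun := (Subobject.pullback f.unop).obj
      map_inf' := Subobject.inf_pullback f.unop
      map_top' := Subobject.pullback_top f.unop }
  map_id A := by
    apply ConcreteCategory.hom_ext
    exact fun S => Subobject.pullback_id S
  map_comp f g := by
    apply ConcreteCategory.hom_ext
    exact fun S => Subobject.pullback_comp g.unop f.unop S

variable {C}

theorem sub_le_iff {A : C} (S T : Subobject A) :
    S ≤ T ↔ ∀ ⦃Z : C⦄ (g : Z ⟶ A), S.Factors g → T.Factors g := by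
  refine ⟨fun h Z g => Subobject.factors_of_le g h, fun h => ?_⟩
  have := h S.arrow S.factors_self
  exact Subobject.le_of_comm (T.factorThru _ this) (by simp)

theorem mk_factors {A B Z : C} (m : A ⟶ B) [Mono m] (g : Z ⟶ B) :
    (Subobject.mk m).Factors g ↔ ∃ h, h ≫ m = g :=
  Iff.rfl

theorem pullback_factors [HasPullbacks C] {A B Z : C} (f : A ⟶ B) (T : Subobject B)
    (g : Z ⟶ A) : ((Subobject.pullback f).obj T).Factors g ↔ T.Factors (g ≫ f) :=
  Limits.pullback_factors_iff f T g

theorem sub_adj [HasPullbacks C] {Y Z : C} (e : Y ⟶ Z) (r : Z ⟶ Y) (her : e ≫ r = 𝟙 Y)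
    (E : Subobject Z) (hE : ∀ {W : C} (g : W ⟶ Z), E.Factors g ↔ g ≫ r ≫ e = g) :
    GaloisConnection (fun α : Subobject Y => (Subobject.pullback r).obj α ⊓ E)
      (Subobject.pullback e).obj := by
  intro α β
  simp only [sub_le_iff, pullback_factors, Subobject.inf_factors, hE]
  constructor
  · intro h W g hg
    exact h (g ≫ e) ⟨by simpa [her] using hg, by simp [reassoc_of% her]⟩
  · rintro h W g ⟨hg, hg'⟩
    have := h _ hg
    rwa [Category.assoc, hg'] at this

/-- The elementary structure on subobjects: `δ_A` is the diagonal. -/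
def subElementary (C : Type u) [Category.{v} C] [HasFiniteLimits C] :
    Elementary (subFunctor C) where
  δ A := Subobject.mk (prod.lift (𝟙 A) (𝟙 A))
  adj_diag A := by
    refine sub_adj (prod.lift (𝟙 A) (𝟙 A)) prod.fst (by simp [prod.lift_fst]) _ (fun g => ?_)
    rw [mk_factors]
    constructor
    · rintro ⟨h, rfl⟩
      simp [prod.lift_fst]
    · exact fun h => ⟨g ≫ prod.fst, by simpa using h⟩
  adj_param X A := by
    refine sub_adj (prod.lift (𝟙 (X ⨯ A)) prod.snd) prod.fst (by simp [prod.lift_fst]) _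
      (fun g => ?_)
    change ((Subobject.pullback (p23 X A A)).obj
      (Subobject.mk (prod.lift (𝟙 A) (𝟙 A)))).Factors g ↔ _
    rw [pullback_factors, mk_factors]
    constructor
    · rintro ⟨h, hh⟩
      have h₁ := congrArg (· ≫ prod.fst) hh
      have h₂ := congrArg (· ≫ prod.snd) hh
      simp only [Category.assoc, prod.lift_fst, prod.lift_snd, Category.comp_id] at h₁ h₂
      apply prod.hom_ext
      · simp [prod.lift_fst]
      · simp [prod.lift_snd, ← h₁, ← h₂]
    · intro h
      refine ⟨g ≫ prod.snd, ?_⟩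
      have h₂ := congrArg (· ≫ prod.snd) h
      simp only [Category.assoc, prod.lift_snd] at h₂
      apply prod.hom_ext
      · simp [prod.lift_fst, h₂]
      · simp [prod.lift_snd]

theorem strongEpi_fac_factors {X Y A : C} (e : X ⟶ Y) [StrongEpi e] (m : Y ⟶ A)
    (T : Subobject A) (h : T.Factors (e ≫ m)) : T.Factors m := by
  have sq : CommSq (T.factorThru _ h) e T.arrow m := ⟨by simp⟩
  have := Subobject.factors_comp_arrow (P := T) sq.lift
  rwa [sq.fac_right] at this

/-- The direct image of `S` along `f` is given by any factorization of `S ⟶ A ⟶ B` as a strong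
epimorphism followed by a monomorphism. -/
theorem exists_eq_mk [HasPullbacks C] [HasImages C] {A B I : C} (f : A ⟶ B) (S : Subobject A)
    (e : (S : C) ⟶ I) [StrongEpi e] (m : I ⟶ B) [Mono m] (h : e ≫ m = S.arrow ≫ f) :
    (Subobject.exists f).obj S = Subobject.mk m := by
  have key : ∀ T, (Subobject.exists f).obj S ≤ T ↔ Subobject.mk m ≤ T := by
    intro T
    rw [(Subobject.existsPullbackAdj f).gc S T, sub_le_iff, sub_le_iff]
    simp only [pullback_factors]
    constructor
    · rintro hS W g ⟨k, rfl⟩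
      have h₁ := hS S.arrow S.factors_self
      rw [← h] at h₁
      exact Subobject.factors_of_factors_right k (strongEpi_fac_factors e m T h₁)
    · intro hT W g hg
      have h₁ := Subobject.factors_of_factors_right (S.factorThru g hg ≫ e)
        (hT m (Subobject.mk_factors_self m))
      rw [Category.assoc, h] at h₁
      simpa using h₁
  exact le_antisymm ((key _).2 le_rfl) ((key _).1 le_rfl)

theorem exists_mk_eq_mk [HasPullbacks C] [HasImages C] {A B I J : C} (f : A ⟶ B) (i : J ⟶ A)
    [Mono i] (e : J ⟶ I) [StrongEpi e] (m : I ⟶ B) [Mono m] (h : e ≫ m = i ≫ f) :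
    (Subobject.exists f).obj (Subobject.mk i) = Subobject.mk m :=
  exists_eq_mk f (Subobject.mk i) ((Subobject.underlyingIso i).hom ≫ e) m
    (by rw [Category.assoc, h, ← Category.assoc, Subobject.underlyingIso_hom_comp_eq_mk])

/-- A factorization of `S ⟶ A ⟶ B` as a regular epimorphism followed by a monomorphism. -/
theorem exists_fac [Regular C] {A B : C} (f : A ⟶ B) (S : Subobject A) :
    ∃ (I : C) (e : (S : C) ⟶ I) (m : I ⟶ B), IsRegularEpi e ∧ Mono m ∧ e ≫ m = S.arrow ≫ f :=
  let F := Regular.strongEpiMonoFactorisation (S.arrow ≫ f)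
  ⟨F.I, F.e, F.m, inferInstance, inferInstance, F.fac⟩

theorem sub_beckChevalley [Regular C] {X' A' X A : C} {p' : X' ⟶ A'} {f' : X' ⟶ X}
    {f : A' ⟶ A} {p : X ⟶ A} (sq : IsPullback p' f' f p) (S : Subobject X) :
    (Subobject.exists p').obj ((Subobject.pullback f').obj S) =
      (Subobject.pullback f).obj ((Subobject.exists p).obj S) := by
  obtain ⟨I, e, m, he, hm, h⟩ := exists_fac p S
  rw [exists_eq_mk p S e m h]
  have sqI := IsPullback.of_hasPullback m f
  rw [Subobject.pullback_obj_mk sqI]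
  have sqS := (Subobject.isPullback f' S).paste_vert sq.flip
  rw [← h] at sqS
  let e' : (((Subobject.pullback f').obj S : Subobject X') : C) ⟶ pullback m f :=
    sqI.lift (Subobject.pullbackπ f' S ≫ e) (((Subobject.pullback f').obj S).arrow ≫ p')
      (by simpa using sqS.w)
  have he' : e' ≫ pullback.snd m f = ((Subobject.pullback f').obj S).arrow ≫ p' :=
    sqI.lift_snd _ _ _
  have sqe : IsPullback (Subobject.pullbackπ f' S) e' e (pullback.fst m f) := by
    rw [← he'] at sqS
    exact IsPullback.of_bot sqS (sqI.lift_fst _ _ _).symm sqI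
  have : IsRegularEpi e' := Regular.regularEpiIsStableUnderBaseChange.of_isPullback sqe he
  exact exists_eq_mk p' _ e' _ he'

/-- The existential structure on the subobjects of a regular category: direct images. -/
def subExistential (C : Type u) [Category.{v} C] [Regular C] :
    Existential (subFunctor C) where
  ex p _ := (Subobject.exists p).obj
  adj p _ := (Subobject.existsPullbackAdj p).gc
  beckChevalley sq _ _ S := sub_beckChevalley sq S
  frobenius p _ α β := by
    have := Regular.exists_inf_pullback_eq_exists_inf p β α
    refine Eq.trans ?_ (this.trans (inf_comm _ _))
    exact congrArg (Subobject.exists p).obj (inf_comm _ _)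

/-- The action of a left exact functor on subobjects. -/
def mapSub {D : Type*} [Category* D] (F : C ⥤ D) [PreservesFiniteLimits F] {A : C}
    (S : Subobject A) : Subobject (F.obj A) :=
  Subobject.mk (F.map S.arrow)

theorem mapSub_mk {D : Type*} [Category* D] (F : C ⥤ D) [PreservesFiniteLimits F] {A B : C}
    (m : A ⟶ B) [Mono m] : mapSub F (Subobject.mk m) = Subobject.mk (F.map m) :=
  Subobject.mk_eq_mk_of_comm _ _ (F.mapIso (Subobject.underlyingIso m))
    (by simp [← Functor.map_comp])

theorem mapSub_top {D : Type*} [Category* D] (F : C ⥤ D) [PreservesFiniteLimits F] (A : C) :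
    mapSub F (⊤ : Subobject A) = ⊤ :=
  Subobject.mk_eq_top_of_isIso _

theorem mapSub_pullback [HasFiniteLimits C] {D : Type*} [Category* D] [HasFiniteLimits D]
    (F : C ⥤ D) [PreservesFiniteLimits F] {A B : C} (f : A ⟶ B) (S : Subobject B) :
    mapSub F ((Subobject.pullback f).obj S) = (Subobject.pullback (F.map f)).obj (mapSub F S) :=
  (Subobject.pullback_obj_mk ((Subobject.isPullback f S).map F)).symm

theorem mapSub_inf [HasFiniteLimits C] {D : Type*} [Category* D] [HasFiniteLimits D]
    (F : C ⥤ D) [PreservesFiniteLimits F] {A : C} (S T : Subobject A) :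
    mapSub F (S ⊓ T) = mapSub F S ⊓ mapSub F T := by
  have sq := (Subobject.inf_isPullback S T).map F
  apply le_antisymm
  · refine le_inf ?_ ?_
    · exact Subobject.mk_le_mk_of_comm (F.map (Subobject.ofLE _ _ inf_le_left))
        (by simp [← Functor.map_comp])
    · exact Subobject.mk_le_mk_of_comm (F.map (Subobject.ofLE _ _ inf_le_right))
        (by simp [← Functor.map_comp])
  · rw [sub_le_iff]
    intro Z g hg
    obtain ⟨h₁, h₂⟩ := (Subobject.inf_factors g).1 hg
    obtain ⟨a, ha⟩ := (mk_factors (F.map S.arrow) g).1 h₁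
    obtain ⟨b, hb⟩ := (mk_factors (F.map T.arrow) g).1 h₂
    refine (mk_factors _ _).2 ⟨sq.lift a b (ha.trans hb.symm), ?_⟩
    have h₃ := sq.lift_fst a b (ha.trans hb.symm)
    have h₄ : F.map (S ⊓ T).arrow = F.map (Subobject.ofLE (S ⊓ T) S inf_le_left) ≫
        F.map S.arrow := by simp [← Functor.map_comp]
    rw [h₄, ← Category.assoc, h₃, ha]

variable (D : Type u) [Category.{v} D]

/-- The natural homomorphisms of inf-semilattices given by the action of a left exact functor on
subobjects. -/
def subNatTrans [HasFiniteLimits C] [HasFiniteLimits D] (F : C ⥤ D) [PreservesFiniteLimits F] :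
    subFunctor C ⟶ F.op ⋙ subFunctor D where
  app A := ConcreteCategory.ofHom (C := SemilatInfCat)
    (X := SemilatInfCat.of (Subobject A.unop))
    (Y := SemilatInfCat.of (Subobject (F.obj A.unop)))
    { toFun := mapSub F
      map_inf' := mapSub_inf F
      map_top' := mapSub_top F _ }
  naturality A B g := by
    apply ConcreteCategory.hom_ext
    exact fun S => mapSub_pullback F g.unop S

variable {D}

theorem mapSub_diag [HasFiniteLimits C] [HasFiniteLimits D] (F : C ⥤ D)
    [PreservesFiniteLimits F] (A : C) :
    mapSub F (Subobject.mk (prod.lift (𝟙 A) (𝟙 A))) =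
      (Subobject.pullback (prod.lift (F.map prod.fst) (F.map prod.snd))).obj
        (Subobject.mk (prod.lift (𝟙 (F.obj A)) (𝟙 (F.obj A)))) := by
  have hc : F.map (prod.lift (𝟙 A) (𝟙 A)) ≫ prod.lift (F.map prod.fst) (F.map prod.snd) =
      prod.lift (𝟙 (F.obj A)) (𝟙 (F.obj A)) := by
    rw [prod.comp_lift, ← F.map_comp, ← F.map_comp]
    simp [prod.lift_fst, prod.lift_snd]
  rw [mapSub_mk]
  refine (Subobject.pullback_obj_mk (f' := 𝟙 _) ?_).symm
  have : IsIso (prod.lift (F.map (prod.fst : A ⨯ A ⟶ A)) (F.map prod.snd)) :=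
    inferInstanceAs (IsIso (prodComparison F A A))
  exact IsPullback.of_horiz_isIso ⟨by simp [hc]⟩

theorem mapSub_exists [Regular C] [Regular D] (F : C ⥤ D) [PreservesFiniteLimits F]
    (hF : ∀ {A B : C} (e : A ⟶ B) [IsRegularEpi e], IsRegularEpi (F.map e))
    {A B : C} (p : A ⟶ B) (S : Subobject A) :
    mapSub F ((Subobject.exists p).obj S) =
      (Subobject.exists (F.map p)).obj (mapSub F S) := by
  obtain ⟨I, e, m, he, hm, h⟩ := exists_fac p S
  rw [exists_eq_mk p S e m h, mapSub_mk]
  have := hF e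
  exact (exists_mk_eq_mk (F.map p) (F.map S.arrow) (F.map e) (F.map m)
    (by rw [← F.map_comp, h, F.map_comp])).symm

theorem mapSub_le [HasFiniteLimits C] [HasFiniteLimits D] {F G : C ⥤ D}
    [PreservesFiniteLimits F] [PreservesFiniteLimits G] (θ : F ⟶ G) {A : C} (S : Subobject A) :
    mapSub F S ≤ (Subobject.pullback (θ.app A)).obj (mapSub G S) := by
  rw [sub_le_iff]
  intro Z g hg
  obtain ⟨h, rfl⟩ := (mk_factors (F.map S.arrow) g).1 hg
  rw [pullback_factors]
  exact (mk_factors (G.map S.arrow) _).2 ⟨h ≫ θ.app _, by simp⟩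

end Sub

namespace Xct

/-- The elementary existential doctrine of subobjects of an exact category. -/
def sub (X : Xct.{u}) : EED.{u} where
  C := X.C
  P := subFunctor X.C
  el := subElementary X.C
  ext := subExistential X.C

/-- The 1-arrow between doctrines of subobjects induced by a regular functor. -/
def Hom.sub {X Y : Xct.{u}} (f : Hom X Y) : EED.Hom X.sub Y.sub where
  F := f.F
  pres := inferInstanceAs (PreservesFiniteProducts f.F)
  b := subNatTrans Y.C f.F
  map_δ A := mapSub_diag f.F A
  map_ex p _ S := mapSub_exists f.F f.map_regularEpi p S

/-- The 2-arrow between 1-arrows of doctrines induced by a natural transformation. -/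
def Hom₂.sub {X Y : Xct.{u}} {f g : Hom X Y} (η : Hom₂ f g) : EED.Hom₂ f.sub g.sub where
  θ := η.θ
  le A S := mapSub_le η.θ S

theorem mapSub_id (X : Xct.{u}) {A : X.C} (S : Subobject A) : mapSub (𝟭 X.C) S = S :=
  Subobject.mk_arrow S

theorem mapSub_comp {X Y Z : Xct.{u}} (f : Hom X Y) (g : Hom Y Z) {A : X.C} (S : Subobject A) :
    @mapSub _ _ _ _ (f.F ⋙ g.F) (f.comp g).lex _ S = mapSub g.F (mapSub f.F S) :=
  (mapSub_mk g.F (f.F.map S.arrow)).symm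

/-- The 2-functor that sends an exact category to its doctrine of subobjects. -/
def subDoctrine : Pseudofunctor Xct.{u} EED.{u} where
  obj := sub
  map f := Hom.sub f
  map₂ η := Hom₂.sub η
  map₂_id f := EED.Hom₂.ext rfl
  map₂_comp η θ := EED.Hom₂.ext rfl
  mapId X := EED.isoMk (Hom.sub (Hom.id X)) (EED.Hom.id X.sub) (Iso.refl _)
    (fun A S => (mapSub_id X S).trans (pull_id _ _).symm)
  mapComp {X Y Z} f g :=
    EED.isoMk (Hom.sub (Hom.comp f g)) ((Hom.sub f).comp (Hom.sub g)) (Iso.refl _)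
      (fun A S => (mapSub_comp f g S).trans
        (pull_id Z.sub.P (A := g.F.obj (f.F.obj A)) (mapSub g.F (mapSub f.F S))).symm)
  map₂_whisker_left f _ _ η := EED.Hom₂.ext (NatTrans.ext (funext fun _ => sandwich _))
  map₂_whisker_right η h := EED.Hom₂.ext (NatTrans.ext (funext fun _ => sandwich _))
  map₂_associator f g h := EED.Hom₂.ext (NatTrans.ext (funext fun A => by
    change 𝟙 (h.F.obj (g.F.obj (f.F.obj A))) = 𝟙 _ ≫ h.F.map (𝟙 _) ≫ 𝟙 _ ≫ 𝟙 _ ≫ 𝟙 _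
    simp))
  map₂_left_unitor f := EED.Hom₂.ext (NatTrans.ext (funext fun A => by
    change 𝟙 (f.F.obj A) = 𝟙 _ ≫ f.F.map (𝟙 _) ≫ 𝟙 _
    rw [Category.id_comp, Category.comp_id]
    exact (f.F.map_id A).symm))
  map₂_right_unitor f := EED.Hom₂.ext (NatTrans.ext (funext fun A => by
    change 𝟙 (f.F.obj A) = 𝟙 _ ≫ 𝟙 _ ≫ 𝟙 _
    simp))

end Xct

/-! ## The exact completion of an elementary existential doctrine -/

section Logic

variable {C : Type u} [Category.{v} C] {P : Cᵒᵖ ⥤ SemilatInfCat.{w}}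

/-- Elimination rule for the existential quantifier, over an arbitrary context. -/
theorem Existential.elim (E : Existential P) {X' A' X A : C} {p' : X' ⟶ A'} {f' : X' ⟶ X}
    {f : A' ⟶ A} {p : X ⟶ A} (sq : IsPullback p' f' f p) (hp : IsProj p) (hp' : IsProj p')
    {β : P.obj (op X)} {γ χ : P.obj (op A')}
    (h : pull P f' β ⊓ pull P p' γ ≤ pull P p' χ) : pull P f (E.ex p hp β) ⊓ γ ≤ χ := by
  rw [← E.beckChevalley sq hp hp', inf_comm, ← E.frobenius, inf_comm]
  exact (E.adj p' hp').l_le h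

variable [HasFiniteProducts C]

/-- The substitution `φ(a, b)` of terms in a binary relation. -/
def rel {A B Z : C} (φ : P.obj (op (A ⨯ B))) (a : Z ⟶ A) (b : Z ⟶ B) : P.obj (op Z) :=
  pull P (prod.lift a b) φ

theorem pull_rel {A B Z W : C} (φ : P.obj (op (A ⨯ B))) (a : Z ⟶ A) (b : Z ⟶ B) (g : W ⟶ Z) :
    pull P g (rel φ a b) = rel φ (g ≫ a) (g ≫ b) := by
  rw [rel, pull_pull, prod.comp_lift, rel]

theorem rel_fst_snd {A B : C} (φ : P.obj (op (A ⨯ B))) : rel φ prod.fst prod.snd = φ := by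
  rw [rel, prod.lift_fst_snd, pull_id]

theorem pull_p12_rel {A B D Z : C} (φ : P.obj (op (A ⨯ B))) (a : Z ⟶ A) (b : Z ⟶ B)
    (d : Z ⟶ D) : pull P (prod.lift (prod.lift a b) d) (pull P (p12 A B D) φ) = rel φ a b := by
  rw [pull_pull, p12, prod.lift_fst, rel]

theorem pull_p23_rel {A B D Z : C} (φ : P.obj (op (B ⨯ D))) (a : Z ⟶ A) (b : Z ⟶ B)
    (d : Z ⟶ D) : pull P (prod.lift (prod.lift a b) d) (pull P (p23 A B D) φ) = rel φ b d := by
  rw [pull_pull, p23, prod.comp_lift, prod.lift_fst_assoc, prod.lift_snd, prod.lift_snd, rel]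

theorem pull_p13_rel {A B D Z : C} (φ : P.obj (op (A ⨯ D))) (a : Z ⟶ A) (b : Z ⟶ B)
    (d : Z ⟶ D) : pull P (prod.lift (prod.lift a b) d) (pull P (p13 A B D) φ) = rel φ a d := by
  rw [pull_pull, p13, prod.comp_lift, prod.lift_fst_assoc, prod.lift_fst, prod.lift_snd, rel]

theorem isPullback_fst {A B Z : C} (a : Z ⟶ A) :
    IsPullback (prod.fst : Z ⨯ B ⟶ Z) (prod.map a (𝟙 B)) a prod.fst := by
  refine ⟨⟨by simp⟩, ⟨PullbackCone.IsLimit.mk _ (fun s => prod.lift s.fst (s.snd ≫ prod.snd))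
    (fun s => ?_) (fun s => ?_) (fun s m h₁ h₂ => ?_)⟩⟩
  · exact prod.lift_fst _ _
  · apply prod.hom_ext
    · simp [prod.lift_fst, s.condition]
    · simp [prod.lift_snd]
  · apply prod.hom_ext
    · simp [prod.lift_fst, h₁]
    · simp [prod.lift_snd, ← h₂]

theorem isPullback_p13 {A B D Z : C} (a : Z ⟶ A) (d : Z ⟶ D) :
    IsPullback (prod.fst : Z ⨯ B ⟶ Z)
      (prod.lift (prod.lift (prod.fst ≫ a) prod.snd) (prod.fst ≫ d))
      (prod.lift a d) (p13 A B D) := by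
  refine ⟨⟨?_⟩, ⟨PullbackCone.IsLimit.mk _
    (fun s => prod.lift s.fst (s.snd ≫ prod.fst ≫ prod.snd))
    (fun s => ?_) (fun s => ?_) (fun s m h₁ h₂ => ?_)⟩⟩
  · simp [prod.lift_fst, prod.lift_fst_assoc, prod.lift_snd]
  · exact prod.lift_fst _ _
  · have h₁ := congrArg (· ≫ prod.fst) s.condition
    have h₂ := congrArg (· ≫ prod.snd) s.condition
    simp only [p13, Category.assoc, prod.lift_fst, prod.lift_snd] at h₁ h₂
    apply prod.hom_ext
    · apply prod.hom_ext
      · simp [prod.lift_fst, prod.lift_fst_assoc, h₁]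
      · simp [prod.lift_fst, prod.lift_snd]
    · simp [prod.lift_fst_assoc, prod.lift_snd, h₂]
  · apply prod.hom_ext
    · simp [prod.lift_fst, h₁]
    · simp [prod.lift_snd, prod.lift_fst_assoc, ← h₂]

/-- The composite `∃b. φ(a, b) ∧ ψ(b, d)` of relations. -/
def compRel (E : Existential P) {A B D : C} (φ : P.obj (op (A ⨯ B))) (ψ : P.obj (op (B ⨯ D))) :
    P.obj (op (A ⨯ D)) :=
  E.ex (p13 A B D) (isProj_p13 A B D) (pull P (p12 A B D) φ ⊓ pull P (p23 A B D) ψ)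

theorem compRel_intro (E : Existential P) {A B D Z : C} (φ : P.obj (op (A ⨯ B)))
    (ψ : P.obj (op (B ⨯ D))) (a : Z ⟶ A) (b : Z ⟶ B) (d : Z ⟶ D) :
    rel φ a b ⊓ rel ψ b d ≤ rel (compRel E φ ψ) a d := by
  have h := pull_mono P (prod.lift (prod.lift a b) d)
    ((E.adj (p13 A B D) (isProj_p13 A B D)).le_u_l (pull P (p12 A B D) φ ⊓ pull P (p23 A B D) ψ))
  rwa [pull_inf, pull_p12_rel, pull_p23_rel, pull_p13_rel] at h

theorem compRel_elim (E : Existential P) {A B D Z : C} {φ : P.obj (op (A ⨯ B))}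
    {ψ : P.obj (op (B ⨯ D))} {a : Z ⟶ A} {d : Z ⟶ D} {γ χ : P.obj (op Z)}
    (h : rel φ (prod.fst ≫ a) prod.snd ⊓ rel ψ prod.snd (prod.fst ≫ d) ⊓
      pull P (prod.fst : Z ⨯ B ⟶ Z) γ ≤ pull P prod.fst χ) :
    rel (compRel E φ ψ) a d ⊓ γ ≤ χ := by
  refine E.elim (isPullback_p13 a d) (isProj_p13 A B D) (isProj_fst Z B) ?_
  rwa [pull_inf, pull_p12_rel, pull_p23_rel]

theorem compRel_elim_top (E : Existential P) {A B D Z : C} {φ : P.obj (op (A ⨯ B))}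
    {ψ : P.obj (op (B ⨯ D))} {a : Z ⟶ A} {d : Z ⟶ D} {χ : P.obj (op Z)}
    (h : rel φ (prod.fst ≫ a) prod.snd ⊓ rel ψ prod.snd (prod.fst ≫ d) ≤
      pull P (prod.fst : Z ⨯ B ⟶ Z) χ) :
    rel (compRel E φ ψ) a d ≤ χ := by
  have := compRel_elim E (γ := ⊤) (inf_le_left.trans h)
  rwa [inf_top_eq] at this

theorem p12_rel {A B D : C} (φ : P.obj (op (A ⨯ B))) :
    pull P (p12 A B D) φ = rel φ (prod.fst ≫ prod.fst) (prod.fst ≫ prod.snd) := by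
  rw [← pull_rel, rel_fst_snd]

/-- To prove `compRel φ ψ ≤ χ` it is enough to prove `φ(a, b) ∧ ψ(b, d) ≤ χ(a, d)`. -/
theorem compRel_le (E : Existential P) {A B D : C} {φ : P.obj (op (A ⨯ B))}
    {ψ : P.obj (op (B ⨯ D))} {χ : P.obj (op (A ⨯ D))}
    (h : ∀ {Z : C} (a : Z ⟶ A) (b : Z ⟶ B) (d : Z ⟶ D), rel φ a b ⊓ rel ψ b d ≤ rel χ a d) :
    compRel E φ ψ ≤ χ := by
  rw [← rel_fst_snd (compRel E φ ψ)]
  refine compRel_elim_top E ((h _ _ _).trans ?_)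
  rw [← pull_rel, rel_fst_snd]

theorem le_of_rel_le {A B : C} {φ ψ : P.obj (op (A ⨯ B))}
    (h : rel φ prod.fst prod.snd ≤ rel ψ prod.fst prod.snd) : φ ≤ ψ := by
  rwa [rel_fst_snd, rel_fst_snd] at h

end Logic

/-- An object `(A, ρ)` of the exact completion `T_P` of a doctrine `P`: a symmetric and transitive
relation `ρ ∈ P(A × A)`. -/
structure TP (D : EED.{u}) : Type u where
  A : D.C
  ρ : D.fib (A ⨯ A)
  symm : ρ ≤ pull D.P (prod.lift prod.snd prod.fst) ρ
  trans : pull D.P (p12 A A A) ρ ⊓ pull D.P (p23 A A A) ρ ≤ pull D.P (p13 A A A) ρ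

namespace TP

variable {D : EED.{u}}

/-- An arrow `φ : (A, ρ) ⟶ (B, σ)` of the exact completion `T_P`: a functional relation, that is,
an element of `P(A × B)` which is defined on `ρ` and `σ`, closed under `ρ` on the left and under
`σ` on the right, single-valued up to `σ`, and total on `ρ`. -/
@[ext]
structure Hom (X Y : TP D) : Type u where
  φ : D.fib (X.A ⨯ Y.A)
  le_ext : φ ≤ pull D.P (prod.lift prod.fst prod.fst) X.ρ ⊓
    pull D.P (prod.lift prod.snd prod.snd) Y.ρ
  left : pull D.P (p12 X.A X.A Y.A) X.ρ ⊓ pull D.P (p23 X.A X.A Y.A) φ ≤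
    pull D.P (p13 X.A X.A Y.A) φ
  right : pull D.P (p12 X.A Y.A Y.A) φ ⊓ pull D.P (p23 X.A Y.A Y.A) Y.ρ ≤
    pull D.P (p13 X.A Y.A Y.A) φ
  single : pull D.P (p12 X.A Y.A Y.A) φ ⊓ pull D.P (p13 X.A Y.A Y.A) φ ≤
    pull D.P (p23 X.A Y.A Y.A) Y.ρ
  total : pull D.P (prod.lift (𝟙 X.A) (𝟙 X.A)) X.ρ ≤
    D.ext.ex (prod.fst : X.A ⨯ Y.A ⟶ X.A) (isProj_fst X.A Y.A) φ

theorem rel_symm (X : TP D) {Z : D.C} (a b : Z ⟶ X.A) : rel X.ρ a b ≤ rel X.ρ b a := by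
  have h := pull_mono D.P (prod.lift a b) X.symm
  rwa [pull_pull, prod.comp_lift, prod.lift_fst, prod.lift_snd] at h

theorem rel_trans (X : TP D) {Z : D.C} (a b c : Z ⟶ X.A) :
    rel X.ρ a b ⊓ rel X.ρ b c ≤ rel X.ρ a c := by
  have h := pull_mono D.P (prod.lift (prod.lift a b) c) X.trans
  rwa [pull_inf, pull_p12_rel, pull_p23_rel, pull_p13_rel] at h

theorem rel_self (X : TP D) {Z : D.C} (a b : Z ⟶ X.A) : rel X.ρ a b ≤ rel X.ρ a a :=
  (le_inf le_rfl (X.rel_symm a b)).trans (X.rel_trans a b a)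

namespace Hom

variable {X Y : TP D} (f : Hom X Y) {Z : D.C}

theorem rel_dom (a : Z ⟶ X.A) (b : Z ⟶ Y.A) : rel f.φ a b ≤ rel X.ρ a a := by
  have h := pull_mono D.P (prod.lift a b) (f.le_ext.trans inf_le_left)
  rwa [pull_pull, prod.comp_lift, prod.lift_fst] at h

theorem rel_cod (a : Z ⟶ X.A) (b : Z ⟶ Y.A) : rel f.φ a b ≤ rel Y.ρ b b := by
  have h := pull_mono D.P (prod.lift a b) (f.le_ext.trans inf_le_right)
  rwa [pull_pull, prod.comp_lift, prod.lift_snd] at h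

theorem rel_left (a a' : Z ⟶ X.A) (b : Z ⟶ Y.A) :
    rel X.ρ a a' ⊓ rel f.φ a' b ≤ rel f.φ a b := by
  have h := pull_mono D.P (prod.lift (prod.lift a a') b) f.left
  rwa [pull_inf, pull_p12_rel, pull_p23_rel, pull_p13_rel] at h

theorem rel_right (a : Z ⟶ X.A) (b b' : Z ⟶ Y.A) :
    rel f.φ a b ⊓ rel Y.ρ b b' ≤ rel f.φ a b' := by
  have h := pull_mono D.P (prod.lift (prod.lift a b) b') f.right
  rwa [pull_inf, pull_p12_rel, pull_p23_rel, pull_p13_rel] at h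

theorem rel_single (a : Z ⟶ X.A) (b b' : Z ⟶ Y.A) :
    rel f.φ a b ⊓ rel f.φ a b' ≤ rel Y.ρ b b' := by
  have h := pull_mono D.P (prod.lift (prod.lift a b) b') f.single
  rwa [pull_inf, pull_p12_rel, pull_p23_rel, pull_p13_rel] at h

theorem rel_total (a : Z ⟶ X.A) {γ χ : D.fib Z}
    (h : rel f.φ (prod.fst ≫ a) prod.snd ⊓ pull D.P (prod.fst : Z ⨯ Y.A ⟶ Z) γ ≤
      pull D.P (prod.fst : Z ⨯ Y.A ⟶ Z) χ) :
    rel X.ρ a a ⊓ γ ≤ χ := by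
  have h₁ := pull_mono D.P a f.total
  rw [pull_pull, prod.comp_lift, Category.comp_id] at h₁
  refine (inf_le_inf_right γ h₁).trans ?_
  refine D.ext.elim (isPullback_fst (B := Y.A) a) (isProj_fst X.A Y.A) (isProj_fst Z Y.A)
    (le_trans (le_of_eq ?_) h)
  rw [rel, ← prod.lift_fst_comp_snd_comp, Category.comp_id]

/-- A functional relation, from the conditions in the internal language. -/
def ofRel (φ : D.fib (X.A ⨯ Y.A))
    (dom : ∀ {Z : D.C} (a : Z ⟶ X.A) (b : Z ⟶ Y.A), rel φ a b ≤ rel X.ρ a a)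
    (cod : ∀ {Z : D.C} (a : Z ⟶ X.A) (b : Z ⟶ Y.A), rel φ a b ≤ rel Y.ρ b b)
    (left : ∀ {Z : D.C} (a a' : Z ⟶ X.A) (b : Z ⟶ Y.A),
      rel X.ρ a a' ⊓ rel φ a' b ≤ rel φ a b)
    (right : ∀ {Z : D.C} (a : Z ⟶ X.A) (b b' : Z ⟶ Y.A),
      rel φ a b ⊓ rel Y.ρ b b' ≤ rel φ a b')
    (single : ∀ {Z : D.C} (a : Z ⟶ X.A) (b b' : Z ⟶ Y.A),
      rel φ a b ⊓ rel φ a b' ≤ rel Y.ρ b b')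
    (total : ∀ χ : D.fib X.A, φ ≤ pull D.P prod.fst χ → rel X.ρ (𝟙 X.A) (𝟙 X.A) ≤ χ) :
    Hom X Y where
  φ := φ
  le_ext := by
    have h₁ := dom prod.fst prod.snd
    have h₂ := cod prod.fst prod.snd
    rw [rel_fst_snd] at h₁ h₂
    exact le_inf h₁ h₂
  left := by
    rw [p12_rel]
    exact left (prod.fst ≫ prod.fst) (prod.fst ≫ prod.snd) prod.snd
  right := by
    rw [p12_rel]
    exact right (prod.fst ≫ prod.fst) (prod.fst ≫ prod.snd) prod.snd
  single := by
    rw [p12_rel]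
    exact single (prod.fst ≫ prod.fst) (prod.fst ≫ prod.snd) prod.snd
  total := total _ ((D.ext.adj _ _).le_u_l φ)

end Hom

/-- The identity on `(A, ρ)` is `ρ`. -/
def Hom.id (X : TP D) : Hom X X :=
  Hom.ofRel X.ρ (fun a b => X.rel_self a b)
    (fun a b => (X.rel_symm a b).trans (X.rel_self b a))
    X.rel_trans X.rel_trans
    (fun a b c => (inf_le_inf_right _ (X.rel_symm a b)).trans (X.rel_trans b a c))
    (fun χ h => by
      have h₁ := pull_mono D.P (prod.lift (𝟙 X.A) (𝟙 X.A)) h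
      rwa [pull_pull, prod.lift_fst, pull_id] at h₁)

/-- The composite of `φ` and `ψ` is `∃b. φ(a, b) ∧ ψ(b, c)`. -/
def Hom.comp {X Y Z : TP D} (f : Hom X Y) (g : Hom Y Z) : Hom X Z :=
  Hom.ofRel (compRel D.ext f.φ g.φ)
    (fun a b => compRel_elim_top D.ext (by
      rw [pull_rel]
      exact inf_le_left.trans (f.rel_dom _ _)))
    (fun a b => compRel_elim_top D.ext (by
      rw [pull_rel]
      exact inf_le_right.trans (g.rel_cod _ _)))
    (fun a a' b => by
      rw [inf_comm]
      refine compRel_elim D.ext ?_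
      rw [pull_rel, pull_rel]
      refine le_trans (le_inf ?_ (inf_le_left.trans inf_le_right))
        (compRel_intro D.ext f.φ g.φ _ prod.snd _)
      exact (le_inf inf_le_right (inf_le_left.trans inf_le_left)).trans (f.rel_left _ _ _))
    (fun a b b' => by
      refine compRel_elim D.ext ?_
      rw [pull_rel, pull_rel]
      refine le_trans (le_inf (inf_le_left.trans inf_le_left) ?_)
        (compRel_intro D.ext f.φ g.φ _ prod.snd _)
      exact (le_inf (inf_le_left.trans inf_le_right) inf_le_right).trans (g.rel_right _ _ _))
    (fun a b b' => by
      refine compRel_elim D.ext ?_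
      rw [inf_comm, pull_rel, pull_rel]
      refine compRel_elim D.ext ?_
      rw [pull_inf, pull_rel, pull_rel, pull_rel]
      refine le_trans (le_inf (inf_le_right.trans inf_le_right) ?_) (g.rel_single _ _ _)
      refine le_trans (le_inf ?_ (inf_le_left.trans inf_le_right)) (g.rel_left _ prod.snd _)
      exact (le_inf (inf_le_right.trans inf_le_left) (inf_le_left.trans inf_le_left)).trans
        (f.rel_single _ _ _))
    (fun χ h => by
      have h₁ := f.rel_total (𝟙 X.A) (γ := ⊤) (χ := χ) (by
        rw [Category.comp_id]
        refine inf_le_left.trans ((le_inf (f.rel_cod _ _) le_rfl).trans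
          (g.rel_total prod.snd ?_))
        rw [pull_rel, pull_pull, inf_comm]
        refine (compRel_intro D.ext f.φ g.φ _ _ _).trans ?_
        have h₂ := pull_mono D.P (prod.lift (prod.fst ≫ prod.fst) prod.snd :
          (X.A ⨯ Y.A) ⨯ Z.A ⟶ X.A ⨯ Z.A) h
        rwa [pull_pull, prod.lift_fst] at h₂)
      rwa [inf_top_eq] at h₁)

/-- The exact completion `T_P`. -/
instance : Category (TP D) where
  Hom := Hom
  id := Hom.id
  comp := Hom.comp
  id_comp {X Y} f := Hom.ext (by
    apply le_antisymm
    · exact compRel_le _ fun a b c => f.rel_left a b c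
    · refine le_of_rel_le ((le_inf (f.rel_dom _ _) le_rfl).trans
        (compRel_intro D.ext X.ρ f.φ _ _ _)))
  comp_id {X Y} f := Hom.ext (by
    apply le_antisymm
    · exact compRel_le _ fun a b c => f.rel_right a b c
    · refine le_of_rel_le ((le_inf le_rfl (f.rel_cod _ _)).trans
        (compRel_intro D.ext f.φ Y.ρ _ _ _)))
  assoc {X Y Z W} f g h := Hom.ext (by
    apply le_antisymm
    · refine compRel_le _ fun a c d => ?_
      refine compRel_elim D.ext ?_
      rw [pull_rel, pull_rel]
      refine le_trans (le_inf (inf_le_left.trans inf_le_left) ?_)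
        (compRel_intro D.ext f.φ (compRel D.ext g.φ h.φ) _ prod.snd _)
      exact (le_inf (inf_le_left.trans inf_le_right) inf_le_right).trans
        (compRel_intro D.ext g.φ h.φ _ _ _)
    · refine compRel_le _ fun a b d => ?_
      rw [inf_comm]
      refine compRel_elim D.ext ?_
      rw [pull_rel, pull_rel]
      refine le_trans (le_inf ?_ (inf_le_left.trans inf_le_right))
        (compRel_intro D.ext (compRel D.ext f.φ g.φ) h.φ _ prod.snd _)
      exact (le_inf inf_le_right (inf_le_left.trans inf_le_left)).trans
        (compRel_intro D.ext f.φ g.φ _ _ _))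

end TP

/-! ## Left biadjoints -/

section Biadjoint

universe w₁ v₁ u₁ w₂ v₂ u₂

open Bicategory

variable {B : Type u₁} [Bicategory.{w₁, v₁} B] {K : Type u₂} [Bicategory.{w₂, v₂} K]

/-- For a pseudofunctor `U` and a 1-arrow `η : b ⟶ U x`, the functor
`K(x, c) ⥤ B(b, U c)` sending `g` to `η ≫ U g`. -/
def transpose (U : Pseudofunctor K B) {b : B} {x : K} (η : b ⟶ U.obj x) (c : K) :
    (x ⟶ c) ⥤ (b ⟶ U.obj c) where
  obj g := η ≫ U.map g
  map s := η ◁ U.map₂ s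

/-- A left biadjoint of a pseudofunctor `U : K ⥤ B`: a pseudofunctor `L : B ⥤ K` together with a
pseudonatural transformation `unit : id ⟶ U ∘ L` such that, for all `b` and `c`, transposing along
`unit_b` is an equivalence of categories `K(L b, c) ≌ B(b, U c)`. -/
structure LeftBiadjoint (U : Pseudofunctor K B) where
  L : Pseudofunctor B K
  unit : Pseudofunctor.StrongTrans (Pseudofunctor.id B) (L.comp U)
  isEquivalence (b : B) (c : K) :
    (transpose U (b := b) (x := L.obj b) (unit.app b) c).IsEquivalence

end Biadjoint

end

end ExactCompletion

/-!
# The exact completion of an elementary existential doctrine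

Everything is computed in the internal (regular) logic of a doctrine. For generalized elements
`a : Z ⟶ A`, `b : Z ⟶ B` and a context `γ ∈ P(Z)`, the inequality `γ ≤ rel φ a b` says that
`φ(a, b)` holds in the context `γ`. To use an existential statement one passes to a context
`γ' ≤ P_g(γ)`, for some `g : Z' ⟶ Z`, that contains a witness (`Existential.ex_elim`). Arrows of
`T_P` are functional relations, and categorical notions have internal descriptions: isomorphisms are
the bijections (`TP.isIso_of_inj_surj`), regular epimorphisms are the surjections
(`TP.Surj.isRegularEpi`, `TP.surj_of_isRegularEpi`), and pullbacks are described by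
`TP.InternalPullback`. Exactness follows: the image of an arrow and the quotient by an equivalence
relation live on the same object of the base, with another relation.

The unit `TP.unitHom` sends an object `A` to `(A, δ_A)` and a predicate `α` to the subobject
`{a | α(a)}`, the comprehension `TP.compr α`. An arrow of doctrines preserves regular logic, so it
acts on objects and functional relations by a regular functor `TP.mapXct`, pseudonaturally with
respect to the unit (`TP.unitNat`).

For the universal property, let `X` be an exact category.

* Every object `(A, ρ)` of `T_P` is a quotient of the comprehension of its support
  `{a | ρ(a, a)}`, and the graph of an arrow, in particular the kernel pair of this quotient, is a
  comprehension as well (`TP.internalPullback_graph`). Hence natural transformations between regular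
  functors `T_P ⥤ X` are determined by their restrictions to the base (`TP.natTrans_ext`), and a
  transformation on the base that is compatible with predicates extends (`TP.exists_natTrans`). So
  transposition is fully faithful.
* If the doctrine is `Sub X`, the functor `A ↦ (A, δ_A)` is an equivalence from `X` to `T_{Sub X}`:
  functional relations are arrows, and symmetric transitive relations have effective quotients. The
  unit at `Sub X` is the action of this equivalence on subobjects (`Xct.unitHomIso`). Therefore
  `f : P ⟶ Sub X` is the transpose of `T_P ⟶ T_{Sub X} ≃ X`, the first functor being induced by `f`
  (`TP.extendIso`). So transposition is essentially surjective.

The coherence axioms of the pseudofunctor and of the unit reduce to equations in the base, since all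
arrows of `T_P` that occur in them are tracked by arrows of the base (`TP.IsTracked`).
-/

namespace ExactCompletion

noncomputable section

/-! ### Reasoning in the internal language of a doctrine -/

section Stages

variable {C : Type u} [Category.{v} C] {P : Cᵒᵖ ⥤ SemilatInfCat.{w}}

/-- A judgement remains valid in every context `γ'` that lies over `γ`. -/
theorem pull_restrict {Z Z' A : C} {γ : P.obj (op Z)} {γ' : P.obj (op Z')} {g : Z' ⟶ Z}
    (hγ : γ' ≤ pull P g γ) {a : Z ⟶ A} {α : P.obj (op A)} (h : γ ≤ pull P a α) :
    γ' ≤ pull P (g ≫ a) α := by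
  rw [← pull_pull]
  exact hγ.trans (pull_mono P g h)

theorem Existential.ex_intro (E : Existential P) {X A Z : C} {p : X ⟶ A} (hp : IsProj p)
    {x : Z ⟶ X} {β : P.obj (op X)} {γ : P.obj (op Z)} (h : γ ≤ pull P x β) :
    γ ≤ pull P (x ≫ p) (E.ex p hp β) := by
  rw [← pull_pull]
  exact h.trans (pull_mono P x ((E.adj p hp).le_u_l β))

variable [HasFiniteProducts C]

theorem rel_restrict {Z Z' A B : C} {γ : P.obj (op Z)} {γ' : P.obj (op Z')} {g : Z' ⟶ Z}
    (hγ : γ' ≤ pull P g γ) {a : Z ⟶ A} {b : Z ⟶ B} {φ : P.obj (op (A ⨯ B))}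
    (h : γ ≤ rel φ a b) : γ' ≤ rel φ (g ≫ a) (g ≫ b) := by
  rw [← pull_rel]
  exact hγ.trans (pull_mono P g h)

theorem rel_inf {A B Z : C} (φ ψ : P.obj (op (A ⨯ B))) (a : Z ⟶ A) (b : Z ⟶ B) :
    rel (φ ⊓ ψ) a b = rel φ a b ⊓ rel ψ a b :=
  pull_inf _ _ _ _

theorem rel_pull {A B A' Z : C} (α : P.obj (op A')) (c : A ⨯ B ⟶ A') (a : Z ⟶ A) (b : Z ⟶ B) :
    rel (pull P c α) a b = pull P (prod.lift a b ≫ c) α :=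
  pull_pull _ _ _ _

theorem rel_rel {A B A' B' Z : C} (φ : P.obj (op (A' ⨯ B'))) (c : A ⨯ B ⟶ A') (d : A ⨯ B ⟶ B')
    (a : Z ⟶ A) (b : Z ⟶ B) :
    rel (rel φ c d) a b = rel φ (prod.lift a b ≫ c) (prod.lift a b ≫ d) :=
  pull_rel _ _ _ _

theorem pull_eq_rel {A B Z : C} (φ : P.obj (op (A ⨯ B))) (z : Z ⟶ A ⨯ B) :
    pull P z φ = rel φ (z ≫ prod.fst) (z ≫ prod.snd) := by
  rw [rel, ← prod.comp_lift, prod.lift_fst_snd, Category.comp_id]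

/-- The converse of a relation. -/
def conv {A B : C} (φ : P.obj (op (A ⨯ B))) : P.obj (op (B ⨯ A)) :=
  rel φ prod.snd prod.fst

theorem rel_conv {A B Z : C} (φ : P.obj (op (A ⨯ B))) (b : Z ⟶ B) (a : Z ⟶ A) :
    rel (conv φ) b a = rel φ a b := by
  rw [conv, rel, pull_rel, prod.lift_fst, prod.lift_snd]

/-- Every base change of a projection is the first projection from a binary product. -/
theorem isPullback_of_isProj {X A B Z : C} {p : X ⟶ A} {q : X ⟶ B}
    (h : IsLimit (BinaryFan.mk p q)) (a : Z ⟶ A) :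
    IsPullback (prod.fst : Z ⨯ B ⟶ Z)
      (BinaryFan.IsLimit.lift' h (prod.fst ≫ a) prod.snd).1 a p := by
  set l := BinaryFan.IsLimit.lift' h (prod.fst ≫ a) (prod.snd : Z ⨯ B ⟶ B) with hl
  have h₁ : l.1 ≫ p = prod.fst ≫ a := l.2.1
  have h₂ : l.1 ≫ q = prod.snd := l.2.2
  refine ⟨⟨h₁.symm⟩, ⟨PullbackCone.IsLimit.mk _ (fun s => prod.lift s.fst (s.snd ≫ q))
    (fun s => prod.lift_fst _ _) (fun s => ?_) (fun s m hm₁ hm₂ => ?_)⟩⟩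
  · refine BinaryFan.IsLimit.hom_ext h ?_ ?_
    · change (_ ≫ l.1) ≫ p = s.snd ≫ p
      rw [Category.assoc, h₁, prod.lift_fst_assoc, s.condition]
    · change (_ ≫ l.1) ≫ q = s.snd ≫ q
      rw [Category.assoc, h₂, prod.lift_snd]
  · apply prod.hom_ext
    · rw [hm₁, prod.lift_fst]
    · rw [prod.lift_snd, ← hm₂, Category.assoc, h₂]

namespace Existential

variable (E : Existential P)

/-- Elimination of an existential quantifier: to derive `χ` from `∃x. β(x, a)` in the context `γ`,
it is enough to derive it in every context that lies over `γ` and contains a witness `x`. -/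
theorem ex_elim {X A Z : C} {p : X ⟶ A} {hp : IsProj p} {a : Z ⟶ A} {β : P.obj (op X)}
    {γ χ : P.obj (op Z)} (h : γ ≤ pull P a (E.ex p hp β))
    (k : ∀ {Z' : C} (g : Z' ⟶ Z) (x : Z' ⟶ X) (γ' : P.obj (op Z')), x ≫ p = g ≫ a →
      γ' ≤ pull P g γ → γ' ≤ pull P x β → γ' ≤ pull P g χ) : γ ≤ χ := by
  obtain ⟨B, q, ⟨hl⟩⟩ := id hp
  refine (le_inf h le_rfl).trans (E.elim (isPullback_of_isProj hl a) hp (isProj_fst Z B) ?_)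
  exact k _ _ _ (BinaryFan.IsLimit.lift' hl (prod.fst ≫ a) prod.snd).2.1 inf_le_right inf_le_left

theorem exFst_intro {A B Z : C} {ψ : P.obj (op (A ⨯ B))} {a : Z ⟶ A} {b : Z ⟶ B}
    {γ : P.obj (op Z)} (h : γ ≤ rel ψ a b) :
    γ ≤ pull P a (E.ex prod.fst (isProj_fst A B) ψ) := by
  have := E.ex_intro (isProj_fst A B) h
  rwa [prod.lift_fst] at this

theorem exFst_elim {A B Z : C} {a : Z ⟶ A} {ψ : P.obj (op (A ⨯ B))}
    {γ χ : P.obj (op Z)} (h : γ ≤ pull P a (E.ex prod.fst (isProj_fst A B) ψ))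
    (k : ∀ {Z' : C} (g : Z' ⟶ Z) (b : Z' ⟶ B) (γ' : P.obj (op Z')),
      γ' ≤ pull P g γ → γ' ≤ rel ψ (g ≫ a) b → γ' ≤ pull P g χ) : γ ≤ χ := by
  refine E.ex_elim h fun g x γ' hx hγ hβ => k g (x ≫ prod.snd) γ' hγ ?_
  rwa [rel, ← hx, ← prod.comp_lift, prod.lift_fst_snd, Category.comp_id]

theorem comp_intro {A B D Z : C} {φ : P.obj (op (A ⨯ B))} {ψ : P.obj (op (B ⨯ D))}
    {a : Z ⟶ A} {b : Z ⟶ B} {d : Z ⟶ D} {γ : P.obj (op Z)} (h₁ : γ ≤ rel φ a b)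
    (h₂ : γ ≤ rel ψ b d) : γ ≤ rel (compRel E φ ψ) a d :=
  (le_inf h₁ h₂).trans (compRel_intro E φ ψ a b d)

theorem comp_elim {A B D Z : C} {φ : P.obj (op (A ⨯ B))} {ψ : P.obj (op (B ⨯ D))}
    {a : Z ⟶ A} {d : Z ⟶ D} {γ χ : P.obj (op Z)} (h : γ ≤ rel (compRel E φ ψ) a d)
    (k : ∀ {Z' : C} (g : Z' ⟶ Z) (b : Z' ⟶ B) (γ' : P.obj (op Z')), γ' ≤ pull P g γ →
      γ' ≤ rel φ (g ≫ a) b → γ' ≤ rel ψ b (g ≫ d) → γ' ≤ pull P g χ) : γ ≤ χ := by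
  refine (le_inf h le_rfl).trans (compRel_elim E ?_)
  exact k prod.fst prod.snd _ inf_le_right (inf_le_left.trans inf_le_left)
    (inf_le_left.trans inf_le_right)

end Existential

/-- An entailment between relations may be checked on generalized elements in context. -/
theorem le_of_stages {A B : C} {φ ψ : P.obj (op (A ⨯ B))}
    (h : ∀ {Z : C} (γ : P.obj (op Z)) (a : Z ⟶ A) (b : Z ⟶ B), γ ≤ rel φ a b → γ ≤ rel ψ a b) :
    φ ≤ ψ :=
  le_of_rel_le (h _ _ _ le_rfl)

end Stages

/-! ### Arrows of the exact completion -/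

namespace TP

variable {D : EED.{u}} {X Y V W : TP D}

section Relations

variable {Z : D.C} {γ : D.fib Z}

theorem eq_symm {a b : Z ⟶ X.A} (h : γ ≤ rel X.ρ a b) : γ ≤ rel X.ρ b a :=
  h.trans (X.rel_symm a b)

theorem eq_trans {a b c : Z ⟶ X.A} (h : γ ≤ rel X.ρ a b) (h' : γ ≤ rel X.ρ b c) :
    γ ≤ rel X.ρ a c :=
  (le_inf h h').trans (X.rel_trans a b c)

theorem eq_left {a b : Z ⟶ X.A} (h : γ ≤ rel X.ρ a b) : γ ≤ rel X.ρ a a :=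
  eq_trans h (eq_symm h)

theorem eq_right {a b : Z ⟶ X.A} (h : γ ≤ rel X.ρ a b) : γ ≤ rel X.ρ b b :=
  eq_trans (eq_symm h) h

/-- The functional relation underlying an arrow of the exact completion. -/
def gr (f : X ⟶ Y) : D.fib (X.A ⨯ Y.A) := Hom.φ f

theorem dom {f : X ⟶ Y} {a : Z ⟶ X.A} {b : Z ⟶ Y.A} (h : γ ≤ rel (gr f) a b) :
    γ ≤ rel X.ρ a a :=
  h.trans (Hom.rel_dom f a b)

theorem cod {f : X ⟶ Y} {a : Z ⟶ X.A} {b : Z ⟶ Y.A} (h : γ ≤ rel (gr f) a b) :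
    γ ≤ rel Y.ρ b b :=
  h.trans (Hom.rel_cod f a b)

theorem congr_left {f : X ⟶ Y} {a a' : Z ⟶ X.A} {b : Z ⟶ Y.A} (h : γ ≤ rel X.ρ a a')
    (h' : γ ≤ rel (gr f) a b) : γ ≤ rel (gr f) a' b :=
  (le_inf (eq_symm h) h').trans (Hom.rel_left f a' a b)

theorem congr_right {f : X ⟶ Y} {a : Z ⟶ X.A} {b b' : Z ⟶ Y.A} (h : γ ≤ rel Y.ρ b b')
    (h' : γ ≤ rel (gr f) a b) : γ ≤ rel (gr f) a b' :=
  (le_inf h' h).trans (Hom.rel_right f a b b')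

theorem single {f : X ⟶ Y} {a : Z ⟶ X.A} {b b' : Z ⟶ Y.A} (h : γ ≤ rel (gr f) a b)
    (h' : γ ≤ rel (gr f) a b') : γ ≤ rel Y.ρ b b' :=
  (le_inf h h').trans (Hom.rel_single f a b b')

/-- To derive `χ` from the definedness of `a`, it is enough to do so in every context over the given
one that contains a value `f(a) = b`. -/
theorem total_elim (f : X ⟶ Y) {a : Z ⟶ X.A} {χ : D.fib Z} (h : γ ≤ rel X.ρ a a)
    (k : ∀ {Z' : D.C} (g : Z' ⟶ Z) (b : Z' ⟶ Y.A) (γ' : D.fib Z'), γ' ≤ pull D.P g γ →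
      γ' ≤ rel (gr f) (g ≫ a) b → γ' ≤ pull D.P g χ) : γ ≤ χ :=
  (le_inf h le_rfl).trans (Hom.rel_total f a (k prod.fst prod.snd _ inf_le_right inf_le_left))

theorem comp_intro {f : X ⟶ Y} {g : Y ⟶ W} {a : Z ⟶ X.A} {b : Z ⟶ Y.A} {c : Z ⟶ W.A}
    (h : γ ≤ rel (gr f) a b) (h' : γ ≤ rel (gr g) b c) : γ ≤ rel (gr (f ≫ g)) a c :=
  D.ext.comp_intro h h'

theorem comp_elim {f : X ⟶ Y} {g : Y ⟶ W} {a : Z ⟶ X.A} {c : Z ⟶ W.A} {χ : D.fib Z}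
    (h : γ ≤ rel (gr (f ≫ g)) a c)
    (k : ∀ {Z' : D.C} (s : Z' ⟶ Z) (b : Z' ⟶ Y.A) (γ' : D.fib Z'), γ' ≤ pull D.P s γ →
      γ' ≤ rel (gr f) (s ≫ a) b → γ' ≤ rel (gr g) b (s ≫ c) → γ' ≤ pull D.P s χ) : γ ≤ χ :=
  D.ext.comp_elim h k

/-- If `f(a) = b` and `g(f(a)) = c` then `g(b) = c`. -/
theorem of_comp {f : X ⟶ Y} {g : Y ⟶ W} {a : Z ⟶ X.A} {b : Z ⟶ Y.A} {c : Z ⟶ W.A}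
    (h : γ ≤ rel (gr f) a b) (h' : γ ≤ rel (gr (f ≫ g)) a c) : γ ≤ rel (gr g) b c :=
  comp_elim h' fun s b' γ' hγ h₁ h₂ => by
    rw [pull_rel]
    exact congr_left (single h₁ (rel_restrict hγ h)) h₂

end Relations

theorem gr_id (X : TP D) : gr (𝟙 X) = X.ρ := rfl

theorem hom_ext {f g : X ⟶ Y} (h : gr f = gr g) : f = g := Hom.ext h

/-- Functional relations are discretely ordered: if `f ≤ g`, then `g` is forced by totality of `f`
and single-valuedness of `g`. -/
theorem hom_ext_of_le {f g : X ⟶ Y} (h : ∀ {Z : D.C} (γ : D.fib Z) (a : Z ⟶ X.A) (b : Z ⟶ Y.A),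
    γ ≤ rel (gr f) a b → γ ≤ rel (gr g) a b) : f = g := by
  refine hom_ext (le_antisymm (le_of_stages h) (le_of_stages fun γ a b hg => ?_))
  refine total_elim f (dom hg) fun s c γ' hγ hf => ?_
  have hg' := rel_restrict hγ hg
  rw [pull_rel]
  exact congr_right (single (h _ _ _ hf) hg') hf

/-- A functional relation, from its properties in the internal language. -/
def homMk (φ : D.fib (X.A ⨯ Y.A))
    (dom : ∀ {Z : D.C} {γ : D.fib Z} {a : Z ⟶ X.A} {b : Z ⟶ Y.A}, γ ≤ rel φ a b →
      γ ≤ rel X.ρ a a)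
    (cod : ∀ {Z : D.C} {γ : D.fib Z} {a : Z ⟶ X.A} {b : Z ⟶ Y.A}, γ ≤ rel φ a b →
      γ ≤ rel Y.ρ b b)
    (left : ∀ {Z : D.C} {γ : D.fib Z} {a a' : Z ⟶ X.A} {b : Z ⟶ Y.A}, γ ≤ rel X.ρ a a' →
      γ ≤ rel φ a' b → γ ≤ rel φ a b)
    (right : ∀ {Z : D.C} {γ : D.fib Z} {a : Z ⟶ X.A} {b b' : Z ⟶ Y.A}, γ ≤ rel φ a b →
      γ ≤ rel Y.ρ b b' → γ ≤ rel φ a b')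
    (single : ∀ {Z : D.C} {γ : D.fib Z} {a : Z ⟶ X.A} {b b' : Z ⟶ Y.A}, γ ≤ rel φ a b →
      γ ≤ rel φ a b' → γ ≤ rel Y.ρ b b')
    (total : ∀ {Z : D.C} {γ : D.fib Z} {a : Z ⟶ X.A}, γ ≤ rel X.ρ a a →
      γ ≤ pull D.P a (D.ext.ex prod.fst (isProj_fst X.A Y.A) φ)) : X ⟶ Y :=
  Hom.ofRel φ (fun _ _ => dom le_rfl) (fun _ _ => cod le_rfl)
    (fun _ _ _ => left inf_le_left inf_le_right) (fun _ _ _ => right inf_le_left inf_le_right)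
    (fun _ _ _ => single inf_le_left inf_le_right)
    (fun χ h => (total le_rfl).trans (by
      rw [pull_id]
      exact (D.ext.adj _ _).l_le h))

@[simp]
theorem gr_homMk (φ : D.fib (X.A ⨯ Y.A)) (h₁ h₂ h₃ h₄ h₅ h₆) :
    gr (homMk φ h₁ h₂ h₃ h₄ h₅ h₆ : X ⟶ Y) = φ := rfl

/-! ### Monomorphisms, isomorphisms and surjections -/

/-- Internal injectivity of a functional relation. -/
def Inj (f : X ⟶ Y) : Prop :=
  ∀ ⦃Z : D.C⦄ ⦃γ : D.fib Z⦄ ⦃a a' : Z ⟶ X.A⦄ ⦃b : Z ⟶ Y.A⦄,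
    γ ≤ rel (gr f) a b → γ ≤ rel (gr f) a' b → γ ≤ rel X.ρ a a'

/-- Internal surjectivity of a functional relation. -/
def Surj (f : X ⟶ Y) : Prop :=
  ∀ ⦃Z : D.C⦄ ⦃γ : D.fib Z⦄ ⦃b : Z ⟶ Y.A⦄, γ ≤ rel Y.ρ b b →
    γ ≤ pull D.P b (D.ext.ex prod.fst (isProj_fst Y.A X.A) (conv (gr f)))

theorem Surj.elim {f : X ⟶ Y} (hf : Surj f) {Z : D.C} {γ χ : D.fib Z} {b : Z ⟶ Y.A}
    (h : γ ≤ rel Y.ρ b b)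
    (k : ∀ {Z' : D.C} (g : Z' ⟶ Z) (a : Z' ⟶ X.A) (γ' : D.fib Z'), γ' ≤ pull D.P g γ →
      γ' ≤ rel (gr f) a (g ≫ b) → γ' ≤ pull D.P g χ) : γ ≤ χ :=
  D.ext.exFst_elim (hf h) fun g a γ' hγ h' => k g a γ' hγ (by rwa [rel_conv] at h')

theorem ex_conv_intro {Z : D.C} {γ : D.fib Z} {A B : D.C} {φ : D.fib (A ⨯ B)} {a : Z ⟶ A}
    {b : Z ⟶ B} (h : γ ≤ rel φ a b) :
    γ ≤ pull D.P b (D.ext.ex prod.fst (isProj_fst B A) (conv φ)) :=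
  D.ext.exFst_intro (by rwa [rel_conv])

/-- The inverse of an internally bijective functional relation is its converse. -/
theorem isIso_of_inj_surj {f : X ⟶ Y} (hi : Inj f) (hs : Surj f) : IsIso f := by
  let g : Y ⟶ X := homMk (conv (gr f)) (fun h => by rw [rel_conv] at h; exact cod h)
    (fun h => by rw [rel_conv] at h; exact dom h)
    (fun h h' => by rw [rel_conv] at h' ⊢; exact congr_right (eq_symm h) h')
    (fun h h' => by rw [rel_conv] at h ⊢; exact congr_left h' h)
    (fun h h' => by rw [rel_conv] at h h'; exact hi h h')
    (fun h => hs h)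
  refine ⟨g, hom_ext_of_le fun γ a a' h => ?_, hom_ext_of_le fun γ b b' h => ?_⟩
  · refine comp_elim h fun s b γ' hγ h₁ h₂ => ?_
    rw [gr_homMk, rel_conv] at h₂
    rw [gr_id, pull_rel]
    exact hi h₁ h₂
  · refine comp_elim h fun s b γ' hγ h₁ h₂ => ?_
    rw [gr_homMk, rel_conv] at h₁
    rw [gr_id, pull_rel]
    exact single h₁ h₂

theorem mono_of_inj {f : X ⟶ Y} (hf : Inj f) : Mono f := by
  refine ⟨fun {V} g h e => hom_ext_of_le fun γ v a hg => ?_⟩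
  refine total_elim f (cod hg) fun s b γ' hγ hb => ?_
  have h₁ := comp_intro (rel_restrict hγ hg) hb
  rw [e] at h₁
  refine comp_elim h₁ fun t a' γ'' hγ' h₂ h₃ => ?_
  rw [pull_rel, pull_rel]
  exact congr_right (hf h₃ (rel_restrict hγ' hb)) h₂

/-- An arrow that is compatible with the kernel of a surjection descends along it. -/
theorem Surj.exists_desc {e : X ⟶ Y} (he : Surj e) (h : X ⟶ V)
    (k : ∀ {Z : D.C} {γ : D.fib Z} {a a' : Z ⟶ X.A} {b : Z ⟶ Y.A} {v v' : Z ⟶ V.A},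
      γ ≤ rel (gr e) a b → γ ≤ rel (gr e) a' b → γ ≤ rel (gr h) a v → γ ≤ rel (gr h) a' v' →
      γ ≤ rel V.ρ v v') : ∃ d : Y ⟶ V, e ≫ d = h := by
  -- `d(b) = v` means that `h(a) = v` for some `a` with `e(a) = b`.
  let d : Y ⟶ V := homMk (compRel D.ext (conv (gr e)) (gr h))
    (fun hr => D.ext.comp_elim hr fun s a γ' hγ h₁ h₂ => by
      rw [rel_conv] at h₁
      rw [pull_rel]
      exact cod h₁)
    (fun hr => D.ext.comp_elim hr fun s a γ' hγ h₁ h₂ => by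
      rw [pull_rel]
      exact cod h₂)
    (fun hr hr' => D.ext.comp_elim hr' fun s a γ' hγ h₁ h₂ => by
      rw [rel_conv] at h₁
      rw [pull_rel]
      refine D.ext.comp_intro ?_ h₂
      rw [rel_conv]
      exact congr_right (eq_symm (rel_restrict hγ hr)) h₁)
    (fun hr hr' => D.ext.comp_elim hr fun s a γ' hγ h₁ h₂ => by
      rw [pull_rel]
      exact D.ext.comp_intro h₁ (congr_right (rel_restrict hγ hr') h₂))
    (fun hr hr' => D.ext.comp_elim hr fun s a γ' hγ h₁ h₂ => by
      have hr'' := rel_restrict hγ hr'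
      refine D.ext.comp_elim hr'' fun t a' γ'' hγ' h₃ h₄ => ?_
      rw [rel_conv] at h₁ h₃
      rw [pull_rel, pull_rel]
      exact k (rel_restrict hγ' h₁) h₃ (rel_restrict hγ' h₂) h₄)
    (fun hb => he.elim hb fun s a γ' hγ ha => by
      refine total_elim h (dom ha) fun t v γ'' hγ' hv => ?_
      have h₁ := D.ext.comp_intro (φ := conv (gr e))
        (by rw [rel_conv]; exact rel_restrict hγ' ha) hv
      rw [pull_pull, pull_pull]
      have := D.ext.exFst_intro h₁
      rwa [← Category.assoc] at this)
  refine ⟨d, hom_ext_of_le fun γ a v hr => ?_⟩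
  refine comp_elim hr fun s b γ' hγ h₁ h₂ => ?_
  rw [gr_homMk] at h₂
  refine D.ext.comp_elim h₂ fun t a' γ'' hγ' h₃ h₄ => ?_
  rw [rel_conv] at h₃
  rw [pull_rel, pull_rel]
  have h₅ := rel_restrict hγ' h₁
  refine total_elim h (dom h₅) fun r v' δ' hδ hv => ?_
  rw [pull_rel]
  exact congr_right (k (rel_restrict hδ h₅) (rel_restrict hδ h₃) hv (rel_restrict hδ h₄)) hv

theorem Surj.epi {e : X ⟶ Y} (he : Surj e) : Epi e := by
  refine ⟨fun {V} g h w => hom_ext_of_le fun γ b v hg => ?_⟩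
  refine he.elim (dom hg) fun s a γ' hγ ha => ?_
  have h₁ := comp_intro ha (rel_restrict hγ hg)
  rw [w] at h₁
  refine comp_elim h₁ fun t b' γ'' hγ' h₂ h₃ => ?_
  rw [pull_rel, pull_rel]
  exact congr_left (single h₂ (rel_restrict hγ' ha)) h₃

end TP

namespace TP

variable {D : EED.{u}} {X Y V W : TP D}

/-- An object of the exact completion, from the symmetry and transitivity of a relation in the
internal language. -/
abbrev ofStages (A : D.C) (ρ : D.fib (A ⨯ A))
    (symm : ∀ {Z : D.C} {γ : D.fib Z} {a b : Z ⟶ A}, γ ≤ rel ρ a b → γ ≤ rel ρ b a)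
    (trans : ∀ {Z : D.C} {γ : D.fib Z} {a b c : Z ⟶ A}, γ ≤ rel ρ a b → γ ≤ rel ρ b c →
      γ ≤ rel ρ a c) : TP D where
  A := A
  ρ := ρ
  symm := symm (rel_fst_snd ρ).ge
  trans := by
    rw [p12_rel]
    exact trans (a := prod.fst ≫ prod.fst) (b := prod.fst ≫ prod.snd) (c := prod.snd)
      inf_le_left inf_le_right

/-! ### Arrows tracked by an arrow of the base -/

/-- An arrow of the base category that takes `ρ`-related elements to `σ`-related elements. -/
def Tracks (X Y : TP D) (m : X.A ⟶ Y.A) : Prop :=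
  ∀ ⦃Z : D.C⦄ ⦃γ : D.fib Z⦄ ⦃a a' : Z ⟶ X.A⦄, γ ≤ rel X.ρ a a' →
    γ ≤ rel Y.ρ (a ≫ m) (a' ≫ m)

theorem le_trackRel_iff {m : X.A ⟶ Y.A} {Z : D.C} {γ : D.fib Z} {a : Z ⟶ X.A} {b : Z ⟶ Y.A} :
    γ ≤ rel (rel X.ρ prod.fst prod.fst ⊓ rel Y.ρ (prod.fst ≫ m) prod.snd) a b ↔
      γ ≤ rel X.ρ a a ∧ γ ≤ rel Y.ρ (a ≫ m) b := by
  rw [rel_inf, rel_rel, rel_rel, prod.lift_fst, prod.lift_fst_assoc, prod.lift_snd, le_inf_iff]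

/-- The arrow `(A, ρ) ⟶ (B, σ)` represented by an arrow `A ⟶ B` of the base category. -/
def track (m : X.A ⟶ Y.A) (hm : Tracks X Y m) : X ⟶ Y :=
  homMk (rel X.ρ prod.fst prod.fst ⊓ rel Y.ρ (prod.fst ≫ m) prod.snd)
    (fun h => (le_trackRel_iff.1 h).1) (fun h => eq_right (le_trackRel_iff.1 h).2)
    (fun h h' => le_trackRel_iff.2 ⟨eq_left h, eq_trans (hm h) (le_trackRel_iff.1 h').2⟩)
    (fun h h' => le_trackRel_iff.2 ⟨(le_trackRel_iff.1 h).1, eq_trans (le_trackRel_iff.1 h).2 h'⟩)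
    (fun h h' => eq_trans (eq_symm (le_trackRel_iff.1 h).2) (le_trackRel_iff.1 h').2)
    (fun h => D.ext.exFst_intro (le_trackRel_iff.2 ⟨h, hm h⟩))

section Track

variable {m : X.A ⟶ Y.A} {hm : Tracks X Y m} {Z : D.C} {γ : D.fib Z}

theorem le_track_iff {a : Z ⟶ X.A} {b : Z ⟶ Y.A} :
    γ ≤ rel (gr (track m hm)) a b ↔ γ ≤ rel X.ρ a a ∧ γ ≤ rel Y.ρ (a ≫ m) b :=
  le_trackRel_iff

theorem track_self {a : Z ⟶ X.A} (h : γ ≤ rel X.ρ a a) :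
    γ ≤ rel (gr (track m hm)) a (a ≫ m) :=
  le_track_iff.2 ⟨h, hm h⟩

theorem hom_eq_track {f : X ⟶ Y} (h : ∀ {Z : D.C} {γ : D.fib Z} {a : Z ⟶ X.A}
    {b : Z ⟶ Y.A}, γ ≤ rel (gr f) a b → γ ≤ rel Y.ρ (a ≫ m) b) : f = track m hm :=
  hom_ext_of_le fun _ _ _ hf => le_track_iff.2 ⟨dom hf, h hf⟩

theorem Tracks.comp {n : Y.A ⟶ V.A} (hm : Tracks X Y m) (hn : Tracks Y V n) :
    Tracks X V (m ≫ n) := fun Z γ a a' h => by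
  simpa only [Category.assoc] using hn (hm h)

theorem track_comp_track {n : Y.A ⟶ V.A} {hn : Tracks Y V n} :
    track m hm ≫ track n hn = track (m ≫ n) (hm.comp hn) := by
  refine hom_eq_track fun h => ?_
  refine comp_elim h fun s b γ' hγ h₁ h₂ => ?_
  rw [le_track_iff] at h₁ h₂
  rw [pull_rel]
  have := eq_trans (hn h₁.2) h₂.2
  simpa only [Category.assoc] using this

theorem track_id {h : Tracks X X (𝟙 X.A)} : track (𝟙 X.A) h = 𝟙 X :=
  (hom_eq_track fun h => by rwa [Category.comp_id]).symm

end Track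

/-! ### Finite limits -/

theorem eq_of_isTerminal {T : TP D} (hT : IsTerminal T.A) (hρ : T.ρ = ⊤) {Z : D.C}
    {γ : D.fib Z} {a b : Z ⟶ T.A} : γ ≤ rel T.ρ a b := by
  rw [hρ, rel, pull_top]
  exact le_top

/-- A terminal object of the base with the total relation is terminal. -/
def isTerminal {T : TP D} (hT : IsTerminal T.A) (hρ : T.ρ = ⊤) : IsTerminal T :=
  IsTerminal.ofUniqueHom (fun X => track (hT.from X.A) fun _ _ _ _ _ => eq_of_isTerminal hT hρ)
    (fun X f => hom_eq_track fun _ => eq_of_isTerminal hT hρ)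

/-- Internal joint injectivity of a pair of functional relations. -/
def JointInj (p : W ⟶ X) (q : W ⟶ Y) : Prop :=
  ∀ ⦃Z : D.C⦄ ⦃γ : D.fib Z⦄ ⦃w w' : Z ⟶ W.A⦄ ⦃a : Z ⟶ X.A⦄ ⦃b : Z ⟶ Y.A⦄,
    γ ≤ rel (gr p) w a → γ ≤ rel (gr q) w b → γ ≤ rel (gr p) w' a → γ ≤ rel (gr q) w' b →
    γ ≤ rel W.ρ w w'

/-- The relation `∃w. p(w, a) ∧ q(w, b)` spanned by a pair of functional relations. -/
def spanRel (p : W ⟶ X) (q : W ⟶ Y) : D.fib (X.A ⨯ Y.A) :=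
  compRel D.ext (conv (gr p)) (gr q)

section Span

variable {p : W ⟶ X} {q : W ⟶ Y} {Z : D.C} {γ : D.fib Z} {a : Z ⟶ X.A} {b : Z ⟶ Y.A}

theorem span_intro {w : Z ⟶ W.A} (h : γ ≤ rel (gr p) w a) (h' : γ ≤ rel (gr q) w b) :
    γ ≤ rel (spanRel p q) a b :=
  D.ext.comp_intro (by rwa [rel_conv]) h'

theorem span_elim {χ : D.fib Z} (h : γ ≤ rel (spanRel p q) a b)
    (k : ∀ {Z' : D.C} (g : Z' ⟶ Z) (w : Z' ⟶ W.A) (γ' : D.fib Z'), γ' ≤ pull D.P g γ →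
      γ' ≤ rel (gr p) w (g ≫ a) → γ' ≤ rel (gr q) w (g ≫ b) → γ' ≤ pull D.P g χ) : γ ≤ χ :=
  D.ext.comp_elim h fun g w γ' hγ h₁ h₂ => k g w γ' hγ (by rwa [rel_conv] at h₁) h₂

end Span

/-- The relation `∃c. f(a, c) ∧ g(b, c)` given by a pair of functional relations. -/
def cospanRel (f : X ⟶ V) (g : Y ⟶ V) : D.fib (X.A ⨯ Y.A) :=
  compRel D.ext (gr f) (conv (gr g))

section Cospan

variable {f : X ⟶ V} {g : Y ⟶ V} {Z : D.C} {γ : D.fib Z} {a : Z ⟶ X.A} {b : Z ⟶ Y.A}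

theorem cospan_intro {c : Z ⟶ V.A} (h : γ ≤ rel (gr f) a c) (h' : γ ≤ rel (gr g) b c) :
    γ ≤ rel (cospanRel f g) a b :=
  D.ext.comp_intro h (by rwa [rel_conv])

theorem cospan_elim {χ : D.fib Z} (h : γ ≤ rel (cospanRel f g) a b)
    (k : ∀ {Z' : D.C} (s : Z' ⟶ Z) (c : Z' ⟶ V.A) (γ' : D.fib Z'), γ' ≤ pull D.P s γ →
      γ' ≤ rel (gr f) (s ≫ a) c → γ' ≤ rel (gr g) (s ≫ b) c → γ' ≤ pull D.P s χ) : γ ≤ χ :=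
  D.ext.comp_elim h fun g w γ' hγ h₁ h₂ => k g w γ' hγ h₁ (by rwa [rel_conv] at h₂)

end Cospan

/-- The pullback of two functional relations, in the internal language: its legs are jointly
injective, and every pair of elements with the same image has a common preimage. -/
structure InternalPullback (p : W ⟶ X) (q : W ⟶ Y) (f : X ⟶ V) (g : Y ⟶ V) : Prop where
  w : p ≫ f = q ≫ g
  inj : JointInj p q
  surj {Z : D.C} {γ : D.fib Z} {a : Z ⟶ X.A} {b : Z ⟶ Y.A} {c : Z ⟶ V.A} :
    γ ≤ rel (gr f) a c → γ ≤ rel (gr g) b c → γ ≤ rel (spanRel p q) a b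

theorem JointInj.hom_ext {p : W ⟶ X} {q : W ⟶ Y} (h : JointInj p q) {U : TP D} {m n : U ⟶ W}
    (hp : m ≫ p = n ≫ p) (hq : m ≫ q = n ≫ q) : m = n := by
  refine hom_ext_of_le fun γ z w hm => ?_
  refine total_elim p (cod hm) fun s a γ' hγ ha => ?_
  refine total_elim q (dom ha) fun t b γ'' hγ' hb => ?_
  have hm' := rel_restrict hγ' (rel_restrict hγ hm)
  have ha' := rel_restrict hγ' ha
  have h₁ := comp_intro hm' ha'
  have h₂ := comp_intro hm' hb
  rw [hp] at h₁
  rw [hq] at h₂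
  refine comp_elim h₁ fun s₁ w₁ γ₁ hγ₁ h₃ h₄ => ?_
  refine comp_elim (rel_restrict hγ₁ h₂) fun s₂ w₂ γ₂ hγ₂ h₅ h₆ => ?_
  have h₇ := single (rel_restrict hγ₂ h₃) h₅
  have h₈ := h (rel_restrict hγ₂ h₄) (congr_left (eq_symm h₇) h₆)
    (rel_restrict hγ₂ (rel_restrict hγ₁ ha')) (rel_restrict hγ₂ (rel_restrict hγ₁ hb))
  simp only [pull_rel]
  exact congr_right h₈ (rel_restrict hγ₂ h₃)

namespace InternalPullback

variable {p : W ⟶ X} {q : W ⟶ Y} {f : X ⟶ V} {g : Y ⟶ V}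

/-- The lift of `h` and `k` relates `z` to the `w` with `p(w) = h(z)` and `q(w) = k(z)`. -/
theorem exists_lift (H : InternalPullback p q f g) {U : TP D} (h : U ⟶ X) (k : U ⟶ Y)
    (hk : h ≫ f = k ≫ g) : ∃ l : U ⟶ W, l ≫ p = h ∧ l ≫ q = k := by
  have elim {Z : D.C} {γ χ : D.fib Z} {z : Z ⟶ U.A} {w : Z ⟶ W.A}
      (hr : γ ≤ rel (cospanRel h p ⊓ cospanRel k q) z w)
      (e : ∀ {Z' : D.C} (s : Z' ⟶ Z) (a : Z' ⟶ X.A) (b : Z' ⟶ Y.A) (γ' : D.fib Z'),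
        γ' ≤ pull D.P s γ → γ' ≤ rel (gr h) (s ≫ z) a → γ' ≤ rel (gr p) (s ≫ w) a →
        γ' ≤ rel (gr k) (s ≫ z) b → γ' ≤ rel (gr q) (s ≫ w) b → γ' ≤ pull D.P s χ) :
      γ ≤ χ := by
    rw [rel_inf, le_inf_iff] at hr
    refine cospan_elim hr.1 fun s a γ' hγ h₁ h₂ => ?_
    refine cospan_elim (rel_restrict hγ hr.2) fun t b γ'' hγ' h₃ h₄ => ?_
    have hγ'' := pull_restrict hγ' hγ
    rw [pull_pull]
    have h₁' := rel_restrict hγ' h₁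
    have h₂' := rel_restrict hγ' h₂
    rw [← Category.assoc] at h₁' h₂' h₃ h₄
    exact e (t ≫ s) _ b γ'' hγ'' h₁' h₂' h₃ h₄
  have intro {Z : D.C} {γ : D.fib Z} {z : Z ⟶ U.A} {w : Z ⟶ W.A} {a : Z ⟶ X.A} {b : Z ⟶ Y.A}
      (h₁ : γ ≤ rel (gr h) z a) (h₂ : γ ≤ rel (gr p) w a) (h₃ : γ ≤ rel (gr k) z b)
      (h₄ : γ ≤ rel (gr q) w b) : γ ≤ rel (cospanRel h p ⊓ cospanRel k q) z w := by
    rw [rel_inf]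
    exact le_inf (cospan_intro h₁ h₂) (cospan_intro h₃ h₄)
  let l : U ⟶ W := homMk (cospanRel h p ⊓ cospanRel k q)
    (fun hr => elim hr fun s a b γ' hγ h₁ h₂ h₃ h₄ => by
      rw [pull_rel]
      exact dom h₁)
    (fun hr => elim hr fun s a b γ' hγ h₁ h₂ h₃ h₄ => by
      rw [pull_rel]
      exact dom h₂)
    (fun hr hr' => elim hr' fun s a b γ' hγ h₁ h₂ h₃ h₄ => by
      rw [pull_rel]
      have := eq_symm (rel_restrict hγ hr)
      exact intro (congr_left this h₁) h₂ (congr_left this h₃) h₄)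
    (fun hr hr' => elim hr fun s a b γ' hγ h₁ h₂ h₃ h₄ => by
      rw [pull_rel]
      have := rel_restrict hγ hr'
      exact intro h₁ (congr_left this h₂) h₃ (congr_left this h₄))
    (fun hr hr' => elim hr fun s a b γ' hγ h₁ h₂ h₃ h₄ => by
      refine elim (rel_restrict hγ hr') fun s' a' b' γ'' hγ' h₅ h₆ h₇ h₈ => ?_
      simp only [pull_rel]
      have ha := single (rel_restrict hγ' h₁) h₅
      have hb := single (rel_restrict hγ' h₃) h₇
      exact H.inj (congr_right ha (rel_restrict hγ' h₂)) (congr_right hb (rel_restrict hγ' h₄))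
        h₆ h₈)
    (fun {Z γ z} hz => by
      refine total_elim h hz fun s a γ' hγ ha => ?_
      refine total_elim f (cod ha) fun t c γ₁ hγ₁ hc => ?_
      have ha' := rel_restrict hγ₁ ha
      have h₁ := comp_intro ha' hc
      rw [hk] at h₁
      refine comp_elim h₁ fun r b γ₂ hγ₂ h₂ h₃ => ?_
      refine span_elim (H.surj (rel_restrict hγ₂ hc) h₃) fun m w γ₃ hγ₃ h₄ h₅ => ?_
      simp only [pull_pull]
      have := D.ext.exFst_intro (intro (rel_restrict hγ₃ (rel_restrict hγ₂ ha')) h₄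
        (rel_restrict hγ₃ h₂) h₅)
      simpa only [Category.assoc] using this)
  refine ⟨l, hom_ext_of_le fun γ z a hr => ?_, hom_ext_of_le fun γ z b hr => ?_⟩
  · refine comp_elim hr fun s w γ' hγ h₁ h₂ => ?_
    refine elim h₁ fun t a' b γ'' hγ' h₃ h₄ h₅ h₆ => ?_
    simp only [pull_rel]
    exact congr_right (single h₄ (rel_restrict hγ' h₂)) h₃
  · refine comp_elim hr fun s w γ' hγ h₁ h₂ => ?_
    refine elim h₁ fun t a' b γ'' hγ' h₃ h₄ h₅ h₆ => ?_
    simp only [pull_rel]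
    exact congr_right (single h₆ (rel_restrict hγ' h₂)) h₅

theorem isPullback (H : InternalPullback p q f g) : IsPullback p q f g :=
  ⟨⟨H.w⟩, ⟨PullbackCone.IsLimit.mk _
    (fun s => (H.exists_lift s.fst s.snd s.condition).choose)
    (fun s => (H.exists_lift s.fst s.snd s.condition).choose_spec.1)
    (fun s => (H.exists_lift s.fst s.snd s.condition).choose_spec.2)
    (fun s m h₁ h₂ => H.inj.hom_ext
      (h₁.trans (H.exists_lift s.fst s.snd s.condition).choose_spec.1.symm)
      (h₂.trans (H.exists_lift s.fst s.snd s.condition).choose_spec.2.symm))⟩⟩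

end InternalPullback

/-- The equality of the pullback `X ×_V Y`, on pairs of elements. -/
def pbRel (f : X ⟶ V) (g : Y ⟶ V) : D.fib ((X.A ⨯ Y.A) ⨯ (X.A ⨯ Y.A)) :=
  rel X.ρ (prod.fst ≫ prod.fst) (prod.snd ≫ prod.fst) ⊓
    rel Y.ρ (prod.fst ≫ prod.snd) (prod.snd ≫ prod.snd) ⊓ pull D.P prod.fst (cospanRel f g)

theorem le_pbRel_iff {f : X ⟶ V} {g : Y ⟶ V} {Z : D.C} {γ : D.fib Z} {a b : Z ⟶ X.A ⨯ Y.A} :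
    γ ≤ rel (pbRel f g) a b ↔
      (γ ≤ rel X.ρ (a ≫ prod.fst) (b ≫ prod.fst) ∧ γ ≤ rel Y.ρ (a ≫ prod.snd) (b ≫ prod.snd)) ∧
        γ ≤ rel (cospanRel f g) (a ≫ prod.fst) (a ≫ prod.snd) := by
  simp only [pbRel, rel_inf, rel_rel, le_inf_iff, prod.lift_fst_assoc,
    prod.lift_snd_assoc, pull_eq_rel (cospanRel f g)]

theorem cospan_congr {f : X ⟶ V} {g : Y ⟶ V} {Z : D.C} {γ : D.fib Z} {a a' : Z ⟶ X.A}
    {b b' : Z ⟶ Y.A} (h : γ ≤ rel (cospanRel f g) a b) (ha : γ ≤ rel X.ρ a a')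
    (hb : γ ≤ rel Y.ρ b b') : γ ≤ rel (cospanRel f g) a' b' :=
  cospan_elim h fun s c γ' hγ h₁ h₂ => by
    rw [pull_rel]
    exact cospan_intro (congr_left (rel_restrict hγ ha) h₁) (congr_left (rel_restrict hγ hb) h₂)

/-- The pullback of `f : X ⟶ V` and `g : Y ⟶ V`: pairs of elements with the same image. -/
abbrev pb (f : X ⟶ V) (g : Y ⟶ V) : TP D :=
  ofStages (X.A ⨯ Y.A) (pbRel f g)
    (fun h => by
      rw [le_pbRel_iff] at h ⊢
      exact ⟨⟨eq_symm h.1.1, eq_symm h.1.2⟩, cospan_congr h.2 h.1.1 h.1.2⟩)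
    (fun h h' => by
      rw [le_pbRel_iff] at h h' ⊢
      exact ⟨⟨eq_trans h.1.1 h'.1.1, eq_trans h.1.2 h'.1.2⟩, h.2⟩)

section Pullback

variable (f : X ⟶ V) (g : Y ⟶ V)

theorem tracks_pbFst : Tracks (pb f g) X (prod.fst : X.A ⨯ Y.A ⟶ X.A) :=
  fun _ _ _ _ h => (le_pbRel_iff.1 h).1.1

theorem tracks_pbSnd : Tracks (pb f g) Y (prod.snd : X.A ⨯ Y.A ⟶ Y.A) :=
  fun _ _ _ _ h => (le_pbRel_iff.1 h).1.2

/-- The first projection of the pullback. -/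
def pbFst : pb f g ⟶ X := track _ (tracks_pbFst f g)

/-- The second projection of the pullback. -/
def pbSnd : pb f g ⟶ Y := track _ (tracks_pbSnd f g)

theorem pb_internalPullback : InternalPullback (pbFst f g) (pbSnd f g) f g where
  w := by
    refine hom_ext_of_le fun γ p c h => ?_
    refine comp_elim h fun s a γ' hγ h₁ h₂ => ?_
    obtain ⟨h₃, h₄⟩ := le_track_iff.1 h₁
    refine cospan_elim (le_pbRel_iff.1 h₃).2 fun t c' γ'' hγ' h₅ h₆ => ?_
    simp only [pull_rel]
    have h₇ := rel_restrict hγ' (le_pbRel_iff.1 h₃).1.2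
    have h₈ := single (congr_left (rel_restrict hγ' h₄) h₅) (rel_restrict hγ' h₂)
    refine congr_right h₈ (comp_intro (track_self (rel_restrict hγ' h₃)) ?_)
    rwa [Category.assoc]
  inj := by
    intro Z γ w w' a b h₁ h₂ h₃ h₄
    have h₅ := le_track_iff.1 h₁
    have h₆ := le_track_iff.1 h₂
    have h₇ := le_track_iff.1 h₃
    have h₈ := le_track_iff.1 h₄
    exact le_pbRel_iff.2 ⟨⟨eq_trans h₅.2 (eq_symm h₇.2), eq_trans h₆.2 (eq_symm h₈.2)⟩,
      (le_pbRel_iff.1 h₅.1).2⟩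
  surj := by
    intro Z γ a b c h₁ h₂
    have h₃ : γ ≤ rel (pb f g).ρ (prod.lift a b) (prod.lift a b) := by
      refine le_pbRel_iff.2 ?_
      simp only [prod.lift_fst, prod.lift_snd]
      exact ⟨⟨dom h₁, dom h₂⟩, cospan_intro h₁ h₂⟩
    have h₄ := track_self (hm := tracks_pbFst f g) h₃
    have h₅ := track_self (hm := tracks_pbSnd f g) h₃
    rw [prod.lift_fst] at h₄
    rw [prod.lift_snd] at h₅
    exact span_intro h₄ h₅

end Pullback

/-- The two projections of the kernel pair of a monomorphism are equal. -/
theorem inj_of_mono (f : X ⟶ Y) [Mono f] : Inj f := by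
  intro Z γ a a' b h h'
  have K := pb_internalPullback f f
  have e : pbFst f f = pbSnd f f := (cancel_mono f).1 K.w
  refine span_elim (K.surj h h') fun s x γ' hγ h₁ h₂ => ?_
  rw [pull_rel]
  rw [e] at h₁
  exact single h₁ h₂

/-- The total relation on a terminal object of the base. -/
abbrev terminalObj (D : EED.{u}) : TP D :=
  ofStages (⊤_ D.C) ⊤ (fun h => by rw [rel, pull_top]; exact le_top)
    (fun h h' => by rw [rel, pull_top]; exact le_top)

/-- The exact completion has a terminal object. -/
def isTerminalTerminalObj (D : EED.{u}) : IsTerminal (terminalObj D) :=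
  isTerminal (T := terminalObj D) terminalIsTerminal rfl

/-- Jointly monic arrows are jointly injective: they induce a monomorphism to the product, which is
the pullback over the terminal object. -/
theorem jointInj_of_jointMono {p : W ⟶ X} {q : W ⟶ Y}
    (h : ∀ ⦃U : TP D⦄ (m n : U ⟶ W), m ≫ p = n ≫ p → m ≫ q = n ≫ q → m = n) :
    JointInj p q := by
  let T := isTerminalTerminalObj D
  have K := pb_internalPullback (T.from X) (T.from Y)
  obtain ⟨m, hp, hq⟩ := K.exists_lift p q (T.hom_ext _ _)
  have : Mono m := ⟨fun x y hxy => h _ _ (by rw [← hp, reassoc_of% hxy])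
    (by rw [← hq, reassoc_of% hxy])⟩
  intro Z γ w w' a b h₁ h₂ h₃ h₄
  rw [← hp] at h₁ h₃
  rw [← hq] at h₂ h₄
  refine total_elim m (dom h₁) fun s z γ' hγ hz => ?_
  refine total_elim m (dom (rel_restrict hγ h₃)) fun s' z' γ'' hγ' hz' => ?_
  have hz := rel_restrict hγ' hz
  simp only [pull_rel]
  have res {U : TP D} {r : W ⟶ U} {y : Z ⟶ W.A} {c : Z ⟶ U.A} (hr : γ ≤ rel (gr r) y c) :=
    rel_restrict hγ' (rel_restrict hγ hr)
  have e := K.inj (of_comp hz (res h₁)) (of_comp hz (res h₂)) (of_comp hz' (res h₃))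
    (of_comp hz' (res h₄))
  exact inj_of_mono m (congr_right e hz) hz'

/-- Every pullback is an internal one, as it is isomorphic to the one built from pairs. -/
theorem InternalPullback.of_isPullback {p : W ⟶ X} {q : W ⟶ Y} {f : X ⟶ V} {g : Y ⟶ V}
    (H : IsPullback p q f g) : InternalPullback p q f g := by
  refine ⟨H.w, jointInj_of_jointMono fun U m n h h' => H.hom_ext h h', fun h₁ h₂ => ?_⟩
  have K := pb_internalPullback f g
  refine span_elim (K.surj h₁ h₂) fun s x γ' hγ h₃ h₄ => ?_
  rw [← H.lift_fst _ _ K.w] at h₃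
  rw [← H.lift_snd _ _ K.w] at h₄
  refine comp_elim h₃ fun t w γ'' hγ' h₅ h₆ => ?_
  refine comp_elim (rel_restrict hγ' h₄) fun r w' γ₃ hγ₃ h₇ h₈ => ?_
  simp only [pull_rel]
  exact span_intro (rel_restrict hγ₃ h₆) (congr_left (single h₇ (rel_restrict hγ₃ h₅)) h₈)

instance : HasFiniteLimits (TP D) := by
  have : HasTerminal (TP D) := (isTerminalTerminalObj D).hasTerminal
  have : HasPullbacks (TP D) := by
    have (X Y V : TP D) (f : X ⟶ V) (g : Y ⟶ V) : HasLimit (cospan f g) :=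
      (pb_internalPullback f g).isPullback.hasPullback
    exact hasPullbacks_of_hasLimit_cospan _
  exact hasFiniteLimits_of_hasTerminal_and_pullbacks

/-! ### Regularity and exactness -/

/-- The relation of equality on the image of `f`. -/
def imageRel (f : X ⟶ Y) : D.fib (Y.A ⨯ Y.A) :=
  Y.ρ ⊓ pull D.P prod.fst (D.ext.ex prod.fst (isProj_fst Y.A X.A) (conv (gr f)))

theorem le_imageRel_iff {f : X ⟶ Y} {Z : D.C} {γ : D.fib Z} {b b' : Z ⟶ Y.A} :
    γ ≤ rel (imageRel f) b b' ↔ γ ≤ rel Y.ρ b b' ∧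
      γ ≤ pull D.P b (D.ext.ex prod.fst (isProj_fst Y.A X.A) (conv (gr f))) := by
  rw [imageRel, rel_inf, rel_pull, prod.lift_fst, le_inf_iff]

theorem image_congr {f : X ⟶ Y} {Z : D.C} {γ : D.fib Z} {b b' : Z ⟶ Y.A}
    (h : γ ≤ rel Y.ρ b b')
    (hb : γ ≤ pull D.P b (D.ext.ex prod.fst (isProj_fst Y.A X.A) (conv (gr f)))) :
    γ ≤ pull D.P b' (D.ext.ex prod.fst (isProj_fst Y.A X.A) (conv (gr f))) := by
  refine D.ext.exFst_elim hb fun s a γ' hγ ha => ?_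
  rw [rel_conv] at ha
  rw [pull_pull]
  exact ex_conv_intro (congr_right (rel_restrict hγ h) ha)

/-- The image of an arrow of the exact completion. -/
abbrev image (f : X ⟶ Y) : TP D :=
  ofStages Y.A (imageRel f)
    (fun h => by
      rw [le_imageRel_iff] at h ⊢
      exact ⟨eq_symm h.1, image_congr h.1 h.2⟩)
    (fun h h' => by
      rw [le_imageRel_iff] at h h' ⊢
      exact ⟨eq_trans h.1 h'.1, h.2⟩)

theorem tracks_image (f : X ⟶ Y) : Tracks (image f) Y (𝟙 Y.A) := fun Z γ a a' h => by
  simpa only [Category.comp_id] using (le_imageRel_iff.1 h).1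

/-- The inclusion of the image. -/
def imageι (f : X ⟶ Y) : image f ⟶ Y := track _ (tracks_image f)

theorem le_imageι_iff {f : X ⟶ Y} {Z : D.C} {γ : D.fib Z} {b b' : Z ⟶ Y.A} :
    γ ≤ rel (gr (imageι f)) b b' ↔ γ ≤ rel (image f).ρ b b' := by
  refine le_track_iff.trans ?_
  change γ ≤ rel (imageRel f) b b ∧ _ ↔ γ ≤ rel (imageRel f) b b'
  rw [Category.comp_id, le_imageRel_iff, le_imageRel_iff]
  exact ⟨fun h => ⟨h.2, h.1.2⟩, fun h => ⟨⟨eq_left h.1, h.2⟩, h.1⟩⟩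

theorem inj_imageι (f : X ⟶ Y) : Inj (imageι f) := fun Z γ a a' b h h' =>
  eq_trans (le_imageι_iff.1 h) (eq_symm (le_imageι_iff.1 h'))

/-- The corestriction of an arrow to its image. -/
def toImage (f : X ⟶ Y) : X ⟶ image f :=
  homMk (gr f : D.fib (X.A ⨯ Y.A)) dom (fun h => le_imageRel_iff.2 ⟨cod h, ex_conv_intro h⟩)
    (fun h h' => congr_left (eq_symm h) h')
    (fun h h' => congr_right (le_imageRel_iff.1 h').1 h)
    (fun h h' => le_imageRel_iff.2 ⟨single h h', ex_conv_intro h⟩)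
    (fun h => total_elim f h fun s b γ' hγ hb => by
      rw [pull_pull]
      exact D.ext.exFst_intro hb)

theorem surj_toImage (f : X ⟶ Y) : Surj (toImage f) := fun Z γ b h => (le_imageRel_iff.1 h).2

theorem toImage_imageι (f : X ⟶ Y) : toImage f ≫ imageι f = f :=
  hom_ext_of_le fun γ a b h => comp_elim h fun s c γ' hγ h₁ h₂ => by
    rw [pull_rel]
    exact congr_right (le_imageRel_iff.1 (le_imageι_iff.1 h₂)).1 h₁

/-- A regular epimorphism is strong, so the inclusion of its image splits. -/
theorem surj_of_isRegularEpi (f : X ⟶ Y) [IsRegularEpi f] : Surj f := by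
  have := mono_of_inj (inj_imageι f)
  have sq : CommSq (toImage f) f (imageι f) (𝟙 Y) := ⟨by simp [toImage_imageι]⟩
  intro Z γ b h
  have h₁ : γ ≤ rel (gr (𝟙 Y)) b b := h
  rw [← sq.fac_right] at h₁
  refine comp_elim h₁ fun s c γ' hγ h₂ h₃ => ?_
  rw [pull_pull]
  exact (le_imageRel_iff.1 (eq_right (le_imageι_iff.1 h₃))).2

/-- A surjection is the coequalizer of its kernel pair. -/
def Surj.isColimitCofork {f : X ⟶ Y} (hf : Surj f) {p q : W ⟶ X} (H : InternalPullback p q f f) :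
    IsColimit (Cofork.ofπ f H.w) := by
  have key (s : Cofork p q) : ∃ d : Y ⟶ s.pt, f ≫ d = s.π := by
    refine hf.exists_desc _ fun h₁ h₂ h₃ h₄ => ?_
    refine span_elim (H.surj h₁ h₂) fun t w γ' hγ h₅ h₆ => ?_
    have h₇ := comp_intro h₅ (rel_restrict hγ h₃)
    have h₈ := comp_intro h₆ (rel_restrict hγ h₄)
    rw [s.condition] at h₇
    rw [pull_rel]
    exact single h₇ h₈
  have := hf.epi
  exact Cofork.IsColimit.mk _ (fun s => (key s).choose) (fun s => (key s).choose_spec)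
    (fun s m hm => (cancel_epi f).1 (hm.trans (key s).choose_spec.symm))

theorem Surj.isRegularEpi {f : X ⟶ Y} (hf : Surj f) : IsRegularEpi f :=
  ⟨⟨Cofork.IsColimit.regularEpi (hf.isColimitCofork (pb_internalPullback f f))⟩⟩

theorem InternalPullback.surj_fst {p : W ⟶ X} {q : W ⟶ Y} {f : X ⟶ V} {g : Y ⟶ V}
    (H : InternalPullback p q f g) (hg : Surj g) : Surj p := by
  intro Z γ a ha
  refine total_elim f ha fun s c γ' hγ hc => ?_
  refine hg.elim (cod hc) fun t b γ₁ hγ₁ hb => ?_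
  refine span_elim (H.surj (rel_restrict hγ₁ hc) hb) fun r w γ₂ hγ₂ h₁ h₂ => ?_
  simp only [pull_pull]
  have := ex_conv_intro h₁
  simpa only [Category.assoc] using this

/-- Regular epimorphisms are the internal surjections, and these are stable under pullback; the
coequalizer of a kernel pair of `f` is the corestriction of `f` to its image. -/
instance : Regular (TP D) where
  hasCoequalizer_of_isKernelPair {X Y Z f g₁ g₂} h := by
    have H := InternalPullback.of_isPullback h
    have hι := mono_of_inj (inj_imageι f)
    have w : g₁ ≫ toImage f = g₂ ≫ toImage f := by
      rw [← cancel_mono (imageι f), Category.assoc, Category.assoc, toImage_imageι, h.w]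
    have H' : InternalPullback g₁ g₂ (toImage f) (toImage f) :=
      ⟨w, H.inj, fun h₁ h₂ => H.surj (f := f) (g := f) h₁ h₂⟩
    exact ⟨⟨_, (surj_toImage f).isColimitCofork H'⟩⟩
  regularEpiIsStableUnderBaseChange :=
    ⟨fun {X Y Y' S f g f' g'} sq hg => by
      have : IsRegularEpi g := hg
      exact ((InternalPullback.of_isPullback sq.flip).surj_fst
        (surj_of_isRegularEpi g)).isRegularEpi⟩

/-- The quotient of an object by a relation that is symmetric and transitive. -/
abbrev quotient (X : TP D) (σ : D.fib (X.A ⨯ X.A))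
    (symm : ∀ {Z : D.C} {γ : D.fib Z} {a b : Z ⟶ X.A}, γ ≤ rel σ a b → γ ≤ rel σ b a)
    (trans : ∀ {Z : D.C} {γ : D.fib Z} {a b c : Z ⟶ X.A}, γ ≤ rel σ a b → γ ≤ rel σ b c →
      γ ≤ rel σ a c) : TP D :=
  ofStages X.A σ symm trans

section Equivalence

variable {R : TP D} {p₁ p₂ : R ⟶ X}

theorem le_spanRel_symm (E : SymmetricRelation p₁ p₂) {Z : D.C} {γ : D.fib Z} {a b : Z ⟶ X.A}
    (h : γ ≤ rel (spanRel p₁ p₂) a b) : γ ≤ rel (spanRel p₁ p₂) b a := by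
  refine span_elim h fun s w γ' hγ h₁ h₂ => ?_
  refine total_elim E.s (dom h₁) fun t w' γ'' hγ' h₃ => ?_
  rw [← E.symmetry₂] at h₁
  rw [← E.symmetry₁] at h₂
  simp only [pull_rel]
  exact span_intro (of_comp h₃ (rel_restrict hγ' h₂)) (of_comp h₃ (rel_restrict hγ' h₁))

theorem le_spanRel_refl (E : ReflexiveRelation p₁ p₂) {Z : D.C} {γ : D.fib Z} {a : Z ⟶ X.A}
    (h : γ ≤ rel X.ρ a a) : γ ≤ rel (spanRel p₁ p₂) a a := by
  refine total_elim E.r h fun s w γ' hγ h₁ => ?_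
  have h₂ : γ' ≤ rel (gr (𝟙 X)) (s ≫ a) (s ≫ a) := rel_restrict hγ h
  have h₃ := h₂
  rw [← E.reflexivity₁] at h₂
  rw [← E.reflexivity₂] at h₃
  rw [pull_rel]
  exact span_intro (of_comp h₁ h₂) (of_comp h₁ h₃)

theorem le_spanRel_trans (E : TransitiveRelation p₁ p₂) {Z : D.C} {γ : D.fib Z}
    {a b c : Z ⟶ X.A} (h : γ ≤ rel (spanRel p₁ p₂) a b) (h' : γ ≤ rel (spanRel p₁ p₂) b c) :
    γ ≤ rel (spanRel p₁ p₂) a c := by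
  have K := InternalPullback.of_isPullback (IsPullback.of_isLimit E.isLimit)
  refine span_elim h fun s w γ₁ hγ₁ h₁ h₂ => ?_
  refine span_elim (rel_restrict hγ₁ h') fun t w' γ₂ hγ₂ h₃ h₄ => ?_
  refine span_elim (K.surj (rel_restrict hγ₂ h₂) h₃) fun r z γ₃ hγ₃ h₅ h₆ => ?_
  refine total_elim E.t (dom h₅) fun q y γ₄ hγ₄ h₇ => ?_
  have h₈ := comp_intro h₅ (rel_restrict hγ₃ (rel_restrict hγ₂ h₁))
  have h₉ := comp_intro h₆ (rel_restrict hγ₃ h₄)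
  rw [← E.transitivity₁] at h₈
  rw [← E.transitivity₂] at h₉
  simp only [pull_rel]
  exact span_intro (of_comp h₇ (rel_restrict hγ₄ h₈)) (of_comp h₇ (rel_restrict hγ₄ h₉))

end Equivalence

/-- The quotient of `(A, ρ)` by an internal equivalence relation `p₁, p₂ : R ⟶ (A, ρ)` is `(A, σ)`,
where `σ` is the relation on `A` that `p₁` and `p₂` span. -/
instance : ExactCategory (TP D) where
  effective {R X} p₁ p₂ hR := by
    obtain ⟨E⟩ := hR.nonempty_equivalenceRelation
    let Q := quotient X (spanRel p₁ p₂) (le_spanRel_symm E.toSymmetricRelation)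
      (le_spanRel_trans E.toTransitiveRelation)
    have hπ : Tracks X Q (𝟙 X.A) := fun Z γ a b h => by
      rw [Category.comp_id, Category.comp_id]
      refine span_elim (le_spanRel_refl E.toReflexiveRelation (eq_left h))
        fun s w γ' hγ h₁ h₂ => ?_
      rw [pull_rel]
      exact span_intro h₁ (congr_right (rel_restrict hγ h) h₂)
    let π : X ⟶ Q := track (𝟙 X.A) hπ
    have hπ' {Z : D.C} {γ : D.fib Z} {a b : Z ⟶ X.A} :
        γ ≤ rel (gr π) a b ↔ γ ≤ rel (spanRel p₁ p₂) a b := by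
      refine le_track_iff.trans ?_
      rw [Category.comp_id]
      refine ⟨And.right, fun h => ⟨?_, h⟩⟩
      refine span_elim h fun s w γ' hγ h₁ h₂ => ?_
      rw [pull_rel]
      exact cod h₁
    have hs : Surj π := fun Z γ b h => by
      exact ex_conv_intro (hπ'.2 h)
    have H : InternalPullback p₁ p₂ π π := by
      refine ⟨hom_ext_of_le fun γ w c h => ?_,
        jointInj_of_jointMono fun U m n h h' => E.right_cancellation m n h h',
        fun {Z γ a b c} h h' => ?_⟩
      · refine comp_elim h fun s a γ' hγ h₁ h₂ => ?_
        refine total_elim p₂ (dom h₁) fun t b γ'' hγ' h₃ => ?_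
        simp only [pull_rel]
        refine comp_intro h₃ (hπ'.2 ?_)
        exact eq_trans (X := Q) (eq_symm (X := Q) (span_intro (rel_restrict hγ' h₁) h₃))
          (hπ'.1 (rel_restrict hγ' h₂))
      · exact eq_trans (X := Q) (hπ'.1 h) (eq_symm (X := Q) (hπ'.1 h'))
    refine ⟨⟨{ toEquivalenceRelation := E, B := Q, π := π, isKernelPair := H.isPullback,
               isPushout := ⟨⟨H.w⟩, ⟨?_⟩⟩ }⟩⟩
    have hc := hs.isColimitCofork H
    -- By reflexivity a cocone under the span `p₁, p₂` is the same as a cofork.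
    have key (s : PushoutCocone p₁ p₂) : s.inl = s.inr := by
      have := congrArg (E.r ≫ ·) s.condition
      simpa only [← Category.assoc, E.reflexivity₁, E.reflexivity₂, Category.id_comp] using this
    exact PushoutCocone.IsColimit.mk _
      (fun s => hc.desc (Cofork.ofπ s.inl (s.condition.trans (by rw [key s]))))
      (fun s => hc.fac _ WalkingParallelPair.one)
      (fun s => (hc.fac _ WalkingParallelPair.one).trans (key s))
      (fun s m h₁ h₂ => Cofork.IsColimit.hom_ext hc
        (h₁.trans (hc.fac (Cofork.ofπ s.inl (s.condition.trans (by rw [key s])))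
          WalkingParallelPair.one).symm))

end TP

/-! ### Equality predicates -/

section Equality

variable {C : Type u} [Category.{v} C] [HasFiniteProducts C] {P : Cᵒᵖ ⥤ SemilatInfCat.{w}}

namespace Elementary

variable (E : Elementary P) {A B X Z : C} {γ : P.obj (op Z)}

/-- Equality is reflexive, in every context. -/
theorem le_refl {a : Z ⟶ A} : γ ≤ rel (E.δ A) a a := by
  have h := (E.adj_diag A).le_u_l ⊤
  have h' := pull_mono P a (h.trans (pull_mono P _ inf_le_right))
  rw [pull_top, pull_pull, prod.comp_lift, Category.comp_id] at h'
  exact le_top.trans h'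

variable {E}

/-- Substitution of equals, with a parameter. -/
theorem le_subst_rel {α : P.obj (op (X ⨯ A))} {x : Z ⟶ X} {a b : Z ⟶ A}
    (h : γ ≤ rel (E.δ A) a b) (h' : γ ≤ rel α x a) : γ ≤ rel α x b := by
  have h₁ := ((E.adj_param X A) α (pull P (p13 X A A) α)).2 (by
    rw [pull_pull, prod.comp_lift, prod.lift_fst_assoc, Category.id_comp, prod.lift_snd,
      prod.lift_fst_snd, pull_id])
  have h₂ := pull_mono P (prod.lift (prod.lift x a) b) h₁
  rw [pull_inf, pull_p12_rel, pull_p23_rel, pull_p13_rel] at h₂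
  exact (le_inf h' h).trans h₂

/-- Substitution of equals. -/
theorem le_subst {α : P.obj (op A)} {a b : Z ⟶ A} (h : γ ≤ rel (E.δ A) a b)
    (h' : γ ≤ pull P a α) : γ ≤ pull P b α := by
  have := le_subst_rel (α := pull P prod.snd α) (x := a) h (by rwa [rel_pull, prod.lift_snd])
  rwa [rel_pull, prod.lift_snd] at this

theorem le_symm {a b : Z ⟶ A} (h : γ ≤ rel (E.δ A) a b) : γ ≤ rel (E.δ A) b a := by
  have := le_subst_rel (α := conv (E.δ A)) (x := a) h (by rw [rel_conv]; exact E.le_refl)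
  rwa [rel_conv] at this

theorem le_trans {a b c : Z ⟶ A} (h : γ ≤ rel (E.δ A) a b) (h' : γ ≤ rel (E.δ A) b c) :
    γ ≤ rel (E.δ A) a c :=
  le_subst_rel h' h

theorem le_congr (f : A ⟶ B) {a b : Z ⟶ A} (h : γ ≤ rel (E.δ A) a b) :
    γ ≤ rel (E.δ B) (a ≫ f) (b ≫ f) := by
  have := le_subst_rel (α := rel (E.δ B) (prod.fst ≫ f) (prod.snd ≫ f)) (x := a) h (by
    rw [rel_rel, prod.lift_fst_assoc, prod.lift_snd_assoc]
    exact E.le_refl)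
  rwa [rel_rel, prod.lift_fst_assoc, prod.lift_snd_assoc] at this

/-- Pairs are equal when their components are. -/
theorem le_prod {a b : Z ⟶ A ⨯ B} (h₁ : γ ≤ rel (E.δ A) (a ≫ prod.fst) (b ≫ prod.fst))
    (h₂ : γ ≤ rel (E.δ B) (a ≫ prod.snd) (b ≫ prod.snd)) : γ ≤ rel (E.δ (A ⨯ B)) a b := by
  have h₃ : γ ≤ rel (E.δ (A ⨯ B)) a (prod.lift (b ≫ prod.fst) (a ≫ prod.snd)) := by
    have := le_subst_rel (α := rel (E.δ (A ⨯ B)) prod.fst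
      (prod.lift prod.snd (prod.fst ≫ prod.snd))) (x := a) h₁ (by
        rw [rel_rel, prod.comp_lift, prod.lift_fst, prod.lift_snd, prod.lift_fst_assoc,
          ← prod.comp_lift, prod.lift_fst_snd, Category.comp_id]
        exact E.le_refl)
    rwa [rel_rel, prod.comp_lift, prod.lift_fst, prod.lift_snd, prod.lift_fst_assoc] at this
  have := le_subst_rel (α := rel (E.δ (A ⨯ B)) (prod.fst ≫ prod.fst)
    (prod.lift (prod.fst ≫ prod.snd) prod.snd)) (x := prod.lift a (b ≫ prod.fst)) h₂ (by
      simpa only [rel_rel, prod.comp_lift, prod.lift_fst_assoc, prod.lift_fst, prod.lift_snd])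
  simp only [rel_rel, prod.comp_lift, prod.lift_fst_assoc, prod.lift_fst, prod.lift_snd] at this
  rwa [← prod.comp_lift, prod.lift_fst_snd, Category.comp_id] at this

end Elementary

end Equality

namespace TP

variable {D : EED.{u}}

/-! ### The unit -/

/-- The object of the exact completion given by an object of the base, with its equality. -/
abbrev disc (A : D.C) : TP D :=
  ofStages A (D.el.δ A) Elementary.le_symm Elementary.le_trans

theorem tracks_disc {A B : D.C} (f : A ⟶ B) : Tracks (disc A) (disc B) f :=
  fun _ _ _ _ h => Elementary.le_congr f h

variable (D) in
/-- The functor from the base category to the exact completion. -/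
abbrev discFunctor : D.C ⥤ TP D where
  obj A := disc A
  map f := track f (tracks_disc f)
  map_id A := track_id (X := disc A) (h := tracks_disc (𝟙 A))
  map_comp {A B E} f g := (track_comp_track (X := disc A) (Y := disc B) (V := disc E)
    (hm := tracks_disc f) (hn := tracks_disc g)).symm

theorem le_disc_map_iff {A B : D.C} {f : A ⟶ B} {Z : D.C} {γ : D.fib Z} {a : Z ⟶ A}
    {b : Z ⟶ B} :
    γ ≤ rel (gr ((discFunctor D).map f)) a b ↔ γ ≤ rel (D.el.δ B) (a ≫ f) b :=
  (le_track_iff (X := disc A) (Y := disc B) (hm := tracks_disc f)).trans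
    ⟨And.right, fun h => ⟨D.el.le_refl, h⟩⟩

/-- The product of two discrete objects is their pullback over the terminal object, and equality of
pairs is componentwise equality. -/
instance : PreservesFiniteProducts (discFunctor D) := by
  have : PreservesLimitsOfShape (Discrete PEmpty.{1}) (discFunctor D) := by
    have h : IsTerminal ((discFunctor D).obj (⊤_ D.C)) := by
      refine isTerminal (T := disc (⊤_ D.C)) terminalIsTerminal ?_
      have h : ⊤ ≤ rel (D.el.δ (⊤_ D.C)) prod.fst prod.snd := by
        rw [Subsingleton.elim (prod.snd : (⊤_ D.C) ⨯ (⊤_ D.C) ⟶ _) prod.fst]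
        exact D.el.le_refl
      rw [rel_fst_snd] at h
      exact top_le_iff.1 h
    have := preservesTerminal_of_iso (discFunctor D) (h.uniqueUpToIso terminalIsTerminal)
    exact preservesLimitsOfShape_pempty_of_preservesTerminal _
  have : PreservesLimitsOfShape (Discrete WalkingPair) (discFunctor D) := by
    refine ⟨fun {K} => ?_⟩
    have h (A B : D.C) : PreservesLimit (pair A B) (discFunctor D) := by
      refine preservesLimit_of_preserves_limit_cone (prodIsProd A B)
        ((isLimitMapConeBinaryFanEquiv _ _ _).symm ?_)
      let T := isTerminalTerminalObj D
      have H : InternalPullback ((discFunctor D).map (prod.fst : A ⨯ B ⟶ A))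
          ((discFunctor D).map prod.snd) (T.from _) (T.from _) := by
        refine ⟨T.hom_ext _ _, fun Z γ w w' a b h₁ h₂ h₃ h₄ => ?_, fun {Z γ a b c} h h' => ?_⟩
        · rw [le_disc_map_iff] at h₁ h₂ h₃ h₄
          exact Elementary.le_prod (Elementary.le_trans h₁ (Elementary.le_symm h₃))
            (Elementary.le_trans h₂ (Elementary.le_symm h₄))
        · refine span_intro (w := prod.lift a b) (le_disc_map_iff.2 ?_) (le_disc_map_iff.2 ?_)
          · rw [prod.lift_fst]
            exact D.el.le_refl
          · rw [prod.lift_snd]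
            exact D.el.le_refl
      exact isProductOfIsTerminalIsPullback _ _ _ _ T H.isPullback.isLimit
    exact preservesLimit_of_iso_diagram _ (diagramIsoPair K).symm
  exact PreservesFiniteProducts.of_preserves_binary_and_terminal _

/-- The subobject `{a | α(a)}` of an object of the base, in the exact completion. -/
abbrev compr {A : D.C} (α : D.fib A) : TP D :=
  ofStages A (D.el.δ A ⊓ pull D.P prod.fst α)
    (fun h => by
      rw [rel_inf, rel_pull, prod.lift_fst, le_inf_iff] at h ⊢
      exact ⟨Elementary.le_symm h.1, Elementary.le_subst h.1 h.2⟩)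
    (fun h h' => by
      rw [rel_inf, rel_pull, prod.lift_fst, le_inf_iff] at h h' ⊢
      exact ⟨Elementary.le_trans h.1 h'.1, h.2⟩)

section Compr

variable {A B : D.C} {α : D.fib A} {β : D.fib B} {Z : D.C} {γ : D.fib Z}

theorem le_compr_iff {a a' : Z ⟶ A} :
    γ ≤ rel (compr α).ρ a a' ↔ γ ≤ rel (D.el.δ A) a a' ∧ γ ≤ pull D.P a α := by
  change γ ≤ rel (D.el.δ A ⊓ pull D.P prod.fst α) a a' ↔ _
  rw [rel_inf, rel_pull, prod.lift_fst, le_inf_iff]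

theorem tracks_compr {f : A ⟶ B} (h : α ≤ pull D.P f β) : Tracks (compr α) (compr β) f :=
  fun Z γ a a' h' => by
    rw [le_compr_iff] at h' ⊢
    exact ⟨Elementary.le_congr f h'.1, (pull_pull D.P a f β) ▸ h'.2.trans (pull_mono D.P a h)⟩

/-- The arrow between comprehensions given by an arrow of the base that maps `α` into `β`. -/
def comprMap (f : A ⟶ B) (h : α ≤ pull D.P f β) : compr α ⟶ compr β :=
  track f (tracks_compr h)

theorem le_comprMap_iff {f : A ⟶ B} {h : α ≤ pull D.P f β} {a : Z ⟶ A} {b : Z ⟶ B} :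
    γ ≤ rel (gr (comprMap f h)) a b ↔ γ ≤ rel (D.el.δ B) (a ≫ f) b ∧ γ ≤ pull D.P a α := by
  refine (le_track_iff (X := compr α) (Y := compr β) (hm := tracks_compr h)).trans ?_
  rw [le_compr_iff, le_compr_iff]
  exact ⟨fun h => ⟨h.2.1, h.1.2⟩, fun h' => ⟨⟨D.el.le_refl, h'.2⟩, h'.1,
    (pull_pull D.P a f β) ▸ h'.2.trans (pull_mono D.P a h)⟩⟩

theorem tracks_comprι (α : D.fib A) : Tracks (compr α) (disc A) (𝟙 A) := fun Z γ a a' h => by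
  rw [Category.comp_id, Category.comp_id]
  exact (le_compr_iff.1 h).1

/-- The inclusion of a comprehension. -/
def comprι (α : D.fib A) : compr α ⟶ disc A := track _ (tracks_comprι α)

theorem le_comprι_iff {a b : Z ⟶ A} :
    γ ≤ rel (gr (comprι α)) a b ↔ γ ≤ rel (D.el.δ A) a b ∧ γ ≤ pull D.P a α := by
  refine (le_track_iff (X := compr α) (Y := disc A) (hm := tracks_comprι α)).trans ?_
  rw [le_compr_iff, Category.comp_id]
  exact ⟨fun h => ⟨h.2, h.1.2⟩, fun h => ⟨⟨D.el.le_refl, h.2⟩, h.1⟩⟩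

instance (α : D.fib A) : Mono (comprι α) := by
  refine mono_of_inj fun Z γ a a' b h h' => ?_
  rw [le_comprι_iff] at h h'
  exact le_compr_iff.2 ⟨Elementary.le_trans h.1 (Elementary.le_symm h'.1), h.2⟩

theorem comprMap_comprι {f : A ⟶ B} (h : α ≤ pull D.P f β) :
    comprMap f h ≫ comprι β = comprι α ≫ (discFunctor D).map f := by
  refine hom_ext_of_le fun γ a c hc => comp_elim hc fun s b γ' hγ h₁ h₂ => ?_
  rw [le_comprMap_iff] at h₁
  rw [le_comprι_iff] at h₂
  rw [pull_rel]
  exact comp_intro (X := compr α) (Y := disc A) (b := s ≫ a) (le_comprι_iff.2 ⟨D.el.le_refl, h₁.2⟩)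
    (le_disc_map_iff.2 (Elementary.le_trans h₁.1 h₂.1))

/-- An arrow factors through a comprehension when its values satisfy the predicate. -/
theorem comprι_factors_iff {X : TP D} (f : X ⟶ disc A) :
    (Subobject.mk (comprι α)).Factors f ↔
      ∀ {Z : D.C} {γ : D.fib Z} {x : Z ⟶ X.A} {a : Z ⟶ A}, γ ≤ rel (gr f) x a →
        γ ≤ pull D.P a α := by
  rw [mk_factors]
  constructor
  · rintro ⟨h, rfl⟩ Z γ x a hx
    refine comp_elim hx fun s b γ' hγ h₁ h₂ => ?_
    rw [le_comprι_iff] at h₂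
    rw [pull_pull]
    exact Elementary.le_subst h₂.1 h₂.2
  · intro hf
    refine ⟨homMk (Y := compr α) (gr f : D.fib (X.A ⨯ A)) dom
      (fun h => le_compr_iff.2 ⟨D.el.le_refl, hf h⟩) (fun h h' => congr_left (eq_symm h) h')
      (fun h h' => congr_right (le_compr_iff.1 h').1 h)
      (fun h h' => le_compr_iff.2 ⟨single h h', hf h⟩)
      (fun h => total_elim f h fun s b γ' hγ hb => by
        rw [pull_pull]
        exact D.ext.exFst_intro hb), ?_⟩
    refine hom_ext_of_le fun γ x a hx => comp_elim hx fun s b γ' hγ h₁ h₂ => ?_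
    rw [pull_rel]
    exact congr_right (le_comprι_iff.1 h₂).1 h₁

/-- The arrow from `{x | α(x)}` to `{a | ∃x. f(x) = a ∧ α(x)}` is a surjection. -/
theorem surj_comprMap {f : A ⟶ B} (hf : IsProj f) (α : D.fib A) :
    Surj (comprMap f ((D.ext.adj f hf).le_u_l α)) := by
  intro Z γ b hb
  refine D.ext.ex_elim (le_compr_iff.1 hb).2 fun s x γ' hx hγ h => ?_
  rw [pull_pull]
  refine ex_conv_intro (a := x) (le_comprMap_iff.2 ⟨?_, h⟩)
  rw [hx]
  exact D.el.le_refl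

end Compr

theorem _root_.ExactCompletion.sub_ext {C : Type u} [Category.{v} C] {A : C} {S T : Subobject A}
    (h : ∀ ⦃Z : C⦄ (g : Z ⟶ A), S.Factors g ↔ T.Factors g) : S = T :=
  le_antisymm ((sub_le_iff S T).2 fun Z g => (h g).1) ((sub_le_iff T S).2 fun Z g => (h g).2)

/-- The exact completion as an object of the 2-category of exact categories. -/
abbrev completion (D : EED.{u}) : Xct.{u} := { C := TP D }

/-- Comprehension is natural: it takes substitution to pullback of subobjects. -/
theorem mk_comprι_pull {A B : D.C} (f : A ⟶ B) (β : D.fib B) :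
    Subobject.mk (comprι (pull D.P f β)) =
      (Subobject.pullback ((discFunctor D).map f)).obj (Subobject.mk (comprι β)) := by
  refine sub_ext fun X h => ?_
  rw [pullback_factors, comprι_factors_iff, comprι_factors_iff]
  constructor
  · intro H Z γ x b hx
    refine comp_elim hx fun s a γ' hγ h₁ h₂ => ?_
    rw [le_disc_map_iff] at h₂
    rw [pull_pull]
    refine Elementary.le_subst h₂ ?_
    rw [← pull_pull]
    exact H h₁
  · intro H Z γ x a hx
    rw [pull_pull]
    exact H (comp_intro hx (le_disc_map_iff.2 D.el.le_refl))

theorem factors_diag_iff {C : Type u} [Category.{v} C] [HasFiniteLimits C] {A Z : C}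
    (f : Z ⟶ A ⨯ A) :
    (Subobject.mk (prod.lift (𝟙 A) (𝟙 A))).Factors f ↔ f ≫ prod.fst = f ≫ prod.snd := by
  rw [mk_factors]
  constructor
  · rintro ⟨h, rfl⟩
    simp [prod.lift_fst, prod.lift_snd]
  · intro h
    refine ⟨f ≫ prod.fst, ?_⟩
    apply prod.hom_ext
    · simp [prod.lift_fst]
    · simp [prod.lift_snd, h]

/-- The comprehension of the equality predicate is the diagonal. -/
theorem mk_comprι_δ (A : D.C) : Subobject.mk (comprι (D.el.δ A)) =
    (Subobject.pullback (prod.lift ((discFunctor D).map prod.fst)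
      ((discFunctor D).map prod.snd))).obj
        (Subobject.mk (prod.lift (𝟙 ((discFunctor D).obj A)) (𝟙 ((discFunctor D).obj A)))) := by
  refine sub_ext fun X f => ?_
  rw [pullback_factors, factors_diag_iff, comprι_factors_iff, Category.assoc, Category.assoc,
    prod.lift_fst, prod.lift_snd]
  constructor
  · intro h
    refine hom_ext_of_le fun γ x a hx => comp_elim hx fun s p γ' hγ h₁ h₂ => ?_
    rw [pull_rel]
    rw [le_disc_map_iff] at h₂
    refine comp_intro h₁ (le_disc_map_iff.2 ?_)
    have h₃ := h h₁
    rw [pull_eq_rel] at h₃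
    exact Elementary.le_trans (Elementary.le_symm h₃) h₂
  · intro h Z γ x p hx
    have h₁ : γ ≤ rel (gr (f ≫ (discFunctor D).map prod.fst)) x (p ≫ prod.fst) :=
      comp_intro hx (le_disc_map_iff.2 D.el.le_refl)
    rw [h] at h₁
    rw [pull_eq_rel]
    exact Elementary.le_symm (le_disc_map_iff.1 (of_comp hx h₁))

/-- The natural family of homomorphisms `α ↦ {a | α(a)}`. -/
def unitNatTrans (D : EED.{u}) :
    D.P ⟶ (discFunctor D).op ⋙ subFunctor (TP D) where
  app A := ConcreteCategory.ofHom (C := SemilatInfCat) (X := D.P.obj A)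
    (Y := SemilatInfCat.of (Subobject (disc A.unop)))
    { toFun := fun α => Subobject.mk (comprι (A := A.unop) α)
      map_inf' := fun α β => by
        refine sub_ext fun X f => ?_
        rw [Subobject.inf_factors, comprι_factors_iff, comprι_factors_iff, comprι_factors_iff]
        have key {Z : D.C} {γ : D.fib Z} {a : Z ⟶ A.unop} : γ ≤ pull D.P a (α ⊓ β) ↔
            γ ≤ pull D.P a α ∧ γ ≤ pull D.P a β := by
          rw [pull_inf, le_inf_iff]
        exact ⟨fun h => ⟨fun h' => (key.1 (h h')).1, fun h' => (key.1 (h h')).2⟩,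
          fun h _ _ _ _ h' => key.2 ⟨h.1 h', h.2 h'⟩⟩
      map_top' := by
        rw [← top_le_iff, sub_le_iff]
        intro X f _
        rw [comprι_factors_iff]
        intro Z γ x a h
        rw [pull_top]
        exact le_top }
  naturality A B f := by
    apply ConcreteCategory.hom_ext
    exact fun β => mk_comprι_pull f.unop β

/-- The unit: a 1-arrow from a doctrine to the doctrine of subobjects of its exact completion. -/
def unitHom (D : EED.{u}) : EED.Hom D (completion D).sub where
  F := discFunctor D
  pres := inferInstanceAs (PreservesFiniteProducts (discFunctor D))
  b := unitNatTrans D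
  map_δ A := by
    exact mk_comprι_δ A
  map_ex {X A} p hp α := by
    have : IsRegularEpi (comprMap p ((D.ext.adj p hp).le_u_l α)) :=
      (surj_comprMap hp α).isRegularEpi
    exact (exists_mk_eq_mk _ _ _ _ (comprMap_comprι _)).symm

end TP

/-! ### Transport along an arrow of doctrines -/

namespace EED.Hom

variable {D E : EED.{u}} (F : EED.Hom D E)

theorem app_inf {A : D.C} (α β : D.fib A) : F.app (α ⊓ β) = F.app α ⊓ F.app β :=
  map_inf (ConcreteCategory.hom (F.b.app (op A))) α β

theorem app_top {A : D.C} : F.app (⊤ : D.fib A) = ⊤ :=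
  map_top (ConcreteCategory.hom (F.b.app (op A)))

/-- The image of a relation from `A` to `B`, as a relation from `F A` to `F B`. -/
def tr {A B : D.C} (φ : D.fib (A ⨯ B)) : E.fib (F.F.obj A ⨯ F.F.obj B) :=
  pull E.P (inv (prodComparison F.F A B)) (F.app φ)

variable {F}

theorem pull_app_eq {A B : D.C} {Z : E.C} (z : Z ⟶ F.F.obj (A ⨯ B)) (φ : D.fib (A ⨯ B)) :
    pull E.P z (F.app φ) = rel (F.tr φ) (z ≫ F.F.map prod.fst) (z ≫ F.F.map prod.snd) := by
  rw [rel, tr, pull_pull]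
  congr 1
  rw [← cancel_mono (prodComparison F.F A B), Category.assoc, IsIso.inv_hom_id, Category.comp_id,
    prodComparison, prod.comp_lift]

theorem pull_app_rel {A B W : D.C} {Z : E.C} (z : Z ⟶ F.F.obj W) (φ : D.fib (A ⨯ B))
    (a : W ⟶ A) (b : W ⟶ B) : pull E.P z (F.app (rel φ a b)) =
      rel (F.tr φ) (z ≫ F.F.map a) (z ≫ F.F.map b) := by
  rw [rel, F.app_pull, pull_pull, pull_app_eq, Category.assoc, Category.assoc, ← F.F.map_comp,
    ← F.F.map_comp, prod.lift_fst, prod.lift_snd]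

/-- As `F` preserves products, the generalized elements of `F (A × B)` are pairs. -/
theorem exists_pair {A B : D.C} {Z : E.C} (a : Z ⟶ F.F.obj A) (b : Z ⟶ F.F.obj B) :
    ∃ z : Z ⟶ F.F.obj (A ⨯ B), z ≫ F.F.map prod.fst = a ∧ z ≫ F.F.map prod.snd = b := by
  refine ⟨prod.lift a b ≫ inv (prodComparison F.F A B), ?_, ?_⟩
  · rw [Category.assoc, inv_prodComparison_map_fst, prod.lift_fst]
  · rw [Category.assoc, inv_prodComparison_map_snd, prod.lift_snd]

theorem exists_triple {A B C : D.C} {Z : E.C} (a : Z ⟶ F.F.obj A) (b : Z ⟶ F.F.obj B)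
    (c : Z ⟶ F.F.obj C) : ∃ z : Z ⟶ F.F.obj ((A ⨯ B) ⨯ C),
      z ≫ F.F.map (prod.fst ≫ prod.fst) = a ∧ z ≫ F.F.map (prod.fst ≫ prod.snd) = b ∧
        z ≫ F.F.map prod.snd = c := by
  obtain ⟨z, h₁, h₂⟩ := exists_pair (F := F) a b
  obtain ⟨z', h₃, h₄⟩ := exists_pair (F := F) z c
  exact ⟨z', by rw [F.F.map_comp, reassoc_of% h₃, h₁], by rw [F.F.map_comp, reassoc_of% h₃, h₂],
    h₄⟩

/-- Transport of an entailment between relations. -/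
theorem tr_mono {A B : D.C} {φ ψ : D.fib (A ⨯ B)} (h : φ ≤ ψ) : F.tr φ ≤ F.tr ψ :=
  pull_mono E.P _ (F.app_mono h)

/-- Transport of an entailment between relations with three free variables. -/
theorem tr_triple {A B C : D.C} {φ : D.fib (A ⨯ B)} {ψ : D.fib (B ⨯ C)} {χ : D.fib (A ⨯ C)}
    (h : ∀ {Z : D.C} (γ : D.fib Z) (a : Z ⟶ A) (b : Z ⟶ B) (c : Z ⟶ C), γ ≤ rel φ a b →
      γ ≤ rel ψ b c → γ ≤ rel χ a c) {Z : E.C} {γ : E.fib Z} {a : Z ⟶ F.F.obj A}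
    {b : Z ⟶ F.F.obj B} {c : Z ⟶ F.F.obj C} (h₁ : γ ≤ rel (F.tr φ) a b)
    (h₂ : γ ≤ rel (F.tr ψ) b c) : γ ≤ rel (F.tr χ) a c := by
  obtain ⟨z, rfl, rfl, rfl⟩ := exists_triple a b c
  rw [← pull_app_rel] at h₁ h₂ ⊢
  have := F.app_mono (h _ _ _ _ (inf_le_left (a := rel φ (prod.fst ≫ prod.fst)
    (prod.fst ≫ prod.snd)) (b := rel ψ (prod.fst ≫ prod.snd) prod.snd)) inf_le_right)
  rw [F.app_inf] at this
  refine LE.le.trans ?_ (pull_mono E.P z this)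
  rw [pull_inf]
  exact le_inf h₁ h₂

theorem tr_conv {A B : D.C} (φ : D.fib (A ⨯ B)) : F.tr (conv φ) = conv (F.tr φ) := by
  rw [tr, conv, pull_app_rel, conv, inv_prodComparison_map_fst, inv_prodComparison_map_snd]

theorem tr_inf {A B : D.C} (φ ψ : D.fib (A ⨯ B)) : F.tr (φ ⊓ ψ) = F.tr φ ⊓ F.tr ψ := by
  rw [tr, F.app_inf, pull_inf]
  rfl

theorem tr_top {A B : D.C} : F.tr (⊤ : D.fib (A ⨯ B)) = ⊤ := by
  rw [tr, F.app_top, pull_top]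

theorem tr_pull_fst {A B : D.C} (α : D.fib A) :
    F.tr (pull D.P (prod.fst : A ⨯ B ⟶ A) α) = pull E.P prod.fst (F.app α) := by
  rw [tr, F.app_pull, pull_pull, inv_prodComparison_map_fst]

/-- `F` preserves `∃b. φ(a, b)`. -/
theorem app_exFst {A B : D.C} (φ : D.fib (A ⨯ B)) :
    F.app (D.ext.ex prod.fst (isProj_fst A B) φ) =
      E.ext.ex prod.fst (isProj_fst _ _) (F.tr φ) := by
  refine (F.map_ex _ _ _).trans (le_antisymm ?_ ?_)
  · refine (E.ext.adj _ _).l_le ?_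
    have h := pull_app_eq (F := F) (𝟙 _) φ
    rw [pull_id, Category.id_comp, Category.id_comp] at h
    exact E.ext.exFst_intro h.le
  · refine (E.ext.adj _ _).l_le ?_
    have h := pull_mono E.P (inv (prodComparison F.F A B))
      ((E.ext.adj _ ((isProj_fst A B).map F.F)).le_u_l (F.app φ))
    rw [pull_pull, inv_prodComparison_map_fst] at h
    exact h

theorem tr_compRel {A B C : D.C} (φ : D.fib (A ⨯ B)) (ψ : D.fib (B ⨯ C)) :
    F.tr (compRel D.ext φ ψ) = compRel E.ext (F.tr φ) (F.tr ψ) := by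
  refine le_antisymm (le_of_stages fun {Z} γ a c h => ?_) (compRel_le _ fun a b c => ?_)
  · obtain ⟨z, rfl, rfl⟩ := exists_pair a c
    rw [← pull_app_eq] at h
    have e : F.app (compRel D.ext φ ψ) = _ := F.map_ex (p13 A B C) (isProj_p13 A B C) _
    rw [e] at h
    refine E.ext.ex_elim h fun g x γ' hx hγ h' => ?_
    change γ' ≤ pull E.P x (F.app _) at h'
    rw [F.app_inf, F.app_pull, F.app_pull, pull_inf, pull_pull, pull_pull, pull_app_eq,
      pull_app_eq, le_inf_iff] at h'
    rw [pull_rel, ← reassoc_of% hx, ← reassoc_of% hx]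
    simp only [Category.assoc, ← F.F.map_comp, p13, p23, prod.lift_fst, prod.lift_snd] at h' ⊢
    exact E.ext.comp_intro h'.1 h'.2
  · exact tr_triple (fun γ a b c h h' => D.ext.comp_intro h h') inf_le_left inf_le_right

theorem tr_δ (A : D.C) : F.tr (D.el.δ A) = E.el.δ (F.F.obj A) := by
  have h : F.app (D.el.δ A) = _ := F.map_δ A
  rw [tr, h, pull_pull]
  change pull E.P (inv (prodComparison F.F A A) ≫ prodComparison F.F A A) _ = _
  rw [IsIso.inv_hom_id, pull_id]

end EED.Hom

namespace TP

variable {D E : EED.{u}} (F : EED.Hom D E)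

/-- Transport of an object of the exact completion. -/
abbrev mapObj (X : TP D) : TP E :=
  ofStages (F.F.obj X.A) (F.tr X.ρ)
    (fun h => by
      have := EED.Hom.tr_mono (F := F) (le_of_stages (φ := X.ρ) (ψ := conv X.ρ) fun γ a b h => by
        rw [rel_conv]
        exact eq_symm h)
      have := h.trans (pull_mono E.P _ this)
      rw [EED.Hom.tr_conv] at this
      exact this.trans (rel_conv _ _ _).le)
    (fun h h' => EED.Hom.tr_triple (fun γ a b c h h' => eq_trans h h') h h')

variable {F}

/-- Transport of totality. -/
theorem total_tr {X Y : TP D} {φ : D.fib (X.A ⨯ Y.A)}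
    (h : ∀ {Z : D.C} {γ : D.fib Z} {a : Z ⟶ X.A}, γ ≤ rel X.ρ a a →
      γ ≤ pull D.P a (D.ext.ex prod.fst (isProj_fst X.A Y.A) φ)) {Z : E.C} {γ : E.fib Z}
    {a : Z ⟶ F.F.obj X.A} (ha : γ ≤ rel (F.tr X.ρ) a a) :
    γ ≤ pull E.P a (E.ext.ex prod.fst (isProj_fst _ _) (F.tr φ)) := by
  have h₁ := pull_mono E.P a (F.app_mono (h (le_refl (rel X.ρ (𝟙 _) (𝟙 _)))))
  rw [EED.Hom.pull_app_rel, F.F.map_id, Category.comp_id, pull_id, EED.Hom.app_exFst] at h₁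
  exact ha.trans h₁

variable (F)

/-- Transport of an arrow of the exact completion. -/
def mapHom {X Y : TP D} (f : X ⟶ Y) : mapObj F X ⟶ mapObj F Y :=
  homMk (F.tr (gr f))
    (fun {Z γ a b} h => by
      obtain ⟨z, rfl, rfl⟩ := EED.Hom.exists_pair a b
      have h₁ := F.app_mono (dom (f := f) (le_refl (rel (gr f) prod.fst prod.snd)))
      have h₂ := pull_mono E.P z h₁
      rw [EED.Hom.pull_app_rel, EED.Hom.pull_app_rel] at h₂
      exact h.trans h₂)
    (fun {Z γ a b} h => by
      obtain ⟨z, rfl, rfl⟩ := EED.Hom.exists_pair a b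
      have h₁ := F.app_mono (cod (f := f) (le_refl (rel (gr f) prod.fst prod.snd)))
      have h₂ := pull_mono E.P z h₁
      rw [EED.Hom.pull_app_rel, EED.Hom.pull_app_rel] at h₂
      exact h.trans h₂)
    (fun h h' => EED.Hom.tr_triple (fun γ a b c h h' => congr_left (eq_symm h) h') h h')
    (fun h h' => EED.Hom.tr_triple (fun γ a b c h h' => congr_right h' h) h h')
    (fun h h' => EED.Hom.tr_triple (φ := conv (gr f)) (ψ := gr f)
      (fun γ a b c h h' => single (by rwa [rel_conv] at h) h')
      (by rwa [EED.Hom.tr_conv, rel_conv]) h')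
    (total_tr fun h => total_elim f h fun s b γ' hγ hb => by
      rw [pull_pull]
      exact D.ext.exFst_intro hb)

theorem gr_mapHom {X Y : TP D} (f : X ⟶ Y) : gr (mapHom F f) = F.tr (gr f) := rfl

/-- The functor between exact completions induced by an arrow of doctrines. -/
abbrev mapFunctor : TP D ⥤ TP E where
  obj := mapObj F
  map := mapHom F
  map_id X := hom_ext rfl
  map_comp f g := hom_ext (EED.Hom.tr_compRel _ _)

variable {F}

theorem Surj.map {X Y : TP D} {f : X ⟶ Y} (hf : Surj f) : Surj (mapHom F f) := by
  intro Z γ b hb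
  rw [gr_mapHom, ← EED.Hom.tr_conv]
  exact total_tr (fun h => hf h) hb

/-- Joint injectivity is an entailment between relations, so it can be transported. -/
theorem jointInj_iff {W X Y : TP D} {p : W ⟶ X} {q : W ⟶ Y} :
    JointInj p q ↔ cospanRel p p ⊓ cospanRel q q ≤ W.ρ := by
  constructor
  · refine fun h => le_of_stages fun γ w w' hw => ?_
    rw [rel_inf, le_inf_iff] at hw
    refine cospan_elim hw.1 fun s a γ' hγ h₁ h₂ => ?_
    refine cospan_elim (rel_restrict hγ hw.2) fun t b γ'' hγ' h₃ h₄ => ?_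
    rw [pull_rel, pull_rel]
    exact h (rel_restrict hγ' h₁) h₃ (rel_restrict hγ' h₂) h₄
  · intro h Z γ w w' a b h₁ h₂ h₃ h₄
    refine LE.le.trans ?_ (pull_mono D.P _ h)
    rw [pull_inf]
    exact le_inf (cospan_intro h₁ h₃) (cospan_intro h₂ h₄)

/-- The internal description of pullbacks involves only the regular logic that an arrow of doctrines
preserves. -/
theorem InternalPullback.map {W X Y V : TP D} {p : W ⟶ X} {q : W ⟶ Y} {f : X ⟶ V} {g : Y ⟶ V}
    (H : InternalPullback p q f g) :
    InternalPullback (mapHom F p) (mapHom F q) (mapHom F f) (mapHom F g) := by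
  refine ⟨?_, ?_, fun {Z γ a b c} h h' => ?_⟩
  · exact ((mapFunctor F).map_comp p f).symm.trans
      ((congrArg (mapFunctor F).map H.w).trans ((mapFunctor F).map_comp q g))
  · rw [jointInj_iff]
    have h := EED.Hom.tr_mono (F := F) (jointInj_iff.1 H.inj)
    simp only [cospanRel, EED.Hom.tr_inf, EED.Hom.tr_compRel, EED.Hom.tr_conv] at h
    exact h
  · have h₁ := EED.Hom.tr_triple (F := F) (φ := gr f) (ψ := conv (gr g)) (χ := spanRel p q)
      (fun γ a c b h h' => H.surj h (by rwa [rel_conv] at h')) h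
      (by rwa [EED.Hom.tr_conv, rel_conv])
    rwa [spanRel, EED.Hom.tr_compRel, EED.Hom.tr_conv] at h₁

instance : PreservesFiniteLimits (mapFunctor F) := by
  have : PreservesLimitsOfShape (Discrete PEmpty.{1}) (mapFunctor F) := by
    have h : IsTerminal (mapObj F (terminalObj D)) :=
      isTerminal (T := mapObj F (terminalObj D))
        (IsTerminal.isTerminalObj F.F _ terminalIsTerminal) EED.Hom.tr_top
    have := preservesTerminal_of_iso (mapFunctor F)
      ((mapFunctor F).mapIso (terminalIsTerminal.uniqueUpToIso (isTerminalTerminalObj D)) ≪≫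
        h.uniqueUpToIso terminalIsTerminal)
    exact preservesLimitsOfShape_pempty_of_preservesTerminal _
  have : PreservesLimitsOfShape WalkingCospan (mapFunctor F) := by
    refine preservesLimitsOfShape_walkingCospan_of_forall_isPullback fun X Y V f g _ => ?_
    have H := pb_internalPullback f g
    exact ⟨_, _, _, H.isPullback, (H.map (F := F)).isPullback⟩
  exact preservesFiniteLimits_of_preservesTerminal_and_pullbacks _

/-- The regular functor between exact completions induced by an arrow of doctrines. -/
def mapXct (F : EED.Hom D E) : Xct.Hom (completion D) (completion E) where
  F := mapFunctor F
  lex := inferInstanceAs (PreservesFiniteLimits (mapFunctor F))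
  map_regularEpi {A B} e _ := (surj_of_isRegularEpi (D := D) (X := A) (Y := B) e).map.isRegularEpi

section Iso

variable {X Y : TP D}

theorem tracks_inv {m : X.A ≅ Y.A} (h : ∀ ⦃Z : D.C⦄ ⦃γ : D.fib Z⦄ ⦃a b : Z ⟶ X.A⦄,
    γ ≤ rel X.ρ a b ↔ γ ≤ rel Y.ρ (a ≫ m.hom) (b ≫ m.hom)) : Tracks Y X m.inv :=
  fun Z γ a b hab => h.2 (by simpa using hab)

theorem tracks_hom {m : X.A ≅ Y.A} (h : ∀ ⦃Z : D.C⦄ ⦃γ : D.fib Z⦄ ⦃a b : Z ⟶ X.A⦄,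
    γ ≤ rel X.ρ a b ↔ γ ≤ rel Y.ρ (a ≫ m.hom) (b ≫ m.hom)) : Tracks X Y m.hom :=
  fun Z γ a b hab => h.1 hab

/-- An isomorphism in the base under which the relations correspond to each other. -/
def isoOfBase (m : X.A ≅ Y.A) (h : ∀ ⦃Z : D.C⦄ ⦃γ : D.fib Z⦄ ⦃a b : Z ⟶ X.A⦄,
    γ ≤ rel X.ρ a b ↔ γ ≤ rel Y.ρ (a ≫ m.hom) (b ≫ m.hom)) : X ≅ Y where
  hom := track m.hom (tracks_hom h)
  inv := track m.inv (tracks_inv h)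
  hom_inv_id := by
    rw [track_comp_track]
    exact (hom_eq_track fun h => by simpa [gr_id] using h).symm
  inv_hom_id := by
    rw [track_comp_track]
    exact (hom_eq_track fun h => by simpa [gr_id] using h).symm

end Iso

/-- Arrows of the completion inherit commutative squares from the base. -/
theorem track_comp_track_eq {X Y Y' V : TP D} {m : X.A ⟶ Y.A} {n : Y.A ⟶ V.A} {m' : X.A ⟶ Y'.A}
    {n' : Y'.A ⟶ V.A} (hm : Tracks X Y m) (hn : Tracks Y V n) (hm' : Tracks X Y' m')
    (hn' : Tracks Y' V n') (h : m ≫ n = m' ≫ n') :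
    track m hm ≫ track n hn = track m' hm' ≫ track n' hn' := by
  rw [track_comp_track, track_comp_track]
  congr 1

theorem map_track {X Y : TP D} {m : X.A ⟶ Y.A} {hm : Tracks X Y m}
    (hm' : Tracks (mapObj F X) (mapObj F Y) (F.F.map m)) :
    mapHom F (track m hm) = track (X := mapObj F X) (Y := mapObj F Y) (F.F.map m) hm' := by
  refine hom_eq_track (X := mapObj F X) (Y := mapObj F Y) fun {Z γ a b} h => ?_
  obtain ⟨z, rfl, rfl⟩ := EED.Hom.exists_pair a b
  have h₁ := F.app_mono (le_track_iff.1 (le_refl (rel (gr (track m hm)) prod.fst prod.snd))).2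
  have h₂ := pull_mono E.P z h₁
  rw [EED.Hom.pull_app_rel, EED.Hom.pull_app_rel, F.F.map_comp, ← Category.assoc] at h₂
  exact h.trans h₂

theorem tr_compr {A : D.C} (α : D.fib A) :
    F.tr (compr α).ρ = (compr (F.app α)).ρ := by
  rw [EED.Hom.tr_inf, EED.Hom.tr_δ, EED.Hom.tr_pull_fst]

variable (F)

theorem mapDisc_iff {A : D.C} ⦃Z : E.C⦄ ⦃γ : E.fib Z⦄ ⦃a b : Z ⟶ F.F.obj A⦄ :
    γ ≤ rel (disc (F.F.obj A)).ρ a b ↔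
      γ ≤ rel (mapObj F (disc A)).ρ (a ≫ (Iso.refl (F.F.obj A)).hom)
        (b ≫ (Iso.refl (F.F.obj A)).hom) := by
  change γ ≤ rel (E.el.δ _) a b ↔ γ ≤ rel (F.tr (D.el.δ A)) (a ≫ 𝟙 _) (b ≫ 𝟙 _)
  rw [EED.Hom.tr_δ, Category.comp_id, Category.comp_id]

theorem mapCompr_iff {A : D.C} (α : D.fib A) ⦃Z : E.C⦄ ⦃γ : E.fib Z⦄
    ⦃a b : Z ⟶ F.F.obj A⦄ : γ ≤ rel (compr (F.app α)).ρ a b ↔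
      γ ≤ rel (mapObj F (compr α)).ρ (a ≫ (Iso.refl (F.F.obj A)).hom)
        (b ≫ (Iso.refl (F.F.obj A)).hom) := by
  change γ ≤ rel (compr (F.app α)).ρ a b ↔ γ ≤ rel (F.tr (compr α).ρ) (a ≫ 𝟙 _) (b ≫ 𝟙 _)
  rw [tr_compr, Category.comp_id, Category.comp_id]

/-- Transport preserves discrete objects. -/
def mapDisc (A : D.C) : disc (F.F.obj A) ≅ mapObj F (disc A) :=
  isoOfBase (X := disc (F.F.obj A)) (Y := mapObj F (disc A)) (Iso.refl _) (mapDisc_iff F)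

/-- Transport preserves comprehensions. -/
def mapCompr {A : D.C} (α : D.fib A) : compr (F.app α) ≅ mapObj F (compr α) :=
  isoOfBase (X := compr (F.app α)) (Y := mapObj F (compr α)) (Iso.refl _) (mapCompr_iff F α)

theorem tracks_map {X Y : TP D} {m : X.A ⟶ Y.A} (hm : Tracks X Y m) :
    Tracks (mapObj F X) (mapObj F Y) (F.F.map m) := fun Z γ a b h => by
  obtain ⟨z, rfl, rfl⟩ := EED.Hom.exists_pair a b
  have h₁ := F.app_mono (hm (le_refl (rel X.ρ prod.fst prod.snd)))
  have h₂ := pull_mono E.P z h₁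
  rw [EED.Hom.pull_app_rel, EED.Hom.pull_app_rel, F.F.map_comp, F.F.map_comp, ← Category.assoc,
    ← Category.assoc] at h₂
  exact h.trans h₂

theorem mapCompr_comp {A : D.C} (α : D.fib A) :
    (mapCompr F α).hom ≫ mapHom F (comprι α) = comprι (F.app α) ≫ (mapDisc F A).hom := by
  rw [comprι, map_track (tracks_map F (tracks_comprι α))]
  exact track_comp_track_eq (X := compr (F.app α)) (Y := mapObj F (compr α))
    (Y' := disc (F.F.obj A)) (V := mapObj F (disc A)) (tracks_hom (mapCompr_iff F α)) _
    (tracks_comprι (F.app α)) (tracks_hom (mapDisc_iff F)) (by simp)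

instance {A : D.C} (α : D.fib A) : Mono (mapHom F (comprι α)) :=
  (mapFunctor F).map_mono (comprι α)

theorem mapDisc_naturality {A B : D.C} (f : A ⟶ B) :
    (discFunctor E).map (F.F.map f) ≫ (mapDisc F B).hom =
      (mapDisc F A).hom ≫ mapHom F ((discFunctor D).map f) := by
  rw [map_track (tracks_map F (tracks_disc f))]
  exact track_comp_track_eq (X := disc (F.F.obj A)) (Y := disc (F.F.obj B))
    (Y' := mapObj F (disc A)) (V := mapObj F (disc B)) (tracks_disc (F.F.map f))
    (tracks_hom (mapDisc_iff F)) (tracks_hom (mapDisc_iff F)) _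
    ((Category.comp_id _).trans (Category.id_comp _).symm)

/-- Pseudonaturality of the unit. -/
def unitNat : F.comp (unitHom E) ≅ (unitHom D).comp (mapXct F).sub :=
  EED.isoMk (F.comp (unitHom E)) ((unitHom D).comp (mapXct F).sub)
    (NatIso.ofComponents (fun A => mapDisc F A) (fun {A B} f => mapDisc_naturality F f))
    (fun A α => by
      change Subobject.mk (comprι (F.app α)) = (Subobject.pullback (mapDisc F A).hom).obj
        (mapSub (mapFunctor F) (Subobject.mk (comprι α)))
      rw [mapSub_mk]
      exact (Subobject.pullback_obj_mk
        (IsPullback.of_horiz_isIso ⟨mapCompr_comp F α⟩)).symm)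

end TP

/-! ### The exact completion of a doctrine of subobjects -/

theorem mk_factors_arrow {C : Type u} [Category.{v} C] {A Z : C} (S : Subobject A) (g : Z ⟶ A) :
    S.Factors g ↔ ∃ h, h ≫ S.arrow = g :=
  ⟨fun h => ⟨S.factorThru g h, S.factorThru_arrow g h⟩,
    fun ⟨h, e⟩ => e ▸ Subobject.factors_of_factors_right h S.factors_self⟩

namespace TP

section Mem

variable {D : EED.{u}} {A I : D.C} {α : D.fib A} {m : I ⟶ A}

theorem tracks_mem (h : ⊤ ≤ pull D.P m α) : Tracks (disc I) (compr α) m :=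
  fun Z γ a b hab => le_compr_iff.2 ⟨Elementary.le_congr _ hab, by
    refine (le_top.trans (pull_top D.P a).ge).trans ?_
    rw [← pull_pull]
    exact pull_mono D.P a h⟩

/-- An element of a predicate, as an arrow to its comprehension. -/
def memMap (m : I ⟶ A) (h : ⊤ ≤ pull D.P m α) : disc I ⟶ compr α := track m (tracks_mem h)

theorem le_memMap_iff {h : ⊤ ≤ pull D.P m α} {Z : D.C} {γ : D.fib Z} {a : Z ⟶ I} {b : Z ⟶ A} :
    γ ≤ rel (gr (memMap m h)) a b ↔ γ ≤ rel (D.el.δ A) (a ≫ m) b := by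
  refine (le_track_iff (X := disc I) (Y := compr α) (hm := tracks_mem h)).trans ?_
  rw [le_compr_iff]
  refine ⟨fun h => h.2.1, fun h' => ⟨D.el.le_refl, h', ?_⟩⟩
  rw [← pull_pull]
  exact (le_top.trans (pull_top D.P a).ge).trans (pull_mono D.P a h)

theorem memMap_comprι (h : ⊤ ≤ pull D.P m α) :
    memMap m h ≫ comprι α = (discFunctor D).map m :=
  (track_comp_track (X := disc I) (Y := compr α) (V := disc A)).trans
    (by congr 1; exact Category.comp_id m)

end Mem

end TP

namespace Xct

open TP

/-- The doctrine of subobjects `X.sub`, in reducible form, so that its fibres are visibly posets of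
subobjects. -/
abbrev subD (X : Xct.{u}) : EED.{u} where
  C := X.C
  P := subFunctor X.C
  el := subElementary X.C
  ext := subExistential X.C

variable {X : Xct.{u}}

section Stages

variable {A B Z : X.C} {γ : Subobject Z}

/-- A subobject is a context, and `α(a)` holds in the context `γ` when the restriction of `a` to the
object `γ` factors through `α`. -/
theorem le_pull_iff {a : Z ⟶ A} {α : Subobject A} :
    γ ≤ pull X.subD.P a α ↔ α.Factors (γ.arrow ≫ a) := by
  rw [← pullback_factors]
  exact ⟨fun h => Subobject.factors_of_le _ h γ.factors_self,
    fun h => (sub_le_iff _ _).2 fun W g hg => by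
      rw [← Subobject.factorThru_arrow γ g hg]
      exact Subobject.factors_of_factors_right _ h⟩

theorem le_rel_iff {a : Z ⟶ A} {b : Z ⟶ B} {φ : Subobject (A ⨯ B)} :
    γ ≤ rel (P := X.subD.P) φ a b ↔ φ.Factors (prod.lift (γ.arrow ≫ a) (γ.arrow ≫ b)) := by
  rw [← prod.comp_lift]
  exact le_pull_iff

theorem top_le_pull_iff {a : Z ⟶ A} {α : Subobject A} :
    (⊤ : Subobject Z) ≤ pull X.subD.P a α ↔ α.Factors a := by
  rw [le_pull_iff]
  refine ⟨fun h => ?_, Subobject.factors_of_factors_right _⟩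
  have := Subobject.factors_of_factors_right (inv (⊤ : Subobject Z).arrow) h
  rwa [IsIso.inv_hom_id_assoc] at this

theorem top_le_rel_iff {a : Z ⟶ A} {b : Z ⟶ B} {φ : Subobject (A ⨯ B)} :
    (⊤ : Subobject Z) ≤ rel (P := X.subD.P) φ a b ↔ φ.Factors (prod.lift a b) :=
  top_le_pull_iff

/-- A relation holds in the context `γ` when it holds, without context, over the object `γ`. -/
theorem le_rel_iff_top {a : Z ⟶ A} {b : Z ⟶ B} {φ : Subobject (A ⨯ B)} :
    γ ≤ rel (P := X.subD.P) φ a b ↔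
      (⊤ : Subobject (γ : X.C)) ≤ rel (P := X.subD.P) φ (γ.arrow ≫ a) (γ.arrow ≫ b) :=
  le_rel_iff.trans top_le_rel_iff.symm

/-- Two generalized elements are internally equal in the context `γ` when they agree on `γ`. -/
theorem le_δ_iff {a b : Z ⟶ A} :
    γ ≤ rel (P := X.subD.P) (X.subD.el.δ A) a b ↔ γ.arrow ≫ a = γ.arrow ≫ b := by
  refine le_rel_iff.trans ((factors_diag_iff _).trans ?_)
  rw [prod.lift_fst, prod.lift_snd]

theorem top_le_δ_iff {a b : Z ⟶ A} :
    (⊤ : Subobject Z) ≤ rel (P := X.subD.P) (X.subD.el.δ A) a b ↔ a = b := by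
  refine top_le_rel_iff.trans ((factors_diag_iff _).trans ?_)
  rw [prod.lift_fst, prod.lift_snd]

/-- Introduction of `∃x. φ(x, b)` in the context `γ`, by a witness defined over the object `γ`. -/
theorem ex_conv_of_factors {A B Z : X.C} {γ : Subobject Z} {φ : Subobject (A ⨯ B)} {b : Z ⟶ B}
    (x : (γ : X.C) ⟶ A) (h : φ.Factors (prod.lift x (γ.arrow ≫ b))) :
    γ ≤ pull X.subD.P b
      (X.subD.ext.ex prod.fst (isProj_fst B A) (conv (P := X.subD.P) φ)) :=
  le_pull_iff.2 (top_le_pull_iff.1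
    (ex_conv_intro (D := X.subD) (A := A) (B := B) (a := x) (top_le_rel_iff.2 h)))

end Stages

instance : (discFunctor X.subD).Faithful where
  map_injective {A B f g} h := by
    have h₁ := (le_disc_map_iff (D := X.subD) (f := f) (a := 𝟙 A) (b := f)
      (γ := (⊤ : Subobject A))).2 (top_le_δ_iff.2 (Category.id_comp f))
    rw [h] at h₁
    have h₂ := top_le_δ_iff.1 ((le_disc_map_iff (D := X.subD)).1 h₁)
    exact h₂.symm.trans (Category.id_comp g)

/-- The graph of a functional relation is the graph of an arrow: its projection to the domain is
monic because the relation is single-valued, and a strong epimorphism because it is total. -/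
instance : (discFunctor X.subD).Full where
  map_surjective {A B} φ := by
    let S : Subobject (A ⨯ B) := gr φ
    let m₁ : (S : X.C) ⟶ A := S.arrow ≫ prod.fst
    let m₂ : (S : X.C) ⟶ B := S.arrow ≫ prod.snd
    have hS {Z : X.C} (u : Z ⟶ (S : X.C)) :
        (⊤ : Subobject Z) ≤ rel (P := X.subD.P) (gr φ) (u ≫ m₁) (u ≫ m₂) := by
      refine top_le_rel_iff.2 ((mk_factors_arrow S _).2 ⟨u, ?_⟩)
      rw [← prod.comp_lift, ← prod.comp_lift, prod.lift_fst_snd, Category.comp_id]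
    have : Mono m₁ := ⟨fun {Z} u v h => by
      have h₁ := hS u
      rw [h] at h₁
      have h₂ := top_le_δ_iff.1 (single (D := X.subD) h₁ (hS v))
      rw [← cancel_mono S.arrow]
      apply prod.hom_ext
      · simpa [m₁] using h
      · simpa [m₂] using h₂⟩
    have : StrongEpi m₁ := by
      obtain ⟨I, e, m, he, hm, hem⟩ := exists_fac (prod.fst : A ⨯ B ⟶ A) S
      have h₁ : (⊤ : Subobject A) ≤ (Subobject.exists prod.fst).obj S := by
        refine total_elim (D := X.subD) φ (Z := A) (a := 𝟙 A) (top_le_δ_iff.2 rfl)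
          fun g b γ' hγ hb => ?_
        have := X.subD.ext.exFst_intro hb
        rwa [Category.comp_id] at this
      rw [exists_eq_mk _ _ e m hem] at h₁
      have : IsIso m := (Subobject.isIso_iff_mk_eq_top m).2 (top_le_iff.1 h₁)
      change StrongEpi (S.arrow ≫ prod.fst)
      rw [← hem]
      infer_instance
    have : IsIso m₁ := isIso_of_mono_of_strongEpi m₁
    refine ⟨inv m₁ ≫ m₂, (hom_ext_of_le fun γ a b h => le_disc_map_iff.2 (le_δ_iff.2 ?_)).symm⟩
    obtain ⟨k, hk⟩ := (mk_factors_arrow _ _).1 (le_rel_iff.1 h)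
    have h₁ : k ≫ m₁ = γ.arrow ≫ a := by
      rw [← prod.lift_fst (γ.arrow ≫ a) (γ.arrow ≫ b), ← hk, Category.assoc]
    have h₂ : k ≫ m₂ = γ.arrow ≫ b := by
      rw [← prod.lift_snd (γ.arrow ≫ a) (γ.arrow ≫ b), ← hk, Category.assoc]
    rw [← h₂, ← reassoc_of% h₁, IsIso.hom_inv_id_assoc]

/-- The support `{a | ρ(a, a)}` of a symmetric and transitive relation of subobjects has a quotient
by the relation, as the relation is effective. -/
theorem exists_quotient (Y : TP X.subD) : ∃ (S : Subobject (show X.C from Y.A)) (Q : X.C)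
    (q : (S : X.C) ⟶ Q), IsRegularEpi q ∧
      (∀ {Z : X.C} (a : Z ⟶ Y.A),
        S.Factors a ↔ (⊤ : Subobject Z) ≤ rel (P := X.subD.P) Y.ρ a a) ∧
      ∀ {Z : X.C} (u v : Z ⟶ (S : X.C)), u ≫ q = v ≫ q ↔
        (⊤ : Subobject Z) ≤ rel (P := X.subD.P) Y.ρ (u ≫ S.arrow) (v ≫ S.arrow) := by
  let A : X.C := Y.A
  let R : Subobject (A ⨯ A) := Y.ρ
  let S : Subobject A := (Subobject.pullback (prod.lift (𝟙 A) (𝟙 A))).obj R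
  have hS {Z : X.C} (a : Z ⟶ A) :
      S.Factors a ↔ (⊤ : Subobject Z) ≤ rel (P := X.subD.P) Y.ρ a a := by
    refine (pullback_factors _ _ _).trans ?_
    rw [prod.comp_lift, Category.comp_id]
    exact top_le_rel_iff.symm
  have hR : (⊤ : Subobject (R : X.C)) ≤ rel (P := X.subD.P) Y.ρ (R.arrow ≫ prod.fst)
      (R.arrow ≫ prod.snd) := by
    refine top_le_rel_iff.2 ((mk_factors_arrow R _).2 ⟨𝟙 _, ?_⟩)
    rw [← prod.comp_lift, prod.lift_fst_snd, Category.comp_id, Category.id_comp]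
  obtain ⟨r₁, hr₁⟩ := (mk_factors_arrow S _).1 ((hS (R.arrow ≫ prod.fst)).2 (eq_left (X := Y) hR))
  obtain ⟨r₂, hr₂⟩ := (mk_factors_arrow S _).1 ((hS (R.arrow ≫ prod.snd)).2 (eq_right (X := Y) hR))
  have res {Z : X.C} (k : Z ⟶ (R : X.C)) : (⊤ : Subobject Z) ≤ rel (P := X.subD.P) Y.ρ
      ((k ≫ r₁) ≫ S.arrow) ((k ≫ r₂) ≫ S.arrow) := by
    have := rel_restrict (P := X.subD.P) (g := k) (γ' := (⊤ : Subobject Z))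
      (pull_top X.subD.P k).ge hR
    rwa [← hr₁, ← hr₂, ← Category.assoc, ← Category.assoc] at this
  have fac {Z : X.C} {u v : Z ⟶ (S : X.C)} (h : (⊤ : Subobject Z) ≤ rel (P := X.subD.P) Y.ρ
      (u ≫ S.arrow) (v ≫ S.arrow)) : ∃ k : Z ⟶ (R : X.C), k ≫ r₁ = u ∧ k ≫ r₂ = v := by
    obtain ⟨k, hk⟩ := (mk_factors_arrow R _).1 (top_le_rel_iff.1 h)
    refine ⟨k, ?_, ?_⟩
    · rw [← cancel_mono S.arrow, Category.assoc, hr₁, ← Category.assoc, hk, prod.lift_fst]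
    · rw [← cancel_mono S.arrow, Category.assoc, hr₂, ← Category.assoc, hk, prod.lift_snd]
  have refl {Z : X.C} (u : Z ⟶ (S : X.C)) :
      (⊤ : Subobject Z) ≤ rel (P := X.subD.P) Y.ρ (u ≫ S.arrow) (u ≫ S.arrow) :=
    (hS _).1 (Subobject.factors_of_factors_right u S.factors_self)
  obtain ⟨r, hr, hr'⟩ := fac (refl (𝟙 _))
  obtain ⟨s, hs, hs'⟩ := fac (u := r₂) (v := r₁) (by
    have := eq_symm (X := Y) (res (𝟙 _))
    rwa [Category.id_comp, Category.id_comp] at this)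
  let c := pullback.cone r₂ r₁
  obtain ⟨t, ht, ht'⟩ := fac (u := c.fst ≫ r₁) (v := c.snd ≫ r₂) (by
    have := res c.fst
    rw [c.condition] at this
    exact eq_trans (X := Y) this (res c.snd))
  have : IsEquivalenceRelation r₁ r₂ := ⟨⟨{
    right_cancellation := fun Z f g h h' => by
      rw [← cancel_mono R.arrow]
      apply prod.hom_ext
      · rw [Category.assoc, Category.assoc, ← hr₁, reassoc_of% h]
      · rw [Category.assoc, Category.assoc, ← hr₂, reassoc_of% h']
    r := r
    reflexivity₁ := hr
    reflexivity₂ := hr'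
    s := s
    symmetry₁ := hs
    symmetry₂ := hs'
    c := c
    isLimit := pullback.isLimit r₂ r₁
    t := t
    transitivity₁ := ht
    transitivity₂ := ht' }⟩⟩
  obtain ⟨⟨E⟩⟩ := ExactCategory.effective r₁ r₂
  refine ⟨S, E.B, E.π, inferInstance, hS, fun u v => ⟨fun h => ?_, fun h => ?_⟩⟩
  · obtain ⟨k, hk, hk'⟩ := E.isKernelPair.exists_lift u v h
    rw [← hk, ← hk']
    exact res k
  · obtain ⟨k, rfl, rfl⟩ := fac h
    rw [Category.assoc, Category.assoc, E.isPushout.w]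

/-- Every object is isomorphic to the effective quotient of its support. -/
instance : (discFunctor X.subD).EssSurj where
  mem_essImage Y := by
    obtain ⟨S, Q, q, hq, hS, hSq⟩ := exists_quotient Y
    have : Mono (prod.lift q S.arrow) := mono_of_mono_fac (prod.lift_snd q S.arrow)
    -- The relation `{(q(s), s) | s ∈ S}` is the graph of an isomorphism from `Q` to `Y`.
    let φ : Subobject (Q ⨯ (show X.C from Y.A)) := Subobject.mk (prod.lift q S.arrow)
    have hφ {Z : X.C} {γ : Subobject Z} {x : Z ⟶ Q} {a : Z ⟶ Y.A} :
        γ ≤ rel (P := X.subD.P) φ x a ↔ ∃ s : (γ : X.C) ⟶ (S : X.C),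
          s ≫ q = γ.arrow ≫ x ∧ s ≫ S.arrow = γ.arrow ≫ a := by
      refine le_rel_iff.trans ((mk_factors _ _).trans (exists_congr fun s => ?_))
      rw [prod.comp_lift]
      refine ⟨fun h => ?_, fun h => by rw [h.1, h.2]⟩
      have h₁ := congrArg (· ≫ prod.fst) h
      have h₂ := congrArg (· ≫ prod.snd) h
      simp only [prod.lift_fst, prod.lift_snd] at h₁ h₂
      exact ⟨h₁, h₂⟩
    let f : disc (D := X.subD) Q ⟶ Y := homMk (X := disc (D := X.subD) Q) (Y := Y) φ
      (fun _ => X.subD.el.le_refl)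
      (fun h => by
        obtain ⟨s, h₁, h₂⟩ := hφ.1 h
        refine le_rel_iff_top.2 ((hS _).1 ?_)
        exact (mk_factors_arrow _ _).2 ⟨s, h₂⟩)
      (fun h h' => by
        obtain ⟨s, h₁, h₂⟩ := hφ.1 h'
        exact hφ.2 ⟨s, h₁.trans (le_δ_iff.1 h).symm, h₂⟩)
      (fun {Z γ x a b} h h' => by
        obtain ⟨s, h₁, h₂⟩ := hφ.1 h
        have h₃ := le_rel_iff_top.1 h'
        obtain ⟨t, ht⟩ := (mk_factors_arrow S _).1 ((hS _).2 (eq_right (X := Y) h₃))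
        refine hφ.2 ⟨t, Eq.trans ?_ h₁, ht⟩
        refine ((hSq _ _).2 ?_).symm
        rw [h₂, ht]
        exact h₃)
      (fun h h' => by
        obtain ⟨s, h₁, h₂⟩ := hφ.1 h
        obtain ⟨t, h₃, h₄⟩ := hφ.1 h'
        have h₅ := (hSq _ _).1 (h₁.trans h₃.symm)
        rw [h₂, h₄] at h₅
        exact le_rel_iff_top.2 h₅)
      (fun {Z γ x} _ => by
        have h : (Subobject.exists prod.fst).obj φ = ⊤ := by
          rw [exists_mk_eq_mk _ _ q (𝟙 Q) (by rw [prod.lift_fst, Category.comp_id])]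
          exact Subobject.mk_eq_top_of_isIso _
        have h' : pull X.subD.P x (X.subD.ext.ex prod.fst (isProj_fst Q Y.A) φ) = ⊤ :=
          (congrArg (pull X.subD.P x) h).trans (pull_top _ _)
        rw [h']
        exact le_top)
    have hf {Z : X.C} {γ : Subobject Z} {x : Z ⟶ Q} {a : Z ⟶ Y.A} :
        γ ≤ rel (P := X.subD.P) (gr f) x a ↔ _ := hφ
    have : IsIso f := by
      refine isIso_of_inj_surj (fun Z γ x x' a h h' => ?_) (fun Z γ a h => ?_)
      · obtain ⟨s, h₁, h₂⟩ := hf.1 h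
        obtain ⟨t, h₃, h₄⟩ := hf.1 h'
        refine le_δ_iff.2 ?_
        rw [← h₁, ← h₃, (cancel_mono S.arrow).1 (h₂.trans h₄.symm)]
      · obtain ⟨s, hs⟩ := (mk_factors_arrow S _).1 ((hS _).2 (le_rel_iff_top.1 h))
        refine ex_conv_of_factors (A := Q) (B := (show X.C from Y.A)) (s ≫ q) ?_
        refine (mk_factors _ _).2 ⟨s, ?_⟩
        rw [prod.comp_lift, hs]
    exact ⟨Q, ⟨asIso f⟩⟩

instance : (discFunctor X.subD).IsEquivalence where

section Compr

variable {A I : X.C} {S : X.subD.fib A} {m : I ⟶ A}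

/-- The comprehension of the subobject represented by `m : I ⟶ A` is isomorphic to `I`. -/
theorem isIso_memMap [Mono m] (hS : ⊤ ≤ pull X.subD.P m S)
    (hS' : ∀ {Z : X.C} {g : Z ⟶ A}, ⊤ ≤ pull X.subD.P g S → ∃ s, s ≫ m = g) :
    IsIso (memMap (D := X.subD) m hS) := by
  refine isIso_of_inj_surj (fun Z γ a a' b h h' => ?_) (fun Z γ b h => ?_)
  · have h₁ := le_δ_iff.1 (le_memMap_iff.1 h)
    have h₂ := le_δ_iff.1 (le_memMap_iff.1 h')
    refine le_δ_iff.2 ?_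
    rw [← cancel_mono m, Category.assoc, Category.assoc, h₁, h₂]
  · let γ' : Subobject Z := γ
    have h₁ : (⊤ : Subobject (γ' : X.C)) ≤ pull X.subD.P (γ'.arrow ≫ b) S :=
      top_le_pull_iff.2 (le_pull_iff.1 (le_compr_iff.1 h).2)
    obtain ⟨s, hs⟩ := hS' h₁
    refine ex_conv_of_factors (A := I) (B := A) s ?_
    have h₂ := (le_memMap_iff (D := X.subD) (h := hS) (γ := (⊤ : Subobject (γ' : X.C)))
      (b := γ'.arrow ≫ b)).2 (top_le_δ_iff.2 hs)
    exact top_le_rel_iff.1 h₂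

end Compr

/-- Comprehension agrees with the action of the functor `X ⥤ T_{Sub X}` on subobjects. -/
theorem mk_comprι_eq_mapSub {A : X.C} (S : X.subD.fib A) :
    Subobject.mk (comprι S) = mapSub (discFunctor X.subD) (A := A) S := by
  let S' : Subobject A := S
  have hS : ⊤ ≤ pull X.subD.P S'.arrow S := top_le_pull_iff.2 S'.factors_self
  have := isIso_memMap hS fun h => (mk_factors_arrow _ _).1 (top_le_pull_iff.1 h)
  have : Mono ((discFunctor X.subD).map S'.arrow) := (discFunctor X.subD).map_mono S'.arrow
  exact (Subobject.mk_eq_mk_of_comm _ _ (asIso (memMap (D := X.subD) S'.arrow hS))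
    (memMap_comprι hS)).symm

end Xct

theorem map_isRegularEpi {C : Type*} [Category* C] {C' : Type*} [Category* C'] (F : C ⥤ C')
    [PreservesColimitsOfShape WalkingParallelPair F] {A B : C} (e : A ⟶ B) [he : IsRegularEpi e] :
    IsRegularEpi (F.map e) := by
  obtain ⟨⟨r⟩⟩ := he
  exact ⟨⟨{
    W := F.obj r.W
    left := F.map r.left
    right := F.map r.right
    w := by rw [← F.map_comp, r.w, F.map_comp]
    isColimit := isColimitCoforkMapOfIsColimit F r.w r.isColimit }⟩⟩

namespace Xct

open TP

variable (X : Xct.{u})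

/-- The equivalence from an exact category to the exact completion of its doctrine of subobjects. -/
def toCompletion : Xct.Hom X (completion X.subD) where
  F := discFunctor X.subD
  lex := inferInstanceAs (PreservesFiniteLimits (discFunctor X.subD))
  map_regularEpi e _ := map_isRegularEpi (discFunctor X.subD) e

/-- The inverse of the equivalence `toCompletion`. -/
def ofCompletion : Xct.Hom (completion X.subD) X where
  F := (discFunctor X.subD).inv
  lex := inferInstanceAs (PreservesFiniteLimits (discFunctor X.subD).inv)
  map_regularEpi e _ := map_isRegularEpi (discFunctor X.subD).inv e

/-- `ofCompletion` is a left inverse of `toCompletion`, up to isomorphism. -/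
def toCompletionCompOfCompletion : (toCompletion X).comp (ofCompletion X) ≅ Xct.Hom.id X :=
  Xct.isoMk ((toCompletion X).comp (ofCompletion X)) (Xct.Hom.id X)
    (discFunctor X.subD).asEquivalence.unitIso.symm

/-- The unit at a doctrine of subobjects is the action of an equivalence on subobjects. -/
def unitHomIso : unitHom X.subD ≅ (toCompletion X).sub :=
  EED.isoMk (unitHom X.subD) (toCompletion X).sub (Iso.refl _) fun A S =>
    (mk_comprι_eq_mapSub S).trans
      (pull_id (completion X.subD).sub.P (A := (discFunctor X.subD).obj A)
        (mapSub (discFunctor X.subD) (A := A) S)).symm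

end Xct

namespace TP

variable {D : EED.{u}} {X Y : TP D}

/-! ### Presentations of objects and arrows by predicates -/

/-- The support `{a | ρ(a, a)}` of an object `(A, ρ)` of the exact completion. -/
abbrev support (X : TP D) : D.fib X.A := rel X.ρ (𝟙 X.A) (𝟙 X.A)

theorem le_support_iff {Z : D.C} {γ : D.fib Z} {a : Z ⟶ X.A} :
    γ ≤ pull D.P a X.support ↔ γ ≤ rel X.ρ a a := by
  rw [pull_rel, Category.comp_id]

theorem tracks_cover (X : TP D) : Tracks (compr X.support) X (𝟙 X.A) := fun Z γ a b h => by
  rw [le_compr_iff] at h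
  rw [Category.comp_id, Category.comp_id]
  exact Elementary.le_subst_rel h.1 (le_support_iff.1 h.2)

/-- The object `(A, ρ)` is a quotient of its support. -/
def cover (X : TP D) : compr X.support ⟶ X := track (𝟙 X.A) X.tracks_cover

theorem le_cover_iff {Z : D.C} {γ : D.fib Z} {a b : Z ⟶ X.A} :
    γ ≤ rel (gr X.cover) a b ↔ γ ≤ rel X.ρ a b := by
  refine (le_track_iff (X := compr X.support) (Y := X) (hm := X.tracks_cover)).trans ?_
  rw [le_compr_iff, le_support_iff, Category.comp_id]
  exact ⟨And.right, fun h => ⟨⟨D.el.le_refl, eq_left h⟩, h⟩⟩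

theorem surj_cover (X : TP D) : Surj X.cover :=
  fun Z γ b h => ex_conv_intro (A := X.A) (a := b) (le_cover_iff.2 h)

/-- The first projection from the graph of an arrow. -/
def graphFst (f : X ⟶ Y) : compr (gr f) ⟶ compr X.support :=
  comprMap prod.fst (le_support_iff.2 (dom (f := f) (rel_fst_snd (gr f)).ge))

/-- The second projection from the graph of an arrow. -/
def graphSnd (f : X ⟶ Y) : compr (gr f) ⟶ compr Y.support :=
  comprMap prod.snd (le_support_iff.2 (cod (f := f) (rel_fst_snd (gr f)).ge))

theorem le_graphFst_iff {f : X ⟶ Y} {Z : D.C} {γ : D.fib Z} {p : Z ⟶ X.A ⨯ Y.A} {a : Z ⟶ X.A} :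
    γ ≤ rel (gr (graphFst f)) p a ↔ γ ≤ rel (D.el.δ X.A) (p ≫ prod.fst) a ∧
      γ ≤ rel (gr f) (p ≫ prod.fst) (p ≫ prod.snd) := by
  rw [← pull_eq_rel]
  exact le_comprMap_iff

theorem le_graphSnd_iff {f : X ⟶ Y} {Z : D.C} {γ : D.fib Z} {p : Z ⟶ X.A ⨯ Y.A} {b : Z ⟶ Y.A} :
    γ ≤ rel (gr (graphSnd f)) p b ↔ γ ≤ rel (D.el.δ Y.A) (p ≫ prod.snd) b ∧
      γ ≤ rel (gr f) (p ≫ prod.fst) (p ≫ prod.snd) := by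
  rw [← pull_eq_rel]
  exact le_comprMap_iff

/-- The graph of `f` is the pullback along `f` of the presentation of its codomain. -/
theorem internalPullback_graph (f : X ⟶ Y) :
    InternalPullback (graphFst f) (graphSnd f) (X.cover ≫ f) Y.cover where
  w := by
    refine hom_ext_of_le fun γ p c h => comp_elim h fun s a γ' hγ h₁ h₂ => ?_
    refine comp_elim h₂ fun t b γ'' hγ' h₃ h₄ => ?_
    have h₁' := le_graphFst_iff.1 (rel_restrict hγ' h₁)
    rw [le_cover_iff] at h₃
    have h₅ := congr_left (Elementary.le_subst_rel (Elementary.le_symm h₁'.1) (eq_symm h₃)) h₄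
    rw [pull_rel, pull_rel]
    exact comp_intro (le_graphSnd_iff.2 ⟨D.el.le_refl, h₁'.2⟩) (le_cover_iff.2 (single h₁'.2 h₅))
  inj := fun Z γ w w' a b h₁ h₂ h₃ h₄ => by
    rw [le_graphFst_iff] at h₁ h₃
    rw [le_graphSnd_iff] at h₂ h₄
    refine le_compr_iff.2 ⟨Elementary.le_prod (Elementary.le_trans h₁.1 (Elementary.le_symm h₃.1))
      (Elementary.le_trans h₂.1 (Elementary.le_symm h₄.1)), ?_⟩
    rw [pull_eq_rel]
    exact h₁.2
  surj {Z γ a b c} h h' := by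
    rw [le_cover_iff] at h'
    have h₁ : γ ≤ rel (gr f) a b := comp_elim h fun s x γ' hγ h₁ h₂ => by
      rw [le_cover_iff] at h₁
      rw [pull_rel]
      exact congr_left (eq_symm h₁) (congr_right (eq_symm (rel_restrict hγ h')) h₂)
    refine span_intro (w := prod.lift a b) (le_graphFst_iff.2 ?_) (le_graphSnd_iff.2 ?_)
    · rw [prod.lift_fst, prod.lift_snd]
      exact ⟨D.el.le_refl, h₁⟩
    · rw [prod.lift_fst, prod.lift_snd]
      exact ⟨D.el.le_refl, h₁⟩

section Regular

variable {𝒳 : Type w} [Category.{v} 𝒳] {G H : TP D ⥤ 𝒳}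

/-- Natural transformations between regular functors on the exact completion are determined by
their values at the objects of the base: the object `(A, ρ)` is a quotient of a subobject of `A`. -/
theorem natTrans_ext [PreservesFiniteLimits H]
    (hG : ∀ {X Y : TP D} (e : X ⟶ Y) [IsRegularEpi e], IsRegularEpi (G.map e)) {s t : G ⟶ H}
    (h : ∀ A : D.C, s.app (disc A) = t.app (disc A)) : s = t := by
  ext X
  have := (surj_cover X).isRegularEpi
  have := hG X.cover
  rw [← cancel_epi (G.map X.cover), s.naturality, t.naturality]
  congr 1
  rw [← cancel_mono (H.map (comprι X.support)), ← s.naturality, ← t.naturality, h]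

/-- A natural transformation on the objects of the base that restricts to all comprehensions extends
to the exact completion: it descends along the covers, whose kernel pairs are comprehensions, and it
is natural as the graph of an arrow is a comprehension. -/
theorem exists_natTrans [PreservesFiniteLimits G] [PreservesFiniteLimits H]
    (hG : ∀ {X Y : TP D} (e : X ⟶ Y) [IsRegularEpi e], IsRegularEpi (G.map e))
    (t : discFunctor D ⋙ G ⟶ discFunctor D ⋙ H)
    (ht : ∀ (A : D.C) (α : D.fib A),
      ∃ k, k ≫ H.map (comprι α) = G.map (comprι α) ≫ t.app A) :
    ∃ s : G ⟶ H, ∀ A : D.C, s.app (disc A) = t.app A := by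
  choose κ hκ using ht
  have nat {A B : D.C} {α : D.fib A} {β : D.fib B} (f : A ⟶ B) (h : α ≤ pull D.P f β) :
      G.map (comprMap f h) ≫ κ B β = κ A α ≫ H.map (comprMap f h) := by
    rw [← cancel_mono (H.map (comprι β)), Category.assoc, Category.assoc, hκ, ← H.map_comp,
      comprMap_comprι, H.map_comp, reassoc_of% hκ, ← Category.assoc, ← G.map_comp,
      comprMap_comprι, G.map_comp, Category.assoc]
    congr 1
    exact t.naturality f
  have natFst {X Y : TP D} (f : X ⟶ Y) : G.map (graphFst f) ≫ κ _ X.support =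
      κ _ (gr f) ≫ H.map (graphFst f) := nat _ _
  have natSnd {X Y : TP D} (f : X ⟶ Y) : G.map (graphSnd f) ≫ κ _ Y.support =
      κ _ (gr f) ≫ H.map (graphSnd f) := nat _ _
  have desc (X : TP D) : ∃ d : G.obj X ⟶ H.obj X,
      G.map X.cover ≫ d = κ _ X.support ≫ H.map X.cover := by
    have := (surj_cover X).isRegularEpi
    have := hG X.cover
    -- The graph of the identity of `X` is the kernel pair of its cover.
    have P := internalPullback_graph (𝟙 X)
    rw [Category.comp_id] at P
    have k : IsKernelPair (G.map X.cover) _ _ := P.isPullback.map G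
    refine ⟨_, Cofork.IsColimit.π_desc' k.toCoequalizer' (κ _ X.support ≫ H.map X.cover) ?_⟩
    rw [reassoc_of% (natFst (𝟙 X)), reassoc_of% (natSnd (𝟙 X)), ← H.map_comp, ← H.map_comp, P.w]
  choose d hd using desc
  refine ⟨⟨d, fun {X Y} f => ?_⟩, fun A => ?_⟩
  · have P := internalPullback_graph f
    have := (P.surj_fst (surj_cover Y)).isRegularEpi
    have := hG (graphFst f)
    have := (surj_cover X).isRegularEpi
    have := hG X.cover
    rw [← cancel_epi (G.map X.cover), ← cancel_epi (G.map (graphFst f)), reassoc_of% (hd X),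
      reassoc_of% (natFst f), ← H.map_comp, ← H.map_comp, P.w, H.map_comp,
      ← reassoc_of% (natSnd f), ← hd, ← G.map_comp_assoc, ← G.map_comp_assoc, Category.assoc,
      P.w, G.map_comp_assoc]
  · have := (surj_cover (disc A)).isRegularEpi
    have := hG (cover (disc A))
    refine (cancel_epi (G.map (cover (disc A)))).1 ((hd _).trans ?_)
    exact hκ A (support (disc A))

end Regular

end TP

open Bicategory

/-! ### The universal property -/

namespace TP

variable {D : EED.{u}} {X : Xct.{u}}

/-- The extension of `f : D ⟶ Sub X` along the unit: the composite `T_D ⟶ T_{Sub X} ≃ X`. -/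
def extend (f : D ⟶ X.subD) : completion D ⟶ X :=
  Xct.Hom.comp (mapXct (E := X.subD) f) X.ofCompletion

/-- The extension restricts to `f` along the unit, by pseudonaturality of the unit at `f` and since
the unit at `Sub X` is the action of `X ≃ T_{Sub X}` on subobjects. -/
def extendIso (f : D ⟶ X.subD) : (show D ⟶ (completion D).sub from unitHom D) ≫
    Xct.subDoctrine.map (extend f) ≅ (f : D ⟶ X.sub) :=
  whiskerLeftIso (show D ⟶ (completion D).sub from unitHom D)
    (Xct.subDoctrine.mapComp (mapXct (E := X.subD) f) X.ofCompletion) ≪≫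
  (α_ _ _ _).symm ≪≫
  whiskerRightIso (show f ≫ (show X.subD ⟶ _ from unitHom X.subD) ≅ _ from
    unitNat (E := X.subD) f).symm _ ≪≫
  α_ _ _ _ ≪≫
  whiskerLeftIso f (whiskerRightIso X.unitHomIso _ ≪≫
    (Xct.subDoctrine.mapComp X.toCompletion X.ofCompletion).symm ≪≫
    Xct.subDoctrine.map₂Iso X.toCompletionCompOfCompletion ≪≫
    Xct.subDoctrine.mapId X) ≪≫ ρ_ f

variable (D X) in
/-- Transposition along the unit. -/
abbrev transposeUnit : (completion D ⟶ X) ⥤ (D ⟶ X.sub) :=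
  transpose Xct.subDoctrine (b := D) (x := completion D) (unitHom D) X

instance : (transposeUnit D X).Faithful where
  map_injective {G H s t} h := by
    have := Xct.Hom.lex H
    refine Xct.Hom₂.ext (natTrans_ext (Xct.Hom.map_regularEpi G) fun A => ?_)
    exact congrArg (fun r : EED.Hom₂ _ _ => r.θ.app A) h

/-- A 2-arrow of doctrines restricts to comprehensions, by its compatibility with predicates. -/
instance : (transposeUnit D X).Full where
  map_surjective {G H} t := by
    have := Xct.Hom.lex G
    have := Xct.Hom.lex H
    let t' : discFunctor D ⋙ Xct.Hom.F G ⟶ discFunctor D ⋙ Xct.Hom.F H := EED.Hom₂.θ t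
    obtain ⟨s, hs⟩ := exists_natTrans (Xct.Hom.map_regularEpi G) t' fun A α => by
      have h : mapSub (Xct.Hom.F G) (Subobject.mk (comprι α)) ≤ (Subobject.pullback (t'.app A)).obj
          (mapSub (Xct.Hom.F H) (Subobject.mk (comprι α))) := EED.Hom₂.le t A α
      rw [mapSub_mk, mapSub_mk, sub_le_iff] at h
      have := h _ (Subobject.mk_factors_self _)
      rwa [pullback_factors, mk_factors] at this
    exact ⟨(⟨s⟩ : Xct.Hom₂ G H), EED.Hom₂.ext (NatTrans.ext (funext hs))⟩

instance : (transposeUnit D X).EssSurj where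
  mem_essImage f := ⟨extend f, ⟨extendIso f⟩⟩

instance : (transposeUnit D X).IsEquivalence where

end TP

/-! ### The exact completion as a pseudofunctor -/

namespace EED.Hom

variable {D E K : EED.{u}}

theorem tr_id {A B : D.C} (φ : D.fib (A ⨯ B)) : (EED.Hom.id D).tr φ = φ := by
  have h : pull D.P (𝟙 (A ⨯ B)) φ = rel (A := A) (B := B) ((EED.Hom.id D).tr φ)
    (𝟙 (A ⨯ B) ≫ prod.fst) (𝟙 (A ⨯ B) ≫ prod.snd) := pull_app_eq (F := EED.Hom.id D) (𝟙 (A ⨯ B)) φ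
  rw [Category.id_comp, Category.id_comp, pull_id] at h
  exact ((h.trans (rel_fst_snd (A := A) (B := B) _))).symm

theorem tr_comp (f : EED.Hom D E) (g : EED.Hom E K) {A B : D.C} (φ : D.fib (A ⨯ B)) :
    (f.comp g).tr φ = g.tr (f.tr φ) := by
  obtain ⟨z, h₁, h₂⟩ := exists_pair (F := f.comp g) (A := A) (B := B) prod.fst prod.snd
  have h₃ := pull_app_eq (F := f.comp g) z φ
  have h₄ : f.app φ = _ := (pull_id _ _).symm.trans (pull_app_eq (F := f) (𝟙 _) φ)
  rw [Category.id_comp, Category.id_comp] at h₄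
  have h₅ := pull_app_rel (F := g) z (f.tr φ) (f.F.map prod.fst) (f.F.map prod.snd)
  rw [← h₄] at h₅
  rw [← rel_fst_snd ((f.comp g).tr φ), ← rel_fst_snd (g.tr (f.tr φ))]
  refine Eq.trans (congrArg₂ (rel ((f.comp g).tr φ)) h₁.symm h₂.symm)
    (Eq.trans ?_ (congrArg₂ (rel (g.tr (f.tr φ))) h₁ h₂))
  exact h₃.symm.trans h₅

/-- The components of a 2-arrow take pairs related by `F φ` to pairs related by `G φ`. -/
theorem le_tr_of_hom₂ {F G : EED.Hom D E} (s : EED.Hom₂ F G) {A B : D.C} {φ : D.fib (A ⨯ B)}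
    {Z : E.C} {γ : E.fib Z} {a : Z ⟶ F.F.obj A} {b : Z ⟶ F.F.obj B} (h : γ ≤ rel (F.tr φ) a b) :
    γ ≤ rel (G.tr φ) (a ≫ s.θ.app A) (b ≫ s.θ.app B) := by
  obtain ⟨z, rfl, rfl⟩ := exists_pair a b
  rw [← pull_app_eq] at h
  have := h.trans (pull_mono E.P z (s.le _ φ))
  rwa [pull_pull, pull_app_eq, Category.assoc, Category.assoc, ← s.θ.naturality,
    ← s.θ.naturality, ← Category.assoc, ← Category.assoc] at this

end EED.Hom

namespace TP

variable {D E K : EED.{u}}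

/-- Naturality of an arrow tracked by the base. -/
theorem comp_track_eq {X Y X' Y' : TP D} {f : X ⟶ Y} {f' : X' ⟶ Y'} {m : X.A ⟶ X'.A}
    {n : Y.A ⟶ Y'.A} (hm : Tracks X X' m) (hn : Tracks Y Y' n)
    (h : ∀ {Z : D.C} {γ : D.fib Z} {a : Z ⟶ X.A} {b : Z ⟶ Y.A}, γ ≤ rel (gr f) a b →
      γ ≤ rel (gr f') (a ≫ m) (b ≫ n)) : f ≫ track n hn = track m hm ≫ f' := by
  refine hom_ext_of_le fun γ a c hr => comp_elim hr fun s b γ' hγ h₁ h₂ => ?_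
  rw [pull_rel]
  exact comp_intro (track_self (dom h₁)) (congr_right (le_track_iff.1 h₂).2 (h h₁))

theorem tracks_of_hom₂ {F G : EED.Hom D E} (s : EED.Hom₂ F G) (X : TP D) :
    Tracks (mapObj F X) (mapObj G X) (s.θ.app X.A) :=
  fun _ _ _ _ h => EED.Hom.le_tr_of_hom₂ s h

/-- The natural transformation induced by a 2-arrow of doctrines. -/
def mapHom₂ {F G : EED.Hom D E} (s : EED.Hom₂ F G) : Xct.Hom₂ (mapXct F) (mapXct G) where
  θ := {
    app X := track (X := mapObj F X) (Y := mapObj G X) (s.θ.app X.A) (tracks_of_hom₂ s X)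
    naturality X Y f := comp_track_eq (X := mapObj F X) (Y := mapObj F Y) (X' := mapObj G X)
      (Y' := mapObj G Y) (f := mapHom F f) (f' := mapHom G f) (tracks_of_hom₂ s X)
      (tracks_of_hom₂ s Y) fun h => EED.Hom.le_tr_of_hom₂ s h }

theorem mapId_iff (X : TP D) ⦃Z : D.C⦄ ⦃γ : D.fib Z⦄ ⦃a b : Z ⟶ X.A⦄ :
    γ ≤ rel (mapObj (EED.Hom.id D) X).ρ a b ↔
      γ ≤ rel X.ρ (a ≫ (Iso.refl X.A).hom) (b ≫ (Iso.refl X.A).hom) := by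
  change γ ≤ rel ((EED.Hom.id D).tr X.ρ) a b ↔ γ ≤ rel X.ρ (a ≫ 𝟙 _) (b ≫ 𝟙 _)
  rw [EED.Hom.tr_id, Category.comp_id, Category.comp_id]
  exact Iff.rfl

variable (D) in
/-- Transport along an identity is isomorphic to the identity. -/
def mapXctId : mapXct (EED.Hom.id D) ≅ Xct.Hom.id (completion D) :=
  Xct.isoMk (mapXct (EED.Hom.id D)) (Xct.Hom.id (completion D))
    (NatIso.ofComponents (F := mapFunctor (EED.Hom.id D)) (G := 𝟭 (TP D))
      (fun X => isoOfBase (X := mapObj (EED.Hom.id D) X) (Y := X) (Iso.refl _) (mapId_iff X))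
      (fun {X Y} f => comp_track_eq (X := mapObj (EED.Hom.id D) X) (Y := mapObj (EED.Hom.id D) Y)
        (f := mapHom (EED.Hom.id D) f) (tracks_hom (mapId_iff X)) (tracks_hom (mapId_iff Y))
        fun {Z γ a b} h => by
          change γ ≤ rel ((EED.Hom.id D).tr (gr f)) a b at h
          change γ ≤ rel (gr f) (a ≫ 𝟙 _) (b ≫ 𝟙 _)
          rwa [EED.Hom.tr_id, ← Category.comp_id a, ← Category.comp_id b] at h))

theorem mapComp_iff (f : EED.Hom D E) (g : EED.Hom E K) (X : TP D) ⦃Z : K.C⦄ ⦃γ : K.fib Z⦄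
    ⦃a b : Z ⟶ g.F.obj (f.F.obj X.A)⦄ : γ ≤ rel (mapObj (f.comp g) X).ρ a b ↔
      γ ≤ rel (mapObj g (mapObj f X)).ρ (a ≫ (Iso.refl (g.F.obj (f.F.obj X.A))).hom)
        (b ≫ (Iso.refl (g.F.obj (f.F.obj X.A))).hom) := by
  change γ ≤ rel ((f.comp g).tr X.ρ) a b ↔ γ ≤ rel (g.tr (f.tr X.ρ)) (a ≫ 𝟙 _) (b ≫ 𝟙 _)
  rw [EED.Hom.tr_comp, Category.comp_id, Category.comp_id]
  exact Iff.rfl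

/-- Transport along a composite is isomorphic to the composite of the transports. -/
def mapXctComp (f : EED.Hom D E) (g : EED.Hom E K) :
    mapXct (f.comp g) ≅ (mapXct f).comp (mapXct g) :=
  Xct.isoMk (mapXct (f.comp g)) ((mapXct f).comp (mapXct g))
    (NatIso.ofComponents (F := mapFunctor (f.comp g)) (G := mapFunctor f ⋙ mapFunctor g)
      (fun X => isoOfBase (X := mapObj (f.comp g) X) (Y := mapObj g (mapObj f X)) (Iso.refl _)
        (mapComp_iff f g X))
      (fun {X Y} h => comp_track_eq (X := mapObj (f.comp g) X) (Y := mapObj (f.comp g) Y)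
        (X' := mapObj g (mapObj f X)) (Y' := mapObj g (mapObj f Y))
        (f := mapHom (f.comp g) h) (f' := mapHom g (mapHom f h)) (tracks_hom (mapComp_iff f g X))
        (tracks_hom (mapComp_iff f g Y))
        fun {Z γ a b} h' => by
          change γ ≤ rel ((f.comp g).tr (gr h)) a b at h'
          change γ ≤ rel (g.tr (f.tr (gr h))) (a ≫ 𝟙 _) (b ≫ 𝟙 _)
          rwa [EED.Hom.tr_comp, ← Category.comp_id a, ← Category.comp_id b] at h'))

end TP

namespace TP
variable {D E K : EED.{u}}

theorem hom₂_ext {D : EED.{u}} {X : Xct.{u}} {G H : completion D ⟶ X} {s t : Xct.Hom₂ G H}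
    (h : ∀ X : TP D, s.θ.app X = t.θ.app X) : s = t :=
  Xct.Hom₂.ext (NatTrans.ext (funext h))

/-- An arrow of the exact completion is tracked by `m` if it takes `a` to `m(a)`. As such an arrow
is determined by `m`, equations between tracked arrows hold when they hold in the base. -/
def IsTracked {X Y : TP D} (f : X ⟶ Y) (m : X.A ⟶ Y.A) : Prop :=
  ∀ ⦃Z : D.C⦄ ⦃γ : D.fib Z⦄ ⦃a : Z ⟶ X.A⦄ ⦃b : Z ⟶ Y.A⦄,
    γ ≤ rel (gr f) a b → γ ≤ rel Y.ρ (a ≫ m) b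

section IsTracked

variable {X Y V : TP D} {f : X ⟶ Y} {g : Y ⟶ V} {m : X.A ⟶ Y.A} {n : Y.A ⟶ V.A}

theorem isTracked_track (hm : Tracks X Y m) : IsTracked (track m hm) m :=
  fun _ _ _ _ h => (le_track_iff.1 h).2

theorem isTracked_id (X : TP D) : IsTracked (𝟙 X) (𝟙 X.A) := fun _ _ _ _ h => by
  rwa [Category.comp_id]

theorem IsTracked.comp (hf : IsTracked f m) (hg : IsTracked g n) : IsTracked (f ≫ g) (m ≫ n) :=
  fun Z γ a b h => comp_elim h fun s x γ' hγ h₁ h₂ => by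
    have := hg (congr_left (eq_symm (hf h₁)) h₂)
    rwa [pull_rel, ← Category.assoc a, ← Category.assoc s, ← Category.assoc s]

theorem IsTracked.ext {f' : X ⟶ Y} {m' : X.A ⟶ Y.A} (hf : IsTracked f m) (hf' : IsTracked f' m')
    (h : m = m') : f = f' := by
  subst h
  refine hom_ext_of_le fun γ a b hab => total_elim f' (dom hab) fun s c γ' hγ hc => ?_
  rw [pull_rel]
  have := hf (rel_restrict hγ hab)
  exact congr_right (eq_trans (eq_symm (hf' hc)) this) hc

theorem IsTracked.map (F : EED.Hom D E) (hf : IsTracked f m) :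
    IsTracked (X := mapObj F X) (Y := mapObj F Y) (mapHom F f) (F.F.map m) := fun Z γ a b h => by
  obtain ⟨z, rfl, rfl⟩ := EED.Hom.exists_pair a b
  have h₁ := F.app_mono (hf (le_refl (rel (gr f) prod.fst prod.snd)))
  have h₂ := pull_mono E.P z h₁
  rw [EED.Hom.pull_app_rel, EED.Hom.pull_app_rel, F.F.map_comp, ← Category.assoc] at h₂
  exact h.trans h₂

end IsTracked

theorem isTracked_mapHom₂ {F G : EED.Hom D E} (s : EED.Hom₂ F G) (X : TP D) :
    IsTracked (X := mapObj F X) (Y := mapObj G X) ((mapHom₂ s).θ.app X) (s.θ.app X.A) :=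
  isTracked_track (X := mapObj F X) (Y := mapObj G X) (tracks_of_hom₂ s X)

theorem isTracked_mapComp_hom (F : EED.Hom D E) (G : EED.Hom E K) (X : TP D) :
    IsTracked (X := mapObj (F.comp G) X) (Y := mapObj G (mapObj F X))
      ((Xct.Hom₂.θ (mapXctComp F G).hom).app X) (𝟙 (G.F.obj (F.F.obj X.A))) :=
  isTracked_track (X := mapObj (F.comp G) X) (Y := mapObj G (mapObj F X))
    (tracks_hom (mapComp_iff F G X))

theorem isTracked_mapComp_inv (F : EED.Hom D E) (G : EED.Hom E K) (X : TP D) :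
    IsTracked (X := mapObj G (mapObj F X)) (Y := mapObj (F.comp G) X)
      ((Xct.Hom₂.θ (mapXctComp F G).inv).app X) (𝟙 (G.F.obj (F.F.obj X.A))) :=
  isTracked_track (X := mapObj G (mapObj F X)) (Y := mapObj (F.comp G) X)
    (tracks_inv (mapComp_iff F G X))

theorem isTracked_mapId_hom (X : TP D) :
    IsTracked (X := mapObj (EED.Hom.id D) X) (Y := X) ((Xct.Hom₂.θ (mapXctId D).hom).app X)
      (𝟙 X.A) :=
  isTracked_track (X := mapObj (EED.Hom.id D) X) (Y := X) (tracks_hom (mapId_iff X))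

theorem id_eq_comp_map_id_comp₃ {C C' : Type*} [Category* C] [Category* C'] (F : C ⥤ C') (A : C) :
    𝟙 (F.obj A) = 𝟙 _ ≫ F.map (𝟙 A) ≫ 𝟙 _ ≫ 𝟙 _ ≫ 𝟙 _ := by simp

theorem id_eq_comp_map_id_comp {C C' : Type*} [Category* C] [Category* C'] (F : C ⥤ C') (A : C) :
    𝟙 (F.obj A) = 𝟙 _ ≫ F.map (𝟙 A) ≫ 𝟙 _ := by simp

/-- The exact completion, as a pseudofunctor. All components of its structure are tracked by
components of 2-arrows in the base, so its axioms follow from equations in the base. -/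
def completionFunctor : Pseudofunctor EED.{u} Xct.{u} where
  obj D := completion D
  map F := mapXct F
  map₂ s := mapHom₂ s
  map₂_id F := hom₂_ext fun X =>
    IsTracked.ext (X := mapObj F X) (Y := mapObj F X) (isTracked_mapHom₂ (𝟙 F) X)
      (isTracked_id _) rfl
  map₂_comp {_ _ F _ H} s t := hom₂_ext fun X =>
    IsTracked.ext (X := mapObj F X) (Y := mapObj H X) (isTracked_mapHom₂ (s ≫ t) X)
      ((isTracked_mapHom₂ s X).comp (isTracked_mapHom₂ t X)) rfl
  mapId D := mapXctId D
  mapComp F G := mapXctComp F G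
  map₂_whisker_left F G H s := hom₂_ext fun X =>
    IsTracked.ext (X := mapObj (F.comp G) X) (Y := mapObj (F.comp H) X)
    (isTracked_mapHom₂ (EED.whiskerLeft F s) X)
      ((isTracked_mapComp_hom F G X).comp
        ((isTracked_mapHom₂ s (mapObj F X)).comp (isTracked_mapComp_inv F H X)))
      (sandwich _)
  map₂_whisker_right {_ _ _ F G} s H := hom₂_ext fun X =>
    IsTracked.ext (X := mapObj (EED.Hom.comp F H) X) (Y := mapObj (EED.Hom.comp G H) X)
    (isTracked_mapHom₂ (EED.whiskerRight s H) X)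
      ((isTracked_mapComp_hom F H X).comp
        (((isTracked_mapHom₂ s X).map H).comp (isTracked_mapComp_inv G H X)))
      (sandwich _)
  map₂_associator F G H := hom₂_ext fun X =>
    IsTracked.ext (X := mapObj (EED.Hom.comp (EED.Hom.comp F G) H) X)
      (Y := mapObj (EED.Hom.comp F (EED.Hom.comp G H)) X) (isTracked_mapHom₂ (α_ F G H).hom X)
      ((isTracked_mapComp_hom (EED.Hom.comp F G) H X).comp
        (((isTracked_mapComp_hom F G X).map H).comp ((isTracked_id _).comp
          ((isTracked_mapComp_inv G H (mapObj F X)).comp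
            (isTracked_mapComp_inv F (EED.Hom.comp G H) X)))))
      (id_eq_comp_map_id_comp₃ H.F _)
  map₂_left_unitor F := hom₂_ext fun X =>
    IsTracked.ext (X := mapObj (EED.Hom.comp (EED.Hom.id _) F) X) (Y := mapObj F X)
      (isTracked_mapHom₂ (λ_ F).hom X)
      ((isTracked_mapComp_hom (EED.Hom.id _) F X).comp
        (((isTracked_mapId_hom X).map F).comp (isTracked_id _)))
      (id_eq_comp_map_id_comp F.F _)
  map₂_right_unitor F := hom₂_ext fun X =>
    IsTracked.ext (X := mapObj (EED.Hom.comp F (EED.Hom.id _)) X) (Y := mapObj F X)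
      (isTracked_mapHom₂ (ρ_ F).hom X)
      ((isTracked_mapComp_hom F (EED.Hom.id _) X).comp
        ((isTracked_mapId_hom (mapObj F X)).comp (isTracked_id _)))
      (sandwich _)

end TP

/-! ### The unit as a pseudonatural transformation -/

namespace TP
variable {D E K : EED.{u}}

theorem isTracked_unitNat_hom (F : EED.Hom D E) (A : D.C) :
    IsTracked (X := disc (F.F.obj A)) (Y := mapObj F (disc A))
      ((EED.Hom₂.θ (unitNat F).hom).app A) (𝟙 (F.F.obj A)) :=
  isTracked_track (X := disc (F.F.obj A)) (Y := mapObj F (disc A)) (tracks_hom (mapDisc_iff F))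

theorem isTracked_discFunctor_map {A B : D.C} (f : A ⟶ B) :
    IsTracked (X := disc A) (Y := disc B) ((discFunctor D).map f) f :=
  isTracked_track (X := disc A) (Y := disc B) (tracks_disc f)

theorem id_comp_id_eq_comp_map_id_comp {C C' : Type*} [Category* C] [Category* C'] (F : C ⥤ C')
    (A : C) :
    𝟙 (F.obj A) ≫ 𝟙 _ ≫ 𝟙 _ = 𝟙 _ ≫ 𝟙 _ ≫ 𝟙 _ ≫ 𝟙 _ ≫ F.map (𝟙 A) ≫ 𝟙 _ := by simp

/-- The unit of the biadjunction. -/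
def unitTrans : Pseudofunctor.StrongTrans (Pseudofunctor.id EED.{u})
    (completionFunctor.comp Xct.subDoctrine) where
  app D := unitHom D
  naturality F := unitNat F
  naturality_naturality {D E F G} s := EED.Hom₂.ext (NatTrans.ext (funext fun A =>
    IsTracked.ext (X := disc (F.F.obj A)) (Y := mapObj G (disc A))
      ((isTracked_discFunctor_map (s.θ.app A)).comp (isTracked_unitNat_hom G A))
      ((isTracked_unitNat_hom F A).comp (isTracked_mapHom₂ s (disc A)))
      ((Category.comp_id _).trans (Category.id_comp _).symm)))
  naturality_id D := EED.Hom₂.ext (NatTrans.ext (funext fun A =>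
    IsTracked.ext (X := disc A) (Y := disc A)
      ((isTracked_unitNat_hom (EED.Hom.id D) A).comp
        ((isTracked_mapId_hom (disc A)).comp (isTracked_id _)))
      ((isTracked_discFunctor_map (𝟙 A)).comp ((isTracked_id _).comp (isTracked_id _)))
      rfl))
  naturality_comp {D E K} F G := EED.Hom₂.ext (NatTrans.ext (funext fun A =>
    IsTracked.ext (X := disc (G.F.obj (F.F.obj A))) (Y := mapObj G (mapObj F (disc A)))
      ((isTracked_unitNat_hom (EED.Hom.comp F G) A).comp
        ((isTracked_mapComp_hom F G (disc A)).comp (isTracked_id _)))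
      ((isTracked_discFunctor_map (𝟙 (G.F.obj (F.F.obj A)))).comp ((isTracked_id _).comp
        ((isTracked_unitNat_hom G (F.F.obj A)).comp ((isTracked_id _).comp
          (((isTracked_unitNat_hom F A).map G).comp (isTracked_id _))))))
      (id_comp_id_eq_comp_map_id_comp G.F _)))

end TP

end

end ExactCompletion

theorem mainTheorem2 :
    ∃ (hT : ∀ D : ExactCompletion.EED.{u}, ExactCompletion.ExactCategory (ExactCompletion.TP D))
      (adj : ExactCompletion.LeftBiadjoint ExactCompletion.Xct.subDoctrine.{u}),
      ∀ D : ExactCompletion.EED.{u},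
        adj.L.obj D = { C := ExactCompletion.TP D, exact := hT D } :=
  ⟨fun _ => inferInstance,
    { L := ExactCompletion.TP.completionFunctor
      unit := ExactCompletion.TP.unitTrans
      isEquivalence := fun D X =>
        inferInstanceAs (ExactCompletion.TP.transposeUnit D X).IsEquivalence },
    fun _ => rfl⟩
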